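/- All graphs are simple. For a graph $G$, a vertex $v$ and an integer $r\ge 0$, the ball $B_{r/2}(v)$ is the subgraph of $G$ consisting of all vertices at distance at most $r/2$ from $v$ and all edges of $G$ whose endpoints' distances to $v$ sum to less than $r$. A graph is chordal if each of its cycles of length at least four has a chord, and $G$ is $r$-locally chordal if all balls $B_{r/2}(v)$ are chordal. Let $\mathbf K(G)$ be the graph whose nodes are the inclusion-maximal cliques of $G$, two distinct ones being adjacent if they meet; the edge $KL$ has weight $|K\cap L|$. A clique graph of $G$ is a spanning subgraph $H$ of $\mathbf K(G)$ such that $v\mapsto H_v$, where $H_v$ is the subgraph of $H$ induced on the maximal cliques containing $v$, is a region representation of $G$: each $H_v$ is nonempty and connected, and distinct $u,v$ are adjacent in $G$ if and only if $H_u$ and $H_v$ share a node. It is $r$-acyclic if $\bigcup_{x\in X}H_x$ is acyclic for every set $X$ of at most $r$ vertices. For a graph $G$ on $\{0,\dots,n-1\}$ and a vertex $v$, let $H^v$ be the result of the following procedure (Kruskal's algorithm on $\mathbf K(B_{3/2}(v))$). List the edges $e_1,\dots,e_m$ of $\mathbf K(B_{3/2}(v))$ by decreasing weight, where ties between two edges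 are decided by the lexicographic order on the unions of their respective ends (finite vertex sets being compared as increasing lists). Start from the edgeless graph on the nodes of $\mathbf K(B_{3/2}(v))$ and, for $i=1,\dots,m$, add $e_i$ unless this creates a cycle. Machine model. A processor is a unit-cost random access machine with private, initially blank registers and arrays holding natural numbers or sets of vertices. One step is one of the following: addition, truncated subtraction or loading a constant; an array access; reading the length or one entry of an adjacency list of $G$; an elementary operation on vertex sets (forming $\emptyset$, inserting a vertex, union, intersection, difference, cardinality, membership, lexicographic comparison); a test of a number for zero; outputting a node or an edge. In a parallel run there is one processor for each vertex $v$; it is given the number $v$ and read access to adjacency lists of $G$ (each in any order). The time of the run is the maximum number of steps of a processor, and the output of the run is the union of the graphs output by the processors. Theorem. There are a single program $P$ and a constant $C$ such that the following holds for every integer $r\ge 3$ and every $r$-locally chordal graph $G$ on $n\ge 1$ vertices $0,\dots,n-1$ with maximum degree $\Delta$. When $P$ is run in parallel on $n$ processors with input $G$, every processor halts within $C(\Delta^2\log\Delta+1)$ steps (where $\Delta^2\log\Delta:=0$ for $\Delta=0$), processor $v$ outputs $H^v$ (for each admissible listing of the edges of $\mathbf K(B_{3/2}(v))$, of which there is at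 least one), and the output $\bigcup_{v}H^v$ is an $r$-acyclic clique graph of $G$. (The program does not receive $r$.) -/

import Mathlib

namespace LocChordal

/-! ## Balls, chordality, local chordality -/

section Graphs

variable {V W : Type*}

/-- A graph is chordal if each of its cycles of length at least four has a chord, that is, an edge
of the graph that joins two vertices of the cycle and is not an edge of the cycle. -/
def IsChordal (G : SimpleGraph V) : Prop :=
  ∀ (v : V) (c : G.Walk v v), c.IsCycle → 4 ≤ c.length →
    ∃ x ∈ c.support, ∃ y ∈ c.support, G.Adj x y ∧ s(x, y) ∉ c.edges

/-- The ball `B_{r/2}(v)`: its vertices are those at distance at most `r/2` from `v`, its edges are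
the edges of `G` whose ends have distances to `v` summing to strictly less than `r`.
The extended distance `edist` is infinite between different components. -/
noncomputable def ball (G : SimpleGraph V) (v : V) (r : ℕ) : G.Subgraph where
  verts := {u | 2 * G.edist v u ≤ r}
  Adj u w := G.Adj u w ∧ 2 * G.edist v u ≤ r ∧ 2 * G.edist v w ≤ r ∧
    G.edist v u + G.edist v w < r
  adj_sub h := h.1
  edge_vert h := h.2.1
  symm := ⟨fun _ _ h => ⟨h.1.symm, h.2.2.1, h.2.1, by rw [add_comm]; exact h.2.2.2⟩⟩

/-- `G` is `r`-locally chordal if all its balls of radius `r/2` are chordal. (Passing to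
`spanningCoe` only adds isolated vertices, which lie on no cycle.) -/
def IsLocallyChordal (r : ℕ) (G : SimpleGraph V) : Prop :=
  ∀ v : V, IsChordal (ball G v r).spanningCoe

/-! ## Region representations and acyclic families -/

/-- The assignment `v ↦ R v` is a region representation of `G` over the graph `H`: each `R v` is a
nonempty connected subgraph of `H`, and distinct vertices `u`, `v` are adjacent in `G` exactly if
`R u` and `R v` share a node. (All graphs here are subgraphs of an ambient graph `X`.) -/
def IsRegionRepresentation (G : SimpleGraph V) {X : SimpleGraph W} (H : X.Subgraph)
    (R : V → X.Subgraph) : Prop :=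
  (∀ v, R v ≤ H) ∧ (∀ v, (R v).Connected) ∧
    ∀ u v, u ≠ v → (G.Adj u v ↔ ((R u).verts ∩ (R v).verts).Nonempty)

/-- The subgraph has no cycle. (`spanningCoe` only adds isolated vertices.) -/
def IsAcyclicSubgraph {X : SimpleGraph W} (T : X.Subgraph) : Prop :=
  T.spanningCoe.IsAcyclic

/-- A family of subgraphs is `r`-acyclic if every union of at most `r` of its members is acyclic. -/
def IsAcyclicFamily (r : ℕ) {X : SimpleGraph W} (R : V → X.Subgraph) : Prop :=
  ∀ Y : Finset V, Y.card ≤ r → IsAcyclicSubgraph (⨆ y ∈ Y, R y)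

/-! ## Maximal cliques, their intersection graph, and clique graphs -/

/-- A graph whose nodes are finite vertex-sets (a subgraph of the complete graph on all of them). -/
abbrev NodeGraph (V : Type*) := (⊤ : SimpleGraph (Finset V)).Subgraph

/-- The set of inclusion-wise maximal cliques of a subgraph `S` of `G`.
For `G` itself take `S = ⊤`. -/
def maxCliques {G : SimpleGraph V} (S : G.Subgraph) : Set (Finset V) :=
  {K | Maximal (fun K : Finset V => (K : Set V) ⊆ S.verts ∧ S.spanningCoe.IsClique (K : Set V)) K}

/-- The intersection graph of the maximal cliques of `S`: two distinct maximal cliques are adjacent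
if they meet. -/
def cliqueIntersectionGraph {G : SimpleGraph V} (S : G.Subgraph) : NodeGraph V where
  verts := maxCliques S
  Adj K L := K ∈ maxCliques S ∧ L ∈ maxCliques S ∧ K ≠ L ∧ ∃ x, x ∈ K ∧ x ∈ L
  adj_sub h := h.2.2.1
  edge_vert h := h.1
  symm := ⟨fun _ _ h => ⟨h.2.1, h.1, h.2.2.1.symm, h.2.2.2.imp fun _ hx => ⟨hx.2, hx.1⟩⟩⟩

/-- For a graph `H` on the maximal cliques of `G`: the subgraph of `H` induced on the set of all
maximal cliques of `G` that contain `v`. -/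
def coPart (G : SimpleGraph V) (H : NodeGraph V) (v : V) : NodeGraph V :=
  H.induce {K | K ∈ maxCliques (⊤ : G.Subgraph) ∧ v ∈ K}

/-- `H` is a clique graph of `G`: a spanning subgraph of the intersection graph of the maximal
cliques of `G` whose co-parts form a region representation of `G` over `H`. -/
def IsCliqueGraph (G : SimpleGraph V) (H : NodeGraph V) : Prop :=
  H ≤ cliqueIntersectionGraph (⊤ : G.Subgraph) ∧
    H.verts = maxCliques (⊤ : G.Subgraph) ∧
    IsRegionRepresentation G H (coPart G H)

/-- An `r`-acyclic clique graph: the corresponding region representation is `r`-acyclic. -/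
def IsAcyclicCliqueGraph (r : ℕ) (G : SimpleGraph V) (H : NodeGraph V) : Prop :=
  IsCliqueGraph G H ∧ IsAcyclicFamily r (coPart G H)

end Graphs

/-! ## Kruskal's algorithm with lexicographic tie-breaking -/

section Kruskal

variable {V : Type*} [LinearOrder V]

/-- The weight `|K ∩ L|` of the edge `KL`. -/
def weight : Sym2 (Finset V) → ℕ :=
  Sym2.lift ⟨fun K L => (K ∩ L).card, fun K L => by simp only [Finset.inter_comm]⟩

/-- The union `K ∪ L` of the ends of the edge `KL`, as the increasing list of its elements. -/
def endsList : Sym2 (Finset V) → List V :=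
  Sym2.lift ⟨fun K L => (K ∪ L).sort (· ≤ ·), fun K L => by simp only [Finset.union_comm]⟩

/-- `e` may be listed before `f`: larger weight first, ties decided by the lexicographic order on
the unions of the ends. -/
def Precedes (e f : Sym2 (Finset V)) : Prop :=
  weight f < weight e ∨ (weight e = weight f ∧ endsList e ≤ endsList f)

/-- `l` lists each edge of `K` exactly once, in decreasing order of weight, with ties decided by
the lexicographic order on the union of the ends. -/
def IsKruskalOrder (K : NodeGraph V) (l : List (Sym2 (Finset V))) : Prop :=
  l.Nodup ∧ (∀ e, e ∈ l ↔ e ∈ K.edgeSet) ∧ l.Pairwise Precedes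

/-- The edgeless graph on the node set `N`. -/
def edgeless (N : Set (Finset V)) : NodeGraph V where
  verts := N
  Adj _ _ := False
  adj_sub h := h.elim
  edge_vert h := h.elim
  symm := ⟨fun _ _ h => h⟩

/-- The graph `T + e`. -/
def addEdge (T : NodeGraph V) (e : Sym2 (Finset V)) : NodeGraph V where
  verts := T.verts ∪ {K | K ∈ e}
  Adj K L := T.Adj K L ∨ (K ≠ L ∧ s(K, L) = e)
  adj_sub h := h.elim (fun h => T.adj_sub h) (fun h => h.1)
  edge_vert {K L} h := h.elim (fun h => Or.inl (T.edge_vert h))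
    (fun h => Or.inr (show K ∈ e from h.2 ▸ Sym2.mem_mk_left K L))
  symm := ⟨fun _ _ h => h.elim (fun h => Or.inl (T.adj_symm h))
    (fun h => Or.inr ⟨h.1.symm, by rw [Sym2.eq_swap]; exact h.2⟩)⟩

open Classical in
/-- One step of Kruskal's algorithm: add `e` unless this creates a cycle. -/
noncomputable def kruskalStep (T : NodeGraph V) (e : Sym2 (Finset V)) : NodeGraph V :=
  if IsAcyclicSubgraph (addEdge T e) then addEdge T e else T

/-- Kruskal's algorithm on `K` with its edges listed as `l`. -/
noncomputable def kruskal (K : NodeGraph V) (l : List (Sym2 (Finset V))) : NodeGraph V :=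
  l.foldl kruskalStep (edgeless K.verts)

end Kruskal

/-! ## The machine model

A processor is a unit-cost random access machine with registers and arrays of two sorts, natural
numbers and sets of vertices. Number arithmetic is addition and truncated subtraction only.
An elementary operation on vertex sets (union, intersection, difference, cardinality, membership,
insertion, lexicographic comparison) is one step, so that comparing the weights of two edges, or
breaking a tie, takes constant time.
The vertices are `0, …, n-1`, and the only access to the input graph is by
reading its adjacency lists, one entry at a time. A program is a finite text, independent of `n`
and of the input graph. -/

section Machine

/-- `A` is an adjacency list representation of `G` (each list in any order). -/
def IsAdjList {n : ℕ} (G : SimpleGraph (Fin n)) (A : Fin n → List (Fin n)) : Prop :=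
  ∀ u, (A u).Nodup ∧ ∀ w, w ∈ A u ↔ G.Adj u w

/-- Elementary instructions. `x y z` are number registers, `a b c` are set registers, `k` names an
array. -/
inductive Instr
  /-- `x := m` -/
  | const (x m : ℕ)
  /-- `x := y + z` -/
  | add (x y z : ℕ)
  /-- `x := y - z` (truncated) -/
  | sub (x y z : ℕ)
  /-- `x := numArray k [y]` -/
  | load (x k y : ℕ)
  /-- `numArray k [x] := y` -/
  | store (k x y : ℕ)
  /-- `x :=` the length of the adjacency list of vertex `y` -/
  | deg (x y : ℕ)
  /-- `x :=` the entry number `z` of the adjacency list of vertex `y` -/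
  | nbr (x y z : ℕ)
  /-- `a := ∅` -/
  | sempty (a : ℕ)
  /-- `a := a ∪ {x}` -/
  | sinsert (a x : ℕ)
  /-- `a := b ∪ c` -/
  | sunion (a b c : ℕ)
  /-- `a := b ∩ c` -/
  | sinter (a b c : ℕ)
  /-- `a := b \ c` -/
  | sdiff (a b c : ℕ)
  /-- `x := |a|` -/
  | scard (x a : ℕ)
  /-- `x := 1` if `y ∈ a`, else `x := 0` -/
  | smem (x y a : ℕ)
  /-- `x := 1` if `a` is lexicographically smaller than `b`, else `x := 0` -/
  | slex (x a b : ℕ)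
  /-- `a := setArray k [y]` -/
  | sload (a k y : ℕ)
  /-- `setArray k [x] := a` -/
  | sstore (k x a : ℕ)
  /-- output the node `a` -/
  | emitNode (a : ℕ)
  /-- output the edge `ab` -/
  | emitEdge (a b : ℕ)

/-- Programs; tests compare a number register with zero. -/
inductive Prog
  | instr (i : Instr)
  | seq (p q : Prog)
  | branch (x : ℕ) (p q : Prog)
  | loop (x : ℕ) (p : Prog)

/-- The private memory and the output so far of one processor. -/
structure State (n : ℕ) where
  reg : ℕ → ℕ
  arr : ℕ → ℕ → ℕ
  sreg : ℕ → Finset (Fin n)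
  sarr : ℕ → ℕ → Finset (Fin n)
  nodes : List (Finset (Fin n))
  edges : List (Finset (Fin n) × Finset (Fin n))

variable {n : ℕ}

/-- The adjacency list of the vertex with number `u` (empty if there is no such vertex). -/
def adjAt (A : Fin n → List (Fin n)) (u : ℕ) : List (Fin n) :=
  if h : u < n then A ⟨u, h⟩ else []

/-- The effect of one instruction. -/
def Instr.exec (A : Fin n → List (Fin n)) (i : Instr) (s : State n) : State n :=
  let setReg (x m : ℕ) : State n := { s with reg := Function.update s.reg x m }
  let setSReg (a : ℕ) (S : Finset (Fin n)) : State n :=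
    { s with sreg := Function.update s.sreg a S }
  match i with
  | .const x m => setReg x m
  | .add x y z => setReg x (s.reg y + s.reg z)
  | .sub x y z => setReg x (s.reg y - s.reg z)
  | .load x k y => setReg x (s.arr k (s.reg y))
  | .store k x y =>
    { s with arr := Function.update s.arr k (Function.update (s.arr k) (s.reg x) (s.reg y)) }
  | .deg x y => setReg x (adjAt A (s.reg y)).length
  | .nbr x y z => setReg x (((adjAt A (s.reg y))[s.reg z]?).elim 0 Fin.val)
  | .sempty a => setSReg a ∅
  | .sinsert a x =>
    setSReg a (if h : s.reg x < n then insert ⟨s.reg x, h⟩ (s.sreg a) else s.sreg a)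
  | .sunion a b c => setSReg a (s.sreg b ∪ s.sreg c)
  | .sinter a b c => setSReg a (s.sreg b ∩ s.sreg c)
  | .sdiff a b c => setSReg a (s.sreg b \ s.sreg c)
  | .scard x a => setReg x (s.sreg a).card
  | .smem x y a => setReg x (if ∃ u ∈ s.sreg a, u.val = s.reg y then 1 else 0)
  | .slex x a b =>
    setReg x (if (s.sreg a).sort (· ≤ ·) < (s.sreg b).sort (· ≤ ·) then 1 else 0)
  | .sload a k y => setSReg a (s.sarr k (s.reg y))
  | .sstore k x a =>
    { s with sarr := Function.update s.sarr k (Function.update (s.sarr k) (s.reg x) (s.sreg a)) }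
  | .emitNode a => { s with nodes := s.sreg a :: s.nodes }
  | .emitEdge a b => { s with edges := (s.sreg a, s.sreg b) :: s.edges }

/-- `Runs A p s t s'`: on the input `A`, program `p` started in state `s` halts after exactly `t`
steps in state `s'`. Every instruction and every test is one step. -/
inductive Runs (A : Fin n → List (Fin n)) : Prog → State n → ℕ → State n → Prop
  | instr (i : Instr) (s : State n) : Runs A (.instr i) s 1 (i.exec A s)
  | seq {p q : Prog} {s s' s'' : State n} {t t' : ℕ} :
      Runs A p s t s' → Runs A q s' t' s'' → Runs A (.seq p q) s (t + t') s''
  | branch_true {x : ℕ} {p q : Prog} {s s' : State n} {t : ℕ} :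
      s.reg x ≠ 0 → Runs A p s t s' → Runs A (.branch x p q) s (t + 1) s'
  | branch_false {x : ℕ} {p q : Prog} {s s' : State n} {t : ℕ} :
      s.reg x = 0 → Runs A q s t s' → Runs A (.branch x p q) s (t + 1) s'
  | loop_true {x : ℕ} {p : Prog} {s s' s'' : State n} {t t' : ℕ} :
      s.reg x ≠ 0 → Runs A p s t s' → Runs A (.loop x p) s' t' s'' →
        Runs A (.loop x p) s (t + t' + 1) s''
  | loop_false {x : ℕ} {p : Prog} {s : State n} :
      s.reg x = 0 → Runs A (.loop x p) s 1 s

/-- The initial state of processor `v`: register `0` holds `v`, all other memory is blank. -/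
def initState (v : Fin n) : State n where
  reg := Function.update (fun _ => 0) 0 v.val
  arr _ _ := 0
  sreg _ := ∅
  sarr _ _ := ∅
  nodes := []
  edges := []

/-- The graph described by the output of a processor. -/
def State.outputGraph (s : State n) : NodeGraph (Fin n) where
  verts := {K | K ∈ s.nodes ∨ ∃ L, (K, L) ∈ s.edges ∨ (L, K) ∈ s.edges}
  Adj K L := K ≠ L ∧ ((K, L) ∈ s.edges ∨ (L, K) ∈ s.edges)
  adj_sub h := h.1
  edge_vert {_ L} h := Or.inr ⟨L, h.2⟩
  symm := ⟨fun _ _ h => ⟨h.1.symm, h.2.symm⟩⟩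

/-- Run `P` in parallel on `n` processors, one for each vertex, each with its own private memory:
every processor halts within `T` steps, and processor `v` outputs the graph `out v`. -/
def ParallelRun (P : Prog) (A : Fin n → List (Fin n)) (T : ℕ)
    (out : Fin n → NodeGraph (Fin n)) : Prop :=
  ∀ v, ∃ t s, t ≤ T ∧ Runs A P (initState v) t s ∧ s.outputGraph = out v

end Machine

end LocChordal

/-!
For `r ≥ 3` the ball `B_{3/2}(v)` has the vertices of the closed neighbourhood `N[v]`, and its
maximal cliques are those maximal cliques of `G` that contain `v`; local chordality makes `G[N[v]]`
chordal. So everything is about the maximal cliques through `v` of a graph that is chordal on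
`N[v]`, and about how the results for different `v` fit together.

*Ties do not occur.* Of two maximal cliques `K ≠ L` of a chordal graph, `K` has a vertex outside `L`
without neighbours in `L \ K`, so that `K` and `L` are the only maximal cliques in `K ∪ L` that
contain this vertex or its counterpart in `L` (`mk_eq_mk_of_union_eq`). Hence no two edges of
`K(B_{3/2}(v))` have the same union of ends, their admissible listing is unique, and so is the
result `H^v` of Kruskal's algorithm. It is characterized by `IsKruskalTree`: it is a forest in which
the ends of each edge `e` of `K(B_{3/2}(v))` are joined by edges not listed after `e`.

*Local trees.* `H^v` is a clique tree: for `v ∈ X`, its nodes that include `X` induce a connected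
graph (`IsKruskalTree.reachable_nodesAbove`). Since the listing orders do not depend on `v`, this
implies that `H^u` and `H^v` agree on the cliques that contain both `u` and `v`
(`IsKruskalTree.adj_of_adj`). So the part of `⋃ H^v` on the cliques that contain `v` is `H^v`, and
`⋃ H^v` is a clique graph.

*Acyclicity.* A set `Y` of at most `r` vertices induces a chordal graph, since a cycle of length at
most `r` lies in a ball `B_{r/2}` (`IsLocallyChordal.chordalOn_of_card_le`). Removing a simplicial
vertex `x` of `G[Y]`, the tree `H^x` meets the union of the remaining ones in the union of its
subtrees on the cliques that contain `x` and a given neighbour `y ∈ Y` of `x`. All these subtrees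
contain every maximal clique that includes `x` and its neighbours in `Y`, so `H^x` is glued on along
a connected set, and induction shows that the union is a forest (`isAcyclic_biSup`).

*The program.* A maximum cardinality search of `G[N[v]]` visits the vertices in the reverse of a
perfect elimination order (`IsMCS.isClique_inter`). So each visited vertex forms a clique with its
earlier neighbours; there are at most `Δ + 1` of these cliques, and they include all maximal ones,
which are those that lie in no neighbourhood of a vertex of `N[v]`. Then `H^v` is found without
sorting the edges: Prim's algorithm always adds the least edge that leaves the current tree, which
is an edge of `H^v` by the cut property (`IsKruskalTree.adj_of_forall_precedes`). With one step per
operation on vertex sets, each of these parts takes `O((Δ + 1)²)` steps, which is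
`O(Δ² log Δ + 1)`.
-/

namespace LocChordal

/-! ### Induced paths and chordality on a vertex set -/

section InducedPaths

variable {V : Type*}

/-- The vertices `f 0, …, f k` form an induced path of `G`, in this order. -/
structure IsInducedPath (G : SimpleGraph V) (f : ℕ → V) (k : ℕ) : Prop where
  ne : ∀ i j, i < j → j ≤ k → f i ≠ f j
  adj : ∀ i j, i < j → j ≤ k → (G.Adj (f i) (f j) ↔ i + 1 = j)

/-- Chordality of `G[X]` in the form in which it is used: a vertex that is adjacent to both ends of
an induced path of length at least two, and does not lie on it, is adjacent to an inner vertex. -/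
def ChordalOn (G : SimpleGraph V) (X : Set V) : Prop :=
  ∀ (f : ℕ → V) (k : ℕ) (x : V), 2 ≤ k → IsInducedPath G f k → (∀ i ≤ k, f i ∈ X) → x ∈ X →
    (∀ i ≤ k, f i ≠ x) → G.Adj x (f 0) → G.Adj x (f k) → ∃ j, 0 < j ∧ j < k ∧ G.Adj x (f j)

variable {G : SimpleGraph V} {f : ℕ → V} {k : ℕ}

lemma IsInducedPath.mono {j : ℕ} (h : IsInducedPath G f k) (hj : j ≤ k) : IsInducedPath G f j :=
  ⟨fun i i' h1 h2 => h.ne i i' h1 (h2.trans hj), fun i i' h1 h2 => h.adj i i' h1 (h2.trans hj)⟩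

lemma IsInducedPath.shift {j : ℕ} (h : IsInducedPath G f k) (hj : j ≤ k) :
    IsInducedPath G (fun i => f (i + j)) (k - j) :=
  ⟨fun i i' h1 h2 => h.ne _ _ (by omega) (by omega),
    fun i i' h1 h2 => (h.adj _ _ (by omega) (by omega)).trans (by omega)⟩

lemma IsInducedPath.reverse (h : IsInducedPath G f k) :
    IsInducedPath G (fun i => f (k - i)) k :=
  ⟨fun i i' h1 h2 => (h.ne _ _ (by omega) (by omega)).symm,
    fun i i' h1 h2 => by
      rw [G.adj_comm]
      exact (h.adj _ _ (by omega) (by omega)).trans (by omega)⟩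

/-- Appending a new neighbour `d` of the last vertex to an induced path: going to `d` from the
first vertex that is adjacent to `d` gives an induced path again. -/
lemma IsInducedPath.exists_extend (h : IsInducedPath G f k) {d : V} (hd : G.Adj (f k) d)
    (hne : ∀ i ≤ k, f i ≠ d) :
    ∃ g j, j ≤ k ∧ IsInducedPath G g (j + 1) ∧ (∀ i ≤ j, g i = f i) ∧ g (j + 1) = d ∧
      G.Adj (f j) d := by
  classical
  have hex : ∃ j, G.Adj (f j) d := ⟨k, hd⟩
  have hj := Nat.find_spec hex
  have hmin : ∀ i < Nat.find hex, ¬ G.Adj (f i) d := fun i hi => Nat.find_min hex hi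
  have hjk : Nat.find hex ≤ k := Nat.find_min' hex hd
  generalize Nat.find hex = j at hj hmin hjk
  refine ⟨fun i => if i ≤ j then f i else d, j, hjk, ⟨?_, ?_⟩, ?_, ?_, hj⟩
  · intro i i' h1 h2
    have h3 : i ≤ j := by omega
    rcases Nat.lt_or_ge j i' with h4 | h4
    · simpa [h3, h4.not_ge] using hne i (h3.trans hjk)
    · simpa [h3, h4] using h.ne i i' h1 (by omega)
  · intro i i' h1 h2
    have h3 : i ≤ j := by omega
    rcases Nat.lt_or_ge j i' with h4 | h4
    · simp only [h3, h4.not_ge, if_true, if_false]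
      constructor
      · intro h5
        by_contra h6
        exact hmin i (by omega) h5
      · intro h5
        obtain rfl : i = j := by omega
        exact hj
    · simpa [h3, h4] using h.adj i i' h1 (by omega)
  · intro i hi; simp [hi]
  · simp

/-- Two vertices joined in a graph are joined by an induced path. -/
lemma exists_isInducedPath_of_reachable {a b : V} (h : G.Reachable a b) :
    ∃ f k, IsInducedPath G f k ∧ f 0 = a ∧ f k = b := by
  obtain ⟨p⟩ := h
  induction p using SimpleGraph.Walk.concatRec with
  | Hnil => exact ⟨fun _ => _, 0, ⟨by intros; omega, by intros; omega⟩, rfl, rfl⟩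
  | Hconcat p hadj ih =>
    obtain ⟨f, k, hf, h0, hk⟩ := ih
    rename_i u v w
    by_cases hw : ∃ i ≤ k, f i = w
    · obtain ⟨i, hi, rfl⟩ := hw
      exact ⟨f, i, hf.mono hi, h0, rfl⟩
    · push Not at hw
      obtain ⟨g, j, hjk, hg, hgf, hgd, -⟩ := hf.exists_extend (hk ▸ hadj) hw
      exact ⟨g, j + 1, hg, by rw [hgf 0 (by omega), h0], hgd⟩

/-- In a chordal graph, a vertex adjacent to both ends of an induced path is adjacent to all of its
vertices. -/
lemma ChordalOn.adj_of_adj_ends {X : Set V} (hX : ChordalOn G X) {x : V} (hx : x ∈ X)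
    (hf : IsInducedPath G f k) (hfX : ∀ i ≤ k, f i ∈ X) (hne : ∀ i ≤ k, f i ≠ x)
    (h0 : G.Adj x (f 0)) (hk : G.Adj x (f k)) : ∀ i ≤ k, G.Adj x (f i) := by
  induction k using Nat.strong_induction_on generalizing f with
  | _ k ih =>
    intro i hi
    rcases Nat.lt_or_ge k 2 with hk2 | hk2
    · rcases Nat.eq_zero_or_pos i with rfl | h
      · exact h0
      · obtain rfl : i = k := by omega
        exact hk
    · obtain ⟨j, hj0, hjk, hj⟩ := hX f k x hk2 hf hfX hx hne h0 hk
      rcases Nat.le_total i j with hij | hij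
      · exact ih j hjk (hf.mono hjk.le) (fun i hi => hfX i (by omega))
          (fun i hi => hne i (by omega)) h0 hj i hij
      · have := ih (k - j) (by omega) (hf.shift hjk.le) (fun i hi => hfX _ (by omega))
          (fun i hi => hne _ (by omega)) (by simpa using hj)
          (by simpa [Nat.sub_add_cancel hjk.le] using hk) (i - j) (by omega)
        simpa [Nat.sub_add_cancel hij] using this

/-- The walk through `f 0, …, f k`. -/
def walkOfFun (f : ℕ → V) : (k : ℕ) → (∀ i < k, G.Adj (f i) (f (i + 1))) → G.Walk (f 0) (f k)
  | 0, _ => .nil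
  | k + 1, h => (walkOfFun f k fun i hi => h i (by omega)).concat (h k (by omega))

lemma support_walkOfFun (f : ℕ → V) (k : ℕ) (h : ∀ i < k, G.Adj (f i) (f (i + 1))) :
    (walkOfFun f k h).support = (List.range (k + 1)).map f := by
  induction k with
  | zero => simp [walkOfFun]
  | succ k ih =>
    rw [walkOfFun, SimpleGraph.Walk.support_concat, ih, List.range_succ (n := k + 1)]
    simp

lemma edges_walkOfFun (f : ℕ → V) (k : ℕ) (h : ∀ i < k, G.Adj (f i) (f (i + 1))) :
    (walkOfFun f k h).edges = (List.range k).map fun i => s(f i, f (i + 1)) := by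
  induction k with
  | zero => simp [walkOfFun]
  | succ k ih =>
    rw [walkOfFun, SimpleGraph.Walk.edges_concat, ih, List.range_succ]
    simp

lemma length_walkOfFun (f : ℕ → V) (k : ℕ) (h : ∀ i < k, G.Adj (f i) (f (i + 1))) :
    (walkOfFun f k h).length = k := by
  induction k with
  | zero => simp [walkOfFun]
  | succ k ih => rw [walkOfFun, SimpleGraph.Walk.length_concat, ih]

/-- An induced path of `G` together with a common neighbour `x` of its ends forms a cycle; if that
cycle lies in a chordal subgraph `B` of `G`, then `x` is adjacent to an inner vertex of the path. -/
lemma IsChordal.exists_adj_inner {B : SimpleGraph V} (hB : IsChordal B) (hBG : B ≤ G)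
    (hf : IsInducedPath G f k) (hk : 2 ≤ k) {x : V} (hne : ∀ i ≤ k, f i ≠ x)
    (hfB : ∀ i < k, B.Adj (f i) (f (i + 1))) (h0 : B.Adj x (f 0)) (h1 : B.Adj x (f k)) :
    ∃ j, 0 < j ∧ j < k ∧ G.Adj x (f j) := by
  set p := (walkOfFun f k hfB).concat h1.symm with hp
  have hsupp : p.support = (List.range (k + 1)).map f ++ [x] := by
    rw [hp, SimpleGraph.Walk.support_concat, support_walkOfFun]
  have hedges : p.edges = (List.range k).map (fun i => s(f i, f (i + 1))) ++ [s(f k, x)] := by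
    rw [hp, SimpleGraph.Walk.edges_concat, edges_walkOfFun]; simp
  have hnd : ((List.range (k + 1)).map f).Nodup := by
    refine List.Nodup.map_on ?_ List.nodup_range
    intro i hi j hj hij
    simp only [List.mem_range] at hi hj
    rcases lt_trichotomy i j with h | h | h
    · exact absurd hij (hf.ne i j h (by omega))
    · exact h
    · exact absurd hij.symm (hf.ne j i h (by omega))
  have hpath : p.IsPath := by
    rw [SimpleGraph.Walk.isPath_def, hsupp]
    refine List.Nodup.append hnd (by simp) ?_
    rw [List.disjoint_singleton]
    simp only [List.mem_map, List.mem_range, not_exists, not_and]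
    intro i hi
    exact hne i (by omega)
  have hcyc : (SimpleGraph.Walk.cons h0 p).IsCycle := by
    rw [SimpleGraph.Walk.cons_isCycle_iff]
    refine ⟨hpath, ?_⟩
    rw [hedges]
    simp only [List.mem_append, List.mem_map, List.mem_range, List.mem_singleton, not_or,
      not_exists, not_and]
    constructor
    · intro i hi h
      have : x ∈ s(f i, f (i + 1)) := by rw [h]; simp
      rcases Sym2.mem_iff.1 this with h | h
      · exact hne i (by omega) h.symm
      · exact hne (i + 1) (by omega) h.symm
    · intro h
      have : f 0 ∈ s(f k, x) := by rw [← h]; simp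
      rcases Sym2.mem_iff.1 this with h | h
      · exact hf.ne 0 k (by omega) le_rfl h
      · exact hne 0 (by omega) h
  have hlen : 4 ≤ (SimpleGraph.Walk.cons h0 p).length := by
    rw [SimpleGraph.Walk.length_cons, hp, SimpleGraph.Walk.length_concat, length_walkOfFun]
    omega
  obtain ⟨y, hy, z, hz, hyz, hnot⟩ := hB x _ hcyc hlen
  have hmem : ∀ y ∈ (SimpleGraph.Walk.cons h0 p).support, y = x ∨ ∃ i ≤ k, f i = y := by
    intro y hy
    rw [SimpleGraph.Walk.support_cons, hsupp] at hy
    simp only [List.mem_cons, List.mem_append, List.mem_map, List.mem_range, List.not_mem_nil,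
      or_false] at hy
    rcases hy with h | ⟨i, hi, h⟩ | h
    · exact Or.inl h
    · exact Or.inr ⟨i, by omega, h⟩
    · exact Or.inl h
  rw [SimpleGraph.Walk.edges_cons, hedges] at hnot
  simp only [List.mem_cons, List.mem_append, List.mem_map, List.mem_range, List.not_mem_nil,
    or_false, not_or, not_exists, not_and] at hnot
  obtain ⟨hn1, hn2, hn3⟩ := hnot
  -- A chord cannot join two vertices of the induced path, so it ends in `x`.
  have key : ∀ i ≤ k, B.Adj x (f i) → s(x, f i) ≠ s(x, f 0) → s(x, f i) ≠ s(f k, x) →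
      ∃ j, 0 < j ∧ j < k ∧ G.Adj x (f j) := by
    intro i hi hadj h2 h3
    refine ⟨i, ?_, ?_, hBG hadj⟩
    · rcases Nat.eq_zero_or_pos i with rfl | h
      · exact absurd rfl h2
      · exact h
    · rcases hi.lt_or_eq with h | rfl
      · exact h
      · exact absurd Sym2.eq_swap h3
  rcases hmem y hy with rfl | ⟨i, hi, rfl⟩ <;> rcases hmem z hz with rfl | ⟨j, hj, rfl⟩
  · exact absurd rfl hyz.ne
  · exact key j hj hyz hn1 hn3
  · rw [Sym2.eq_swap] at hn1 hn3
    exact key i hi hyz.symm hn1 hn3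
  · exfalso
    rcases lt_trichotomy i j with h | rfl | h
    · obtain rfl := (hf.adj i j h hj).1 (hBG hyz)
      exact hn2 i (by omega) rfl
    · exact absurd rfl hyz.ne
    · obtain rfl := (hf.adj j i h hi).1 (hBG hyz.symm)
      exact hn2 j (by omega) Sym2.eq_swap

end InducedPaths

/-! ### Maximum cardinality search -/

section MaximumCardinalitySearch

variable {V : Type*} [Fintype V] [DecidableEq V] (G : SimpleGraph V) [DecidableRel G.Adj]

/-- The list `l` records, latest vertex first, the beginning of a maximum cardinality search of
`G[X]`: each next vertex has the largest possible number of neighbours among the earlier ones. -/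
inductive IsMCS (X : Finset V) : List V → Prop
  | nil : IsMCS X []
  | cons {u : V} {l : List V} : IsMCS X l → u ∈ X → u ∉ l →
      (∀ w ∈ X, w ∉ l →
        (G.neighborFinset w ∩ l.toFinset).card ≤ (G.neighborFinset u ∩ l.toFinset).card) →
      IsMCS X (u :: l)

variable {G} {X : Finset V}

lemma IsMCS.subset {l : List V} (h : IsMCS G X l) : l.toFinset ⊆ X := by
  induction h with
  | nil => simp
  | cons _ hu _ _ ih =>
    intro w hw
    simp only [List.toFinset_cons, Finset.mem_insert] at hw
    rcases hw with rfl | hw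
    · exact hu
    · exact ih hw

lemma IsMCS.nodup {l : List V} (h : IsMCS G X l) : l.Nodup := by
  induction h with
  | nil => simp
  | cons _ _ hu _ ih => exact List.nodup_cons.2 ⟨hu, ih⟩

lemma IsMCS.length_le {l : List V} (h : IsMCS G X l) : l.length ≤ X.card := by
  rw [← List.toFinset_card_of_nodup h.nodup]
  exact Finset.card_le_card h.subset

variable (G X) in
lemma exists_isMCS (k : ℕ) (hk : k ≤ X.card) : ∃ l, IsMCS G X l ∧ l.length = k := by
  induction k with
  | zero => exact ⟨[], .nil, rfl⟩
  | succ k ih =>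
    obtain ⟨l, hl, hlk⟩ := ih (by omega)
    have hne : (X \ l.toFinset).Nonempty := by
      rw [← Finset.card_pos]
      have := Finset.le_card_sdiff l.toFinset X
      rw [List.toFinset_card_of_nodup hl.nodup] at this
      omega
    obtain ⟨u, hu, hmax⟩ := Finset.exists_max_image (X \ l.toFinset)
      (fun w => (G.neighborFinset w ∩ l.toFinset).card) hne
    simp only [Finset.mem_sdiff, List.mem_toFinset] at hu hmax
    exact ⟨u :: l, .cons hl hu.1 hu.2 fun w hw hwl => hmax w ⟨hw, hwl⟩, by simp [hlk]⟩

/-- During a maximum cardinality search of a chordal graph, no induced path of length at least two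
joins two visited vertices through unvisited ones. -/
lemma IsMCS.no_isInducedPath (hX : ChordalOn G X) {l : List V} (hl : IsMCS G X l)
    {f : ℕ → V} {k : ℕ} (hf : IsInducedPath G f k) (hk : 2 ≤ k) (h0 : f 0 ∈ l) (h1 : f k ∈ l)
    (hin : ∀ i, 0 < i → i < k → f i ∈ X ∧ f i ∉ l) : False := by
  induction hl generalizing f k with
  | nil => simp at h0
  | @cons b t ht hb hbt hmax ih =>
    have hsub := ht.subset
    have memX : ∀ {a}, a ∈ t → a ∈ X := fun h => hsub (List.mem_toFinset.2 h)
    -- The case of a path from the earlier visited vertices to the latest one.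
    have main : ∀ {f : ℕ → V} {k : ℕ}, IsInducedPath G f k → 2 ≤ k → f 0 ∈ t → f k = b →
        (∀ i, 0 < i → i < k → f i ∈ X ∧ f i ∉ b :: t) → False := by
      intro f k hf hk h0 hkb hin
      have h1X := hin 1 (by omega) (by omega)
      have hadj01 : G.Adj (f 0) (f 1) := (hf.adj 0 1 (by omega) (by omega)).2 rfl
      have hnadj0b : ¬ G.Adj (f 0) b := by
        rw [← hkb, hf.adj 0 k (by omega) le_rfl]; omega
      obtain ⟨d, hdt, hdb, hd1⟩ : ∃ d ∈ t, G.Adj b d ∧ ¬ G.Adj (f 1) d := by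
        by_contra! hcon
        have hlt : (G.neighborFinset b ∩ t.toFinset).card <
            (G.neighborFinset (f 1) ∩ t.toFinset).card := by
          refine Finset.card_lt_card ⟨fun w hw => ?_, fun hsub => ?_⟩
          · simp only [Finset.mem_inter, SimpleGraph.mem_neighborFinset, List.mem_toFinset] at hw ⊢
            exact ⟨hcon w hw.2 hw.1, hw.2⟩
          · have := @hsub (f 0) (by simp [hadj01.symm, h0])
            simp only [Finset.mem_inter, SimpleGraph.mem_neighborFinset] at this
            exact hnadj0b this.1.symm
        have := hmax (f 1) h1X.1 (fun h => h1X.2 (List.mem_cons_of_mem _ h))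
        omega
      have hinner : ∀ i, 0 < i → i ≤ k → f i ∈ X ∧ f i ∉ t := by
        intro i hi hik
        rcases hik.lt_or_eq with h | rfl
        · exact ⟨(hin i hi h).1, fun h' => (hin i hi h).2 (List.mem_cons_of_mem _ h')⟩
        · rw [hkb]; exact ⟨hb, hbt⟩
      have hfX : ∀ i ≤ k, f i ∈ (X : Set V) := by
        intro i hik
        rcases Nat.eq_zero_or_pos i with rfl | hi
        · exact memX h0
        · exact (hinner i hi hik).1
      have hfd : ∀ i ≤ k, f i ≠ d := by
        intro i hik h
        rcases Nat.eq_zero_or_pos i with rfl | hi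
        · exact hd1 (h ▸ hadj01.symm)
        · exact (hinner i hi hik).2 (h ▸ hdt)
      by_cases hd0 : G.Adj d (f 0)
      · exact hd1 (hX.adj_of_adj_ends (memX hdt) hf hfX hfd hd0 (hkb ▸ hdb.symm) 1
          (by omega)).symm
      · obtain ⟨g, j, hjk, hg, hgf, hgd, hjd⟩ := hf.exists_extend (hkb ▸ hdb) hfd
        have hj : 0 < j := by
          rcases Nat.eq_zero_or_pos j with rfl | h
          · exact absurd hjd.symm hd0
          · exact h
        refine ih hg (by omega) (by rw [hgf 0 (by omega)]; exact h0) (by rw [hgd]; exact hdt) ?_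
        intro i hi hij
        rw [hgf i (by omega)]
        exact hinner i hi (by omega)
    rcases List.mem_cons.1 h0 with h0 | h0 <;> rcases List.mem_cons.1 h1 with h1 | h1
    · exact hf.ne 0 k (by omega) le_rfl (h0.trans h1.symm)
    · exact main hf.reverse hk (by simpa using h1) (by simpa using h0)
        fun i hi hik => hin _ (by omega) (by omega)
    · exact main hf hk h0 h1 hin
    · exact ih hf hk h0 h1 fun i hi hik =>
        ⟨(hin i hi hik).1, fun h => (hin i hi hik).2 (List.mem_cons_of_mem _ h)⟩

/-- Maximum cardinality search visits the vertices of a chordal graph in the reverse of a perfect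
elimination order. -/
lemma IsMCS.isClique_inter (hX : ChordalOn G X) {b : V} {t : List V} (hl : IsMCS G X (b :: t)) :
    G.IsClique ((G.neighborFinset b ∩ t.toFinset : Finset V) : Set V) := by
  intro a ha c hc hac
  simp only [Finset.coe_inter, SimpleGraph.coe_neighborFinset, List.coe_toFinset,
    Set.mem_inter_iff, SimpleGraph.mem_neighborSet, Set.mem_ofPred_eq] at ha hc
  by_contra hnadj
  cases hl with
  | cons ht hb hbt hmax =>
    have hpath : IsInducedPath G (fun i => if i = 0 then a else if i = 1 then b else c) 2 := by
      constructor
      · intro i j hij hj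
        have : (i = 0 ∧ j = 1) ∨ (i = 0 ∧ j = 2) ∨ (i = 1 ∧ j = 2) := by omega
        rcases this with ⟨rfl, rfl⟩ | ⟨rfl, rfl⟩ | ⟨rfl, rfl⟩
        · simpa using ha.1.ne'
        · simpa using hac
        · simpa using hc.1.ne
      · intro i j hij hj
        have : (i = 0 ∧ j = 1) ∨ (i = 0 ∧ j = 2) ∨ (i = 1 ∧ j = 2) := by omega
        rcases this with ⟨rfl, rfl⟩ | ⟨rfl, rfl⟩ | ⟨rfl, rfl⟩
        · simpa using ha.1.symm
        · simpa using hnadj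
        · simpa using hc.1
    refine ht.no_isInducedPath hX hpath le_rfl (by simpa using ha.2) (by simpa using hc.2) ?_
    intro i h0 h2
    obtain rfl : i = 1 := by omega
    simpa using ⟨hb, hbt⟩

/-- Every nonempty clique lies in the clique formed by its last visited vertex and the earlier
neighbours of that vertex. -/
lemma exists_suffix_of_isClique {Q : Finset V} (hQ : G.IsClique (Q : Set V)) (hne : Q.Nonempty)
    {l : List V} (hQl : Q ⊆ l.toFinset) :
    ∃ u t, (u :: t) <:+ l ∧ Q ⊆ insert u (G.neighborFinset u ∩ t.toFinset) := by
  induction l with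
  | nil =>
    obtain ⟨q, hq⟩ := hne
    simpa using hQl hq
  | cons b t ih =>
    by_cases hb : b ∈ Q
    · refine ⟨b, t, List.suffix_rfl, fun q hq => ?_⟩
      rcases eq_or_ne q b with rfl | hqb
      · simp
      · have h1 : q ∈ t.toFinset := by
          have := hQl hq
          simpa [hqb] using this
        simp only [Finset.mem_insert, Finset.mem_inter, SimpleGraph.mem_neighborFinset]
        exact Or.inr ⟨hQ hb hq hqb.symm, h1⟩
    · obtain ⟨u, s, hs, h⟩ := ih fun q hq => by
        have := hQl hq
        have hqb : q ≠ b := fun h => hb (h ▸ hq)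
        simpa [hqb] using this
      exact ⟨u, s, hs.trans (List.suffix_cons _ _), h⟩

lemma IsMCS.suffix {l s : List V} (hl : IsMCS G X l) (hs : s <:+ l) : IsMCS G X s := by
  induction hl with
  | nil => rw [List.suffix_nil.1 hs]; exact .nil
  | cons ht hb hbt hmax ih =>
    rcases List.suffix_cons_iff.1 hs with rfl | h
    · exact .cons ht hb hbt hmax
    · exact ih h

/-- A nonempty chordal graph has a simplicial vertex. -/
lemma ChordalOn.exists_simplicial (hX : ChordalOn G X) (hne : X.Nonempty) :
    ∃ x ∈ X, G.IsClique {y | y ∈ X ∧ G.Adj x y} := by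
  classical
  obtain ⟨l, hl, hlen⟩ := exists_isMCS G X X.card le_rfl
  have heq : l.toFinset = X := by
    refine Finset.eq_of_subset_of_card_le hl.subset ?_
    rw [List.toFinset_card_of_nodup hl.nodup, hlen]
  cases l with
  | nil => simp only [List.toFinset_nil] at heq; simp [← heq] at hne
  | cons b t =>
    refine ⟨b, heq ▸ by simp, (hl.isClique_inter hX).subset ?_⟩
    rintro y ⟨hy, hby⟩
    rw [← heq] at hy
    have : y ≠ b := hby.ne'
    simp only [List.toFinset_cons, Finset.mem_insert, this, false_or] at hy
    simp [hby, List.mem_toFinset.1 hy]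

end MaximumCardinalitySearch

/-! ### Forests -/

section Forests

variable {W : Type*}

/-- A walk that leaves a set crosses its boundary. -/
lemma exists_adj_of_reachable {F : SimpleGraph W} {a b : W} (h : F.Reachable a b) {P : W → Prop}
    (ha : P a) (hb : ¬ P b) : ∃ x y, F.Adj x y ∧ P x ∧ ¬ P y := by
  obtain ⟨p⟩ := h
  obtain ⟨d, -, h1, h2⟩ := p.exists_boundary_dart {x | P x} ha hb
  exact ⟨d.fst, d.snd, d.adj, h1, h2⟩

lemma not_reachable_deleteEdges {F : SimpleGraph W} (hF : F.IsAcyclic) {a b : W}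
    (h : F.Adj a b) : ¬ (F.deleteEdges {s(a, b)}).Reachable a b :=
  SimpleGraph.isBridge_iff.1 (SimpleGraph.isAcyclic_iff_forall_adj_isBridge.1 hF h)

lemma reachable_deleteEdges_or {F : SimpleGraph W} {a b x : W} (h : F.Reachable a x) :
    (F.deleteEdges {s(a, b)}).Reachable a x ∨ (F.deleteEdges {s(a, b)}).Reachable b x := by
  by_contra hcon
  obtain ⟨y, z, hyz, hy, hz⟩ := exists_adj_of_reachable h
    (P := fun z => (F.deleteEdges {s(a, b)}).Reachable a z ∨
      (F.deleteEdges {s(a, b)}).Reachable b z) (Or.inl .rfl) hcon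
  push Not at hz
  by_cases he : s(y, z) = s(a, b)
  · have : z ∈ s(a, b) := by rw [← he]; simp
    rcases Sym2.mem_iff.1 this with rfl | rfl
    · exact hz.1 .rfl
    · exact hz.2 .rfl
  · have hadj : (F.deleteEdges {s(a, b)}).Adj y z := by
      rw [SimpleGraph.deleteEdges_adj]; exact ⟨hyz, by simpa using he⟩
    rcases hy with hy | hy
    · exact hz.1 (hy.trans hadj.reachable)
    · exact hz.2 (hy.trans hadj.reachable)

/-- The union of two forests with connected intersection is a forest. Here `NF` and `NT` are node
sets that contain the ends of all edges of `F` and `T`. -/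
lemma isAcyclic_sup {F T : SimpleGraph W} {NF NT : Set W} (hF : F.IsAcyclic) (hT : T.IsAcyclic)
    (hNF : ∀ a b, F.Adj a b → a ∈ NF) (hNT : ∀ a b, T.Adj a b → a ∈ NT)
    (hconn : ∀ x ∈ NF ∩ NT, ∀ y ∈ NF ∩ NT, (F ⊓ T).Reachable x y) : (F ⊔ T).IsAcyclic := by
  -- By symmetry it suffices to show that the edges of `F` are bridges of the union.
  have main : ∀ {F T : SimpleGraph W} {NF NT : Set W}, F.IsAcyclic → T.IsAcyclic →
      (∀ a b, F.Adj a b → a ∈ NF) → (∀ a b, T.Adj a b → a ∈ NT) →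
      (∀ x ∈ NF ∩ NT, ∀ y ∈ NF ∩ NT, (F ⊓ T).Reachable x y) → ∀ a b, F.Adj a b →
      ¬ ((F ⊔ T).deleteEdges {s(a, b)}).Reachable a b := by
    intro F T NF NT hF hT hNF hNT hconn a b hab hreach
    set Fe := F.deleteEdges {s(a, b)} with hFe
    set Te := T.deleteEdges {s(a, b)} with hTe
    have hsplit : ∀ x y, ((F ⊔ T).deleteEdges {s(a, b)}).Adj x y → Fe.Adj x y ∨ Te.Adj x y := by
      intro x y h
      rw [SimpleGraph.deleteEdges_adj] at h
      rcases h.1 with h1 | h1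
      · exact Or.inl (SimpleGraph.deleteEdges_adj.2 ⟨h1, h.2⟩)
      · exact Or.inr (SimpleGraph.deleteEdges_adj.2 ⟨h1, h.2⟩)
    have hFab : ¬ Fe.Reachable a b := not_reachable_deleteEdges hF hab
    have memF : ∀ x, a ∈ NF → Fe.Reachable a x → x ∈ NF := by
      intro x ha h
      by_contra hx
      obtain ⟨y, z, hyz, hy, hz⟩ := exists_adj_of_reachable h (P := (· ∈ NF)) ha hx
      exact hz (hNF _ _ (SimpleGraph.deleteEdges_adj.1 hyz).1.symm)
    have memF' : ∀ x, b ∈ NF → Fe.Reachable b x → x ∈ NF := by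
      intro x ha h
      by_contra hx
      obtain ⟨y, z, hyz, hy, hz⟩ := exists_adj_of_reachable h (P := (· ∈ NF)) ha hx
      exact hz (hNF _ _ (SimpleGraph.deleteEdges_adj.1 hyz).1.symm)
    have haF : a ∈ NF := hNF _ _ hab
    have hbF : b ∈ NF := hNF _ _ hab.symm
    by_cases hTab : T.Adj a b
    · have hTab' : ¬ Te.Reachable a b := not_reachable_deleteEdges hT hTab
      have haT : a ∈ NT := hNT _ _ hTab
      have hJ : ∀ x ∈ NF ∩ NT, (Fe.Reachable a x ∧ Te.Reachable a x) ∨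
          (Fe.Reachable b x ∧ Te.Reachable b x) := by
        intro x hx
        have hF' : (F ⊓ T).deleteEdges {s(a, b)} ≤ Fe := SimpleGraph.deleteEdges_mono inf_le_left
        have hT' : (F ⊓ T).deleteEdges {s(a, b)} ≤ Te := SimpleGraph.deleteEdges_mono inf_le_right
        rcases reachable_deleteEdges_or (b := b) (hconn a ⟨haF, haT⟩ x hx) with h | h
        · exact Or.inl ⟨h.mono hF', h.mono hT'⟩
        · exact Or.inr ⟨h.mono hF', h.mono hT'⟩
      obtain ⟨x, y, hxy, hx, hy⟩ := exists_adj_of_reachable hreach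
        (P := fun z => Fe.Reachable a z ∨ Te.Reachable a z) (Or.inl .rfl)
        (by rintro (h | h); exacts [hFab h, hTab' h])
      push Not at hy
      rcases hsplit x y hxy with h | h
      · have hxa : ¬ Fe.Reachable a x := fun h' => hy.1 (h'.trans h.reachable)
        have hxT : Te.Reachable a x := hx.resolve_left hxa
        have hxNT : x ∈ NT := by
          by_contra hx
          obtain ⟨y, z, hyz, hy, hz⟩ := exists_adj_of_reachable hxT (P := (· ∈ NT)) haT hx
          exact hz (hNT _ _ (SimpleGraph.deleteEdges_adj.1 hyz).1.symm)
        rcases hJ x ⟨hNF _ _ (SimpleGraph.deleteEdges_adj.1 h).1, hxNT⟩ with h2 | h2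
        · exact hxa h2.1
        · exact hTab' (hxT.trans h2.2.symm)
      · have hxa : ¬ Te.Reachable a x := fun h' => hy.2 (h'.trans h.reachable)
        have hxF : Fe.Reachable a x := hx.resolve_right hxa
        rcases hJ x ⟨memF x haF hxF, hNT _ _ (SimpleGraph.deleteEdges_adj.1 h).1⟩ with h2 | h2
        · exact hxa h2.2
        · exact hFab (hxF.trans h2.1.symm)
    · have hJ : F ⊓ T ≤ Fe := by
        intro x y h
        refine SimpleGraph.deleteEdges_adj.2 ⟨h.1, fun he => hTab ?_⟩
        have he : s(x, y) = s(a, b) := he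
        rw [← SimpleGraph.mem_edgeSet, ← he]
        exact h.2
      by_cases hex : ∃ x ∈ NF ∩ NT, Fe.Reachable a x
      · obtain ⟨x₀, hx₀, hax₀⟩ := hex
        obtain ⟨x, y, hxy, hx, hy⟩ := exists_adj_of_reachable hreach.symm
          (P := fun z => Fe.Reachable b z) .rfl fun h => hFab h.symm
        rcases hsplit x y hxy with h | h
        · exact hy (hx.trans h.reachable)
        · have hxm : x ∈ NF ∩ NT :=
            ⟨memF' x hbF hx, hNT _ _ (SimpleGraph.deleteEdges_adj.1 h).1⟩
          exact hFab ((hax₀.trans ((hconn x₀ hx₀ x hxm).mono hJ)).trans hx.symm)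
      · obtain ⟨x, y, hxy, hx, hy⟩ := exists_adj_of_reachable hreach
          (P := fun z => Fe.Reachable a z) .rfl hFab
        rcases hsplit x y hxy with h | h
        · exact hy (hx.trans h.reachable)
        · exact hex ⟨x, ⟨memF x haF hx, hNT _ _ (SimpleGraph.deleteEdges_adj.1 h).1⟩, hx⟩
  rw [SimpleGraph.isAcyclic_iff_forall_adj_isBridge]
  intro a b hab
  rw [SimpleGraph.isBridge_iff]
  rcases hab with h | h
  · exact main hF hT hNF hNT hconn a b h
  · rw [sup_comm]
    exact main hT hF hNT hNF (fun x hx y hy => by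
      rw [inf_comm]; exact hconn x hx.symm y hy.symm) a b h

lemma eq_of_le_of_reachable {F T : SimpleGraph W} (hT : T.IsAcyclic) (h : F ≤ T)
    (hr : ∀ a b, T.Adj a b → F.Reachable a b) : F = T := by
  refine le_antisymm h fun a b hab => ?_
  by_contra hn
  refine not_reachable_deleteEdges hT hab ((hr a b hab).mono fun x y hxy => ?_)
  refine SimpleGraph.deleteEdges_adj.2 ⟨h hxy, fun he => hn ?_⟩
  have he : s(x, y) = s(a, b) := he
  rw [← SimpleGraph.mem_edgeSet, ← he]
  exact hxy

end Forests

/-! ### Kruskal's algorithm -/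

section Kruskal

variable {V : Type*} [LinearOrder V]

lemma precedes_refl (e : Sym2 (Finset V)) : Precedes e e := Or.inr ⟨rfl, le_rfl⟩

lemma precedes_total (e f : Sym2 (Finset V)) : Precedes e f ∨ Precedes f e := by
  unfold Precedes
  rcases lt_trichotomy (weight e) (weight f) with h | h | h
  · exact Or.inr (Or.inl h)
  · rcases le_total (endsList e) (endsList f) with h' | h'
    · exact Or.inl (Or.inr ⟨h, h'⟩)
    · exact Or.inr (Or.inr ⟨h.symm, h'⟩)
  · exact Or.inl (Or.inl h)

lemma Precedes.trans {e f g : Sym2 (Finset V)} (h1 : Precedes e f) (h2 : Precedes f g) :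
    Precedes e g := by
  unfold Precedes at *
  rcases h1 with h1 | ⟨h1, h1'⟩ <;> rcases h2 with h2 | ⟨h2, h2'⟩
  · exact Or.inl (h2.trans h1)
  · exact Or.inl (h2 ▸ h1)
  · exact Or.inl (h1 ▸ h2)
  · exact Or.inr ⟨h1.trans h2, h1'.trans h2'⟩

lemma Precedes.weight_le {e f : Sym2 (Finset V)} (h : Precedes e f) : weight f ≤ weight e := by
  rcases h with h | h
  · exact h.le
  · exact h.1.ge

@[simp] lemma weight_mk (K L : Finset V) : weight s(K, L) = (K ∩ L).card := rfl

@[simp] lemma endsList_mk (K L : Finset V) : endsList s(K, L) = (K ∪ L).sort (· ≤ ·) := rfl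

/-- The subgraph formed by the edges of `T` that may be listed before `e`. -/
def edgesUpTo (T : SimpleGraph (Finset V)) (e : Sym2 (Finset V)) : SimpleGraph (Finset V) where
  Adj K L := T.Adj K L ∧ Precedes s(K, L) e
  symm := ⟨fun K L h => ⟨h.1.symm, by rw [Sym2.eq_swap]; exact h.2⟩⟩
  loopless := ⟨fun K h => T.irrefl h.1⟩

lemma edgesUpTo_le (T : SimpleGraph (Finset V)) (e : Sym2 (Finset V)) : edgesUpTo T e ≤ T :=
  fun _ _ h => h.1

lemma edgesUpTo_mono {T T' : SimpleGraph (Finset V)} (h : T ≤ T') (e : Sym2 (Finset V)) :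
    edgesUpTo T e ≤ edgesUpTo T' e :=
  fun _ _ h' => ⟨h h'.1, h'.2⟩

omit [LinearOrder V] in
lemma spanningCoe_addEdge (T : NodeGraph V) (K L : Finset V) :
    (addEdge T s(K, L)).spanningCoe = T.spanningCoe ⊔ SimpleGraph.edge K L := by
  ext M N
  simp only [SimpleGraph.Subgraph.spanningCoe_adj, addEdge, SimpleGraph.sup_adj,
    SimpleGraph.edge_adj, Sym2.eq_iff]
  tauto

omit [LinearOrder V] in
lemma reachable_of_not_isAcyclic_addEdge {T : NodeGraph V} (hT : IsAcyclicSubgraph T)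
    {K L : Finset V} (h : ¬ IsAcyclicSubgraph (addEdge T s(K, L))) :
    T.spanningCoe.Reachable K L := by
  by_contra hn
  refine h ?_
  rw [IsAcyclicSubgraph, spanningCoe_addEdge]
  exact SimpleGraph.IsAcyclic.sup_edge_of_not_reachable hn hT

omit [LinearOrder V] in
lemma kruskal_append (K : NodeGraph V) (l : List (Sym2 (Finset V))) (e : Sym2 (Finset V)) :
    kruskal K (l ++ [e]) = kruskalStep (kruskal K l) e := by
  simp [kruskal]

/-- What Kruskal's algorithm achieves: a forest of listed edges in which the ends of each listed
edge `e` are joined by edges not listed after `e`. -/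
lemma kruskal_spec (K : NodeGraph V) {l : List (Sym2 (Finset V))} (hl : ∀ e ∈ l, e ∈ K.edgeSet)
    (hp : l.Pairwise Precedes) :
    (kruskal K l).verts = K.verts ∧
    (∀ M N, (kruskal K l).Adj M N → s(M, N) ∈ l) ∧
    IsAcyclicSubgraph (kruskal K l) ∧
    ∀ M N, s(M, N) ∈ l → (edgesUpTo (kruskal K l).spanningCoe s(M, N)).Reachable M N := by
  induction l using List.reverseRecOn with
  | nil =>
    refine ⟨rfl, fun M N h => h.elim, ?_, by simp⟩
    have : (kruskal K []).spanningCoe = ⊥ := by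
      ext M N; simp [kruskal, edgeless]
    rw [IsAcyclicSubgraph, this]
    exact SimpleGraph.isAcyclic_bot
  | append_singleton l e ih =>
    have hp' := List.pairwise_append.1 hp
    obtain ⟨h1, h2, h3, h4⟩ := ih (fun f hf => hl f (by simp [hf])) hp'.1
    have hbefore : ∀ f ∈ l, Precedes f e := fun f hf => hp'.2.2 f hf e (by simp)
    have heK : e ∈ K.edgeSet := hl e (by simp)
    rw [kruskal_append]
    unfold kruskalStep
    induction e using Sym2.ind with
    | _ P Q =>
    rw [SimpleGraph.Subgraph.mem_edgeSet] at heK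
    split_ifs with hac
    · have hle : (kruskal K l).spanningCoe ≤ (addEdge (kruskal K l) s(P, Q)).spanningCoe := by
        rw [spanningCoe_addEdge]; exact le_sup_left
      refine ⟨?_, ?_, hac, ?_⟩
      · change (kruskal K l).verts ∪ {M | M ∈ s(P, Q)} = K.verts
        rw [h1, Set.union_eq_left]
        intro M hM
        rcases Sym2.mem_iff.1 hM with rfl | rfl
        · exact K.edge_vert heK
        · exact K.edge_vert heK.symm
      · rintro M N (h | ⟨-, h⟩)
        · simp [h2 M N h]
        · simp [h]
      · intro M N h
        rcases List.mem_append.1 h with h | h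
        · exact (h4 M N h).mono (edgesUpTo_mono hle _)
        · have h : s(M, N) = s(P, Q) := by simpa using h
          have hMN : M ≠ N := by
            have : K.Adj M N := by
              rw [← SimpleGraph.Subgraph.mem_edgeSet, h]; exact heK
            exact this.ne
          exact SimpleGraph.Adj.reachable ⟨Or.inr ⟨hMN, h⟩, precedes_refl _⟩
    · refine ⟨h1, fun M N h => by simp [h2 M N h], h3, ?_⟩
      intro M N h
      rcases List.mem_append.1 h with h | h
      · exact h4 M N h
      · have h : s(M, N) = s(P, Q) := by simpa using h
        have hPQ := reachable_of_not_isAcyclic_addEdge h3 hac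
        have hMN : (kruskal K l).spanningCoe.Reachable M N := by
          rcases Sym2.eq_iff.1 h with ⟨rfl, rfl⟩ | ⟨rfl, rfl⟩
          · exact hPQ
          · exact hPQ.symm
        refine hMN.mono fun A B hAB => ⟨hAB, ?_⟩
        rw [h]
        exact hbefore _ (h2 A B hAB)

lemma exists_isKruskalOrder [Finite V] (K : NodeGraph V) : ∃ l, IsKruskalOrder K l := by
  classical
  have hfin : K.edgeSet.Finite := Set.toFinite _
  have : Std.Total (α := Sym2 (Finset V)) Precedes := ⟨precedes_total⟩
  have : IsTrans (Sym2 (Finset V)) Precedes := ⟨fun _ _ _ => Precedes.trans⟩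
  refine ⟨hfin.toFinset.toList.insertionSort Precedes, ?_, ?_, List.pairwise_insertionSort _ _⟩
  · rw [(List.perm_insertionSort _ _).nodup_iff]
    exact Finset.nodup_toList _
  · intro e
    rw [(List.perm_insertionSort _ _).mem_iff]
    simp

/-- If no two edges are tied, the order is unique. -/
lemma IsKruskalOrder.unique {K : NodeGraph V} (hK : ∀ e ∈ K.edgeSet, ∀ f ∈ K.edgeSet,
    Precedes e f → Precedes f e → e = f) {l l' : List (Sym2 (Finset V))}
    (h : IsKruskalOrder K l) (h' : IsKruskalOrder K l') : l = l' := by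
  refine List.Perm.eq_of_pairwise (le := Precedes) ?_ h.2.2 h'.2.2 ?_
  · intro e f he hf
    exact hK e ((h.2.1 e).1 he) f ((h'.2.1 f).1 hf)
  · rw [List.perm_ext_iff_of_nodup h.1 h'.1]
    intro e
    rw [h.2.1, h'.2.1]

end Kruskal

/-! ### Maximal cliques and balls -/

section Cliques

variable {V : Type*} {G : SimpleGraph V}

/-- `K` is an inclusion-maximal clique of `G`. -/
def IsMaxClique (G : SimpleGraph V) (K : Finset V) : Prop :=
  Maximal (fun K : Finset V => G.IsClique (K : Set V)) K

/-- The closed neighbourhood of `u`. -/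
def closedNbhd (G : SimpleGraph V) (u : V) : Set V := {w | w = u ∨ G.Adj u w}

lemma IsMaxClique.eq_of_subset {K L : Finset V} (hK : IsMaxClique G K) (hL : IsMaxClique G L)
    (h : K ⊆ L) : K = L := le_antisymm h (hK.2 hL.1 h)

lemma exists_isMaxClique [Finite V] {Q : Finset V} (hQ : G.IsClique (Q : Set V)) :
    ∃ K, Q ⊆ K ∧ IsMaxClique G K :=
  (Set.toFinite {K : Finset V | G.IsClique (K : Set V)}).exists_le_maximal hQ

lemma subset_closedNbhd {K : Finset V} (hK : G.IsClique (K : Set V)) {u : V} (hu : u ∈ K) :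
    (K : Set V) ⊆ closedNbhd G u := by
  intro w hw
  by_cases h : w = u
  · exact Or.inl h
  · exact Or.inr (hK hu hw fun h' => h h'.symm)

lemma mem_ball_three {u w : V} : w ∈ (ball G u 3).verts ↔ w ∈ closedNbhd G u := by
  change 2 * G.edist u w ≤ ((3 : ℕ) : ℕ∞) ↔ _
  have h1 : 2 * G.edist u w ≤ ((3 : ℕ) : ℕ∞) ↔ G.edist u w ≤ 1 := by
    cases h : G.edist u w with
    | top => simp
    | coe d => norm_cast; omega
  rw [h1, SimpleGraph.edist_le_one_iff_adj_or_eq, closedNbhd]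
  simp only [Set.mem_ofPred_eq]
  tauto

lemma edist_le_one_of_mem {u w : V} (h : w ∈ closedNbhd G u) : G.edist u w ≤ 1 := by
  rw [SimpleGraph.edist_le_one_iff_adj_or_eq]
  exact h.elim (fun h => Or.inr h.symm) Or.inl

lemma ball_adj_of_mem {r : ℕ} (hr : 3 ≤ r) {u a b : V} (ha : a ∈ closedNbhd G u)
    (hb : b ∈ closedNbhd G u) (hab : G.Adj a b) : (ball G u r).Adj a b := by
  have h1 := edist_le_one_of_mem ha
  have h2 := edist_le_one_of_mem hb
  have hr' : ((3 : ℕ) : ℕ∞) ≤ (r : ℕ∞) := by exact_mod_cast hr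
  refine ⟨hab, le_trans ?_ hr', le_trans ?_ hr', lt_of_lt_of_le ?_ hr'⟩
  · calc 2 * G.edist u a ≤ 2 * 1 := by gcongr
      _ ≤ _ := by norm_num
  · calc 2 * G.edist u b ≤ 2 * 1 := by gcongr
      _ ≤ _ := by norm_num
  · calc G.edist u a + G.edist u b ≤ 1 + 1 := by gcongr
      _ < _ := by norm_num

lemma spanningCoe_ball_le (u : V) (r : ℕ) : (ball G u r).spanningCoe ≤ G := fun _ _ h => h.1

/-- The closed neighbourhoods of an `r`-locally chordal graph with `r ≥ 3` are chordal. -/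
lemma IsLocallyChordal.chordalOn_closedNbhd {r : ℕ} (h : IsLocallyChordal r G) (hr : 3 ≤ r)
    (u : V) : ChordalOn G (closedNbhd G u) := by
  intro f k x hk hf hfX hx hne h0 h1
  refine (h u).exists_adj_inner (spanningCoe_ball_le u r) hf hk hne (fun i hi => ?_) ?_ ?_
  · exact ball_adj_of_mem hr (hfX i hi.le) (hfX (i + 1) hi)
      ((hf.adj i (i + 1) (by omega) hi).2 rfl)
  · exact ball_adj_of_mem hr hx (hfX 0 (by omega)) h0
  · exact ball_adj_of_mem hr hx (hfX k le_rfl) h1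

/-- An `r`-locally chordal graph induces a chordal graph on any `r` vertices, as each cycle of
length at most `r` lies in the ball of radius `r/2` around any of its vertices. -/
lemma IsLocallyChordal.chordalOn_of_card_le {r : ℕ} (h : IsLocallyChordal r G) {X : Finset V}
    (hX : X.card ≤ r) : ChordalOn G (X : Set V) := by
  classical
  intro f k x hk hf hfX hx hne h0 h1
  have hkr : k + 2 ≤ r := by
    refine le_trans ?_ hX
    have hinj : Set.InjOn f (Finset.range (k + 1) : Set ℕ) := by
      intro i hi j hj hij
      simp only [Finset.coe_range, Set.mem_Iio] at hi hj
      rcases lt_trichotomy i j with h | h | h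
      · exact absurd hij (hf.ne i j h (by omega))
      · exact h
      · exact absurd hij.symm (hf.ne j i h (by omega))
    have hx' : x ∉ (Finset.range (k + 1)).image f := by
      simp only [Finset.mem_image, Finset.mem_range, not_exists, not_and]
      exact fun i hi => hne i (by omega)
    have hcard : (insert x ((Finset.range (k + 1)).image f)).card = k + 2 := by
      rw [Finset.card_insert_of_notMem hx', Finset.card_image_of_injOn hinj, Finset.card_range]
    rw [← hcard]
    refine Finset.card_le_card fun w hw => ?_
    simp only [Finset.mem_insert, Finset.mem_image, Finset.mem_range] at hw
    rcases hw with rfl | ⟨i, hi, rfl⟩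
    · exact hx
    · exact hfX i (by omega)
  have hadj : ∀ i < k, G.Adj (f i) (f (i + 1)) := fun i hi =>
    (hf.adj i (i + 1) (by omega) hi).2 rfl
  have hd1 : ∀ i ≤ k, G.edist x (f i) ≤ ((i + 1 : ℕ) : ℕ∞) := by
    intro i hi
    have := SimpleGraph.edist_le
      (SimpleGraph.Walk.cons h0 (walkOfFun f i fun j hj => hadj j (by omega)))
    rwa [SimpleGraph.Walk.length_cons, length_walkOfFun] at this
  have hd2 : ∀ i ≤ k, G.edist x (f i) ≤ ((k - i + 1 : ℕ) : ℕ∞) := by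
    intro i hi
    have h2 := SimpleGraph.edist_le (SimpleGraph.Walk.cons (v := f (k - 0)) (by simpa using h1)
      (walkOfFun (fun j => f (k - j)) (k - i) fun j hj => by
        have := (hadj (k - (j + 1)) (by omega)).symm
        rwa [show k - (j + 1) + 1 = k - j by omega] at this))
    rw [SimpleGraph.Walk.length_cons, length_walkOfFun] at h2
    simpa [show k - (k - i) = i by omega] using h2
  have hv : ∀ i ≤ k, 2 * G.edist x (f i) ≤ (r : ℕ∞) := by
    intro i hi
    calc 2 * G.edist x (f i) = G.edist x (f i) + G.edist x (f i) := two_mul _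
      _ ≤ ((i + 1 : ℕ) : ℕ∞) + ((k - i + 1 : ℕ) : ℕ∞) := add_le_add (hd1 i hi) (hd2 i hi)
      _ ≤ r := by norm_cast; omega
  have hx0 : 2 * G.edist x x ≤ (r : ℕ∞) := by simp
  refine (h x).exists_adj_inner (spanningCoe_ball_le x r) hf hk hne (fun i hi => ?_) ?_ ?_
  · refine ⟨hadj i hi, hv i hi.le, hv (i + 1) hi, ?_⟩
    calc G.edist x (f i) + G.edist x (f (i + 1))
        ≤ ((i + 1 : ℕ) : ℕ∞) + ((k - (i + 1) + 1 : ℕ) : ℕ∞) :=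
          add_le_add (hd1 i hi.le) (hd2 (i + 1) hi)
      _ < r := by norm_cast; omega
  · refine ⟨h0, hx0, hv 0 (by omega), ?_⟩
    calc G.edist x x + G.edist x (f 0) ≤ 0 + ((0 + 1 : ℕ) : ℕ∞) :=
          add_le_add (by simp) (hd1 0 (by omega))
      _ < r := by norm_cast; omega
  · refine ⟨h1, hx0, hv k le_rfl, ?_⟩
    calc G.edist x x + G.edist x (f k) ≤ 0 + ((k - k + 1 : ℕ) : ℕ∞) :=
          add_le_add (by simp) (hd2 k le_rfl)
      _ < r := by norm_cast; omega

lemma mem_maxCliques_top {K : Finset V} :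
    K ∈ maxCliques (⊤ : G.Subgraph) ↔ IsMaxClique G K := by
  simp [maxCliques, IsMaxClique]

lemma mem_maxCliques_ball {u : V} {K : Finset V} :
    K ∈ maxCliques (ball G u 3) ↔ IsMaxClique G K ∧ u ∈ K := by
  classical
  have hu : u ∈ closedNbhd G u := Or.inl rfl
  have hcl : ∀ L : Finset V, ((L : Set V) ⊆ (ball G u 3).verts ∧
      (ball G u 3).spanningCoe.IsClique (L : Set V)) ↔
        ((L : Set V) ⊆ closedNbhd G u ∧ G.IsClique (L : Set V)) := by
    intro L
    constructor
    · rintro ⟨h1, h2⟩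
      exact ⟨fun w hw => mem_ball_three.1 (h1 hw), h2.mono (spanningCoe_ball_le u 3)⟩
    · rintro ⟨h1, h2⟩
      exact ⟨fun w hw => mem_ball_three.2 (h1 hw), fun a ha b hb hab =>
        ball_adj_of_mem le_rfl (h1 ha) (h1 hb) (h2 ha hb hab)⟩
  simp only [maxCliques, Set.mem_ofPred_eq, hcl, IsMaxClique]
  constructor
  · rintro ⟨⟨h1, h2⟩, h3⟩
    have huK : u ∈ K := by
      have hins : G.IsClique ((insert u K : Finset V) : Set V) := by
        rw [Finset.coe_insert, SimpleGraph.isClique_insert]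
        exact ⟨h2, fun b hb hub => (h1 hb).resolve_left fun h => hub h.symm⟩
      refine h3 ⟨?_, hins⟩ (Finset.subset_insert u K) (Finset.mem_insert_self u K)
      exact subset_closedNbhd hins (Finset.mem_insert_self u K)
    refine ⟨⟨h2, fun L hL hKL => h3 ⟨subset_closedNbhd hL (hKL huK), hL⟩ hKL⟩, huK⟩
  · rintro ⟨⟨h1, h2⟩, h3⟩
    exact ⟨⟨subset_closedNbhd h1 h3, h1⟩, fun L hL hKL => h2 hL.2 hKL⟩

lemma cliqueIntersectionGraph_ball_adj {u : V} {K L : Finset V} :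
    (cliqueIntersectionGraph (ball G u 3)).Adj K L ↔
      K ≠ L ∧ IsMaxClique G K ∧ IsMaxClique G L ∧ u ∈ K ∧ u ∈ L := by
  change (K ∈ maxCliques _ ∧ L ∈ maxCliques _ ∧ K ≠ L ∧ ∃ x, x ∈ K ∧ x ∈ L) ↔ _
  rw [mem_maxCliques_ball, mem_maxCliques_ball]
  constructor
  · rintro ⟨⟨h1, h2⟩, ⟨h3, h4⟩, h5, -⟩
    exact ⟨h5, h1, h3, h2, h4⟩
  · rintro ⟨h5, h1, h3, h2, h4⟩
    exact ⟨⟨h1, h2⟩, ⟨h3, h4⟩, h5, u, h2, h4⟩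

end Cliques

/-! ### The tie-breaking is strict -/

section Ties

variable {V : Type*} [DecidableEq V] {G : SimpleGraph V} {u : V}

/-- In a chordal graph, the neighbourhoods that the vertices of a clique `K` have in another clique
`L` are nested; a vertex of `K \ L` with the least one has no neighbour in `L \ K` at all. -/
lemma exists_forall_not_adj (hu : ChordalOn G (closedNbhd G u)) {K L : Finset V}
    (hK : IsMaxClique G K) (hL : IsMaxClique G L) (huK : u ∈ K) (huL : u ∈ L) (hKL : K ≠ L) :
    ∃ a ∈ K \ L, ∀ b ∈ L \ K, ¬ G.Adj a b := by
  classical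
  have hne : (K \ L).Nonempty := by
    rw [Finset.sdiff_nonempty]
    exact fun h => hKL (hK.eq_of_subset hL h)
  obtain ⟨a, ha, hmin⟩ := Finset.exists_min_image (K \ L)
    (fun a => (L.filter fun b => G.Adj a b).card) hne
  refine ⟨a, ha, fun b hb hab => ?_⟩
  simp only [Finset.mem_sdiff] at ha hb hmin
  refine hb.2 (hK.2 (y := insert b K) ?_ (Finset.subset_insert _ _) (Finset.mem_insert_self _ _))
  change G.IsClique ((insert b K : Finset V) : Set V)
  rw [Finset.coe_insert, SimpleGraph.isClique_insert]
  refine ⟨hK.1, fun c hc hbc => ?_⟩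
  by_cases hcL : c ∈ L
  · exact hL.1 hb.1 hcL hbc
  by_contra hnadj
  have hca : c ≠ a := fun h => hnadj (h ▸ hab.symm)
  obtain ⟨b', hb'L, hcb', hab'⟩ : ∃ b' ∈ L, G.Adj c b' ∧ ¬ G.Adj a b' := by
    by_contra! hcon
    have hlt : (L.filter fun b => G.Adj c b).card < (L.filter fun b => G.Adj a b).card := by
      refine Finset.card_lt_card ⟨fun w hw => ?_, fun hsub => ?_⟩
      · simp only [Finset.mem_filter] at hw ⊢
        exact ⟨hw.1, hcon w hw.1 hw.2⟩
      · have := @hsub b (by simp [hb.1, hab])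
        simp only [Finset.mem_filter] at this
        exact hnadj this.2.symm
    have := hmin c ⟨hc, hcL⟩
    omega
  have hb'a : b' ≠ a := fun h => ha.2 (h ▸ hb'L)
  have hbb' : b ≠ b' := fun h => hab' (h ▸ hab)
  have hKn := subset_closedNbhd hK.1 huK
  have hLn := subset_closedNbhd hL.1 huL
  have hadjbb' : G.Adj b b' := hL.1 hb.1 hb'L hbb'
  have hpath : IsInducedPath G (fun i => if i = 0 then a else if i = 1 then b else b') 2 := by
    constructor
    · intro i j hij hj
      have : (i = 0 ∧ j = 1) ∨ (i = 0 ∧ j = 2) ∨ (i = 1 ∧ j = 2) := by omega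
      rcases this with ⟨rfl, rfl⟩ | ⟨rfl, rfl⟩ | ⟨rfl, rfl⟩
      · simpa using hab.ne
      · simpa using hb'a.symm
      · simpa using hbb'
    · intro i j hij hj
      have : (i = 0 ∧ j = 1) ∨ (i = 0 ∧ j = 2) ∨ (i = 1 ∧ j = 2) := by omega
      rcases this with ⟨rfl, rfl⟩ | ⟨rfl, rfl⟩ | ⟨rfl, rfl⟩
      · simpa using hab
      · simpa using hab'
      · simpa using hadjbb'
  obtain ⟨j, hj0, hj2, hj⟩ := hu _ 2 c le_rfl hpath
    (by
      intro i hi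
      interval_cases i
      · exact hKn ha.1
      · exact hLn hb.1
      · exact hLn hb'L)
    (hKn hc)
    (by
      intro i hi
      interval_cases i
      · exact hca.symm
      · exact hbc
      · exact hcb'.ne')
    (hK.1 hc ha.1 hca) hcb'
  obtain rfl : j = 1 := by omega
  exact hnadj (SimpleGraph.Adj.symm hj)

/-- Two edges of the clique intersection graph of a chordal graph with the same union coincide. -/
lemma mk_eq_mk_of_union_eq (hu : ChordalOn G (closedNbhd G u)) {K L K' L' : Finset V}
    (hK : IsMaxClique G K) (hL : IsMaxClique G L) (hK' : IsMaxClique G K')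
    (hL' : IsMaxClique G L') (huK : u ∈ K) (huL : u ∈ L) (hKL : K ≠ L)
    (h : K ∪ L = K' ∪ L') : s(K, L) = s(K', L') := by
  have key : ∀ {K L : Finset V}, IsMaxClique G K → IsMaxClique G L → u ∈ K → u ∈ L → K ≠ L →
      K ∪ L = K' ∪ L' → K = K' ∨ K = L' := by
    intro K L hK hL huK huL hKL h
    obtain ⟨a, ha, hna⟩ := exists_forall_not_adj hu hK hL huK huL hKL
    rw [Finset.mem_sdiff] at ha
    have hsub : ∀ Q : Finset V, IsMaxClique G Q → Q ⊆ K ∪ L → a ∈ Q → Q = K := by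
      intro Q hQ hQs haQ
      refine hQ.eq_of_subset hK fun w hw => ?_
      by_contra hwK
      have hwL := (Finset.mem_union.1 (hQs hw)).resolve_left hwK
      refine hna w (Finset.mem_sdiff.2 ⟨hwL, hwK⟩) (hQ.1 haQ hw fun h => hwK (h ▸ ha.1))
    have haU : a ∈ K' ∪ L' := h ▸ Finset.mem_union_left _ ha.1
    rcases Finset.mem_union.1 haU with h1 | h1
    · exact Or.inl (hsub K' hK' (h ▸ Finset.subset_union_left) h1).symm
    · exact Or.inr (hsub L' hL' (h ▸ Finset.subset_union_right) h1).symm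
  rcases key hK hL huK huL hKL h with rfl | rfl <;>
    rcases key hL hK huL huK hKL.symm (by rw [Finset.union_comm]; exact h) with h1 | h1
  · exact absurd h1.symm hKL
  · rw [h1]
  · rw [h1, Sym2.eq_swap]
  · exact absurd h1.symm hKL

end Ties

/-! ### The local clique trees -/

section CliqueTrees

variable {V : Type*} [LinearOrder V] {G : SimpleGraph V}

/-- `T` has the characteristic properties of an output of Kruskal's algorithm on the intersection
graph of the maximal cliques that contain `u`: it is a forest, and the ends of each edge `e` of
that intersection graph are joined in `T` by edges that may be listed before `e`. -/
structure IsKruskalTree (G : SimpleGraph V) (u : V) (T : SimpleGraph (Finset V)) : Prop where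
  left_mem : ∀ {K L}, T.Adj K L → IsMaxClique G K ∧ u ∈ K
  isAcyclic : T.IsAcyclic
  reachable : ∀ {K L}, K ≠ L → IsMaxClique G K → IsMaxClique G L → u ∈ K → u ∈ L →
    (edgesUpTo T s(K, L)).Reachable K L

lemma isKruskalTree_kruskal {u : V} {l : List (Sym2 (Finset V))}
    (hl : IsKruskalOrder (cliqueIntersectionGraph (ball G u 3)) l) :
    IsKruskalTree G u (kruskal (cliqueIntersectionGraph (ball G u 3)) l).spanningCoe := by
  obtain ⟨-, h2, h3, h4⟩ := kruskal_spec _ (fun e he => (hl.2.1 e).1 he) hl.2.2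
  refine ⟨fun {K L} h => ?_, h3, fun {K L} hKL hK hL huK huL => h4 K L ?_⟩
  · have h := (hl.2.1 _).1 (h2 K L h)
    rw [SimpleGraph.Subgraph.mem_edgeSet, cliqueIntersectionGraph_ball_adj] at h
    exact ⟨h.2.1, h.2.2.2.1⟩
  · rw [hl.2.1, SimpleGraph.Subgraph.mem_edgeSet, cliqueIntersectionGraph_ball_adj]
    exact ⟨hKL, hK, hL, huK, huL⟩

/-- The part of `T` on the nodes that include `X`. -/
def nodesAbove (T : SimpleGraph (Finset V)) (X : Finset V) : SimpleGraph (Finset V) where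
  Adj K L := T.Adj K L ∧ X ⊆ K ∧ X ⊆ L
  symm := ⟨fun _ _ h => ⟨h.1.symm, h.2.2, h.2.1⟩⟩
  loopless := ⟨fun _ h => T.irrefl h.1⟩

omit [LinearOrder V] in
lemma nodesAbove_le (T : SimpleGraph (Finset V)) (X : Finset V) : nodesAbove T X ≤ T :=
  fun _ _ h => h.1

omit [LinearOrder V] in
lemma nodesAbove_anti (T : SimpleGraph (Finset V)) {X Y : Finset V} (h : X ⊆ Y) :
    nodesAbove T Y ≤ nodesAbove T X :=
  fun _ _ h' => ⟨h'.1, h.trans h'.2.1, h.trans h'.2.2⟩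

/-- The graph `G[N[u]] - X`. -/
def nbhdMinus (G : SimpleGraph V) (u : V) (X : Finset V) : SimpleGraph V where
  Adj a b := G.Adj a b ∧ (a ∈ closedNbhd G u ∧ a ∉ X) ∧ (b ∈ closedNbhd G u ∧ b ∉ X)
  symm := ⟨fun _ _ h => ⟨h.1.symm, h.2.2, h.2.1⟩⟩
  loopless := ⟨fun _ h => G.irrefl h.1⟩

/-- If two cliques including `X` are joined by a path that avoids `X`, they are joined by a
sequence of maximal cliques in which consecutive ones share `X` and a further vertex: in a chordal
graph all vertices of an induced such path are adjacent to all of `X`. -/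
lemma reachable_of_nbhdMinus_reachable [Finite V] {u : V} (hu : ChordalOn G (closedNbhd G u))
    {X : Finset V} (huX : u ∈ X) {F : SimpleGraph (Finset V)}
    (hF : ∀ M N, IsMaxClique G M → IsMaxClique G N → X ⊆ M → X ⊆ N → ∀ z ∈ M, z ∈ N → z ∉ X →
      F.Reachable M N)
    {M N : Finset V} (hM : IsMaxClique G M) (hN : IsMaxClique G N) (hXM : X ⊆ M) (hXN : X ⊆ N)
    {m n : V} (hm : m ∈ M) (hn : n ∈ N) (hmX : m ∉ X) (hnX : n ∉ X)
    (hmn : (nbhdMinus G u X).Reachable m n) : F.Reachable M N := by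
  obtain ⟨f, k, hf, rfl, rfl⟩ := exists_isInducedPath_of_reachable hmn
  have hfX : ∀ i ≤ k, f i ∈ closedNbhd G u ∧ f i ∉ X := by
    intro i hi
    rcases Nat.eq_zero_or_pos i with rfl | h
    · exact ⟨subset_closedNbhd hM.1 (hXM huX) hm, hmX⟩
    · have := (hf.adj (i - 1) i (by omega) hi).2 (by omega)
      exact this.2.2
  have hfG : IsInducedPath G f k := by
    refine ⟨hf.ne, fun i j hij hj => ?_⟩
    rw [← hf.adj i j hij hj]
    exact ⟨fun h => ⟨h, hfX i (by omega), hfX j hj⟩, fun h => h.1⟩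
  have hadjX : ∀ x ∈ X, ∀ i ≤ k, G.Adj x (f i) := by
    intro x hx
    have hne : ∀ i ≤ k, f i ≠ x := fun i hi h => (hfX i hi).2 (h ▸ hx)
    exact hu.adj_of_adj_ends (subset_closedNbhd hM.1 (hXM huX) (hXM hx)) hfG
      (fun i hi => (hfX i hi).1) hne (hM.1 (hXM hx) hm (hne 0 (by omega)).symm)
      (hN.1 (hXN hx) hn (hne k le_rfl).symm)
  have key : ∀ i ≤ k, ∀ N, IsMaxClique G N → X ⊆ N → f i ∈ N → F.Reachable M N := by
    intro i
    induction i with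
    | zero =>
      intro _ N hN hXN h0
      exact hF M N hM hN hXM hXN (f 0) hm h0 hmX
    | succ i ih =>
      intro hi N hN hXN hiN
      have hcl : G.IsClique ((insert (f i) (insert (f (i + 1)) X) : Finset V) : Set V) := by
        rw [Finset.coe_insert, Finset.coe_insert, SimpleGraph.isClique_insert,
          SimpleGraph.isClique_insert]
        refine ⟨⟨hM.1.subset hXM, fun b hb _ => (hadjX b hb _ hi).symm⟩, ?_⟩
        intro b hb _
        rcases hb with rfl | hb
        · exact (hfG.adj i (i + 1) (by omega) hi).2 rfl
        · exact (hadjX b hb i (by omega)).symm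
      obtain ⟨Q, hQ, hQmax⟩ := exists_isMaxClique hcl
      have hXQ : X ⊆ Q := fun x hx => hQ (by simp [hx])
      exact (ih (by omega) Q hQmax hXQ (hQ (by simp))).trans
        (hF Q N hQmax hN hXQ hXN (f (i + 1)) (hQ (by simp)) hiN (hfX _ hi).2)
  exact key k le_rfl N hN hXN hn

/-- The output of Kruskal's algorithm on the maximal cliques of a chordal graph is a clique tree:
the nodes that include a given set `X` are joined by nodes that include `X`. If two of them were
not, then `X` would separate them, and the path of `T` between them would cross this separation in
an edge of weight at least `|X|`, whose ends then include `X`, too. -/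
lemma IsKruskalTree.reachable_nodesAbove [Fintype V] {u : V} {T : SimpleGraph (Finset V)}
    (hu : ChordalOn G (closedNbhd G u)) (hT : IsKruskalTree G u T) (X : Finset V) (huX : u ∈ X)
    {K L : Finset V} (hK : IsMaxClique G K) (hL : IsMaxClique G L) (hXK : X ⊆ K) (hXL : X ⊆ L) :
    (nodesAbove T X).Reachable K L := by
  induction hn : Fintype.card V - X.card using Nat.strong_induction_on generalizing X K L with
  | _ n ih =>
  subst hn
  have hF : ∀ M N, IsMaxClique G M → IsMaxClique G N → X ⊆ M → X ⊆ N → ∀ z ∈ M, z ∈ N → z ∉ X →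
      (nodesAbove T X).Reachable M N := by
    intro M N hM hN hXM hXN z hzM hzN hzX
    have hss : X ⊂ M ∩ N := ⟨Finset.subset_inter hXM hXN, fun h =>
      hzX (h (Finset.mem_inter.2 ⟨hzM, hzN⟩))⟩
    have h1 := Finset.card_lt_card hss
    have h2 := Finset.card_le_univ (M ∩ N)
    exact (ih (Fintype.card V - (M ∩ N).card) (by omega) (M ∩ N) (hss.1 huX) hM hN
      Finset.inter_subset_left Finset.inter_subset_right rfl).mono (nodesAbove_anti T hss.1)
  have hchain := fun {M N : Finset V} => reachable_of_nbhdMinus_reachable hu huX hF (M := M) (N := N)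
  by_cases hKL : K = L
  · rw [hKL]
  by_contra hcon
  -- Here `M` reaches `A`, the union of the components of `G[N[u]] - X` that meet a node joined to
  -- `K` above `X`.
  let P : Finset V → Prop := fun M => ∃ M' : Finset V, IsMaxClique G M' ∧ X ⊆ M' ∧
    (nodesAbove T X).Reachable K M' ∧ ∃ z' ∈ M', z' ∉ X ∧ ∃ z ∈ M, z ∉ X ∧
      (nbhdMinus G u X).Reachable z' z
  have hself : ∀ M : Finset V, IsMaxClique G M → X ⊆ M → (nodesAbove T X).Reachable K M → P M := by
    intro M hM hXM hr
    have : ∃ z ∈ M, z ∉ X := by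
      by_contra! hsub
      have hMX : M ⊆ X := hsub
      exact hKL ((hM.eq_of_subset hK (hMX.trans hXK)).symm.trans
        (hM.eq_of_subset hL (hMX.trans hXL)))
    obtain ⟨z, hz, hzX⟩ := this
    exact ⟨M, hM, hXM, hr, z, hz, hzX, z, hz, hzX, .rfl⟩
  have hPr : ∀ M : Finset V, IsMaxClique G M → X ⊆ M → P M → (nodesAbove T X).Reachable K M := by
    rintro M hM hXM ⟨M', hM', hXM', hr, z', hz', hz'X, z, hz, hzX, hzz⟩
    exact hr.trans (hchain hM' hM hXM' hXM hz' hz hz'X hzX hzz)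
  obtain ⟨M, N, ⟨hMN, hprec⟩, hPM, hPN⟩ := exists_adj_of_reachable
    (hT.reachable hKL hK hL (hXK huX) (hXL huX)) (P := P) (hself K hK hXK .rfl)
    fun h => hcon (hPr L hL hXL h)
  obtain ⟨hM, huM⟩ := hT.left_mem hMN
  obtain ⟨hN, huN⟩ := hT.left_mem hMN.symm
  have hw : X.card ≤ (M ∩ N).card := by
    refine le_trans (Finset.card_le_card (Finset.subset_inter hXK hXL)) ?_
    simpa using hprec.weight_le
  have hsub : M ∩ N ⊆ X := by
    intro w hw
    rw [Finset.mem_inter] at hw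
    by_contra hwX
    obtain ⟨M', hM', hXM', hr, z', hz', hz'X, z, hz, hzX, hzz⟩ := hPM
    refine hPN ⟨M', hM', hXM', hr, z', hz', hz'X, w, hw.2, hwX, ?_⟩
    by_cases hzw : z = w
    · exact hzw ▸ hzz
    · refine hzz.trans (SimpleGraph.Adj.reachable ⟨hM.1 hz hw.1 hzw, ⟨?_, hzX⟩, ?_, hwX⟩)
      · exact subset_closedNbhd hM.1 huM hz
      · exact subset_closedNbhd hM.1 huM hw.1
  have heq : M ∩ N = X := Finset.eq_of_subset_of_card_le hsub hw
  have hXM : X ⊆ M := heq ▸ Finset.inter_subset_left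
  have hXN : X ⊆ N := heq ▸ Finset.inter_subset_right
  have hadj : (nodesAbove T X).Adj M N := ⟨hMN, hXM, hXN⟩
  exact hPN (hself N hN hXN ((hPr M hM hXM hPM).trans hadj.reachable))

lemma precedes_antisymm [Finite V] {u : V} (hu : ChordalOn G (closedNbhd G u))
    {K L K' L' : Finset V} (hK : IsMaxClique G K) (hL : IsMaxClique G L) (hK' : IsMaxClique G K')
    (hL' : IsMaxClique G L') (huK : u ∈ K) (huL : u ∈ L) (hKL : K ≠ L)
    (h1 : Precedes s(K, L) s(K', L')) (h2 : Precedes s(K', L') s(K, L)) :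
    s(K, L) = s(K', L') := by
  have hw := le_antisymm h2.weight_le h1.weight_le
  have hle : endsList s(K, L) ≤ endsList s(K', L') := by
    rcases h1 with h | h
    · omega
    · exact h.2
  have hge : endsList s(K', L') ≤ endsList s(K, L) := by
    rcases h2 with h | h
    · omega
    · exact h.2
  have h := le_antisymm hle hge
  refine mk_eq_mk_of_union_eq hu hK hL hK' hL' huK huL hKL ?_
  have := congrArg List.toFinset h
  simpa using this

/-- The local clique trees at `u` and `v` agree on the maximal cliques that contain both `u` and
`v`. If an edge `KL` of `T` were missing in `T'`, it would close a cycle with edges of `T'` that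
precede it and share the vertices of `K ∩ L`; as they contain `u`, Kruskal's algorithm at `u` would
have joined their ends before it came to `KL`, and would have rejected `KL`. -/
lemma IsKruskalTree.adj_of_adj [Fintype V] {u v : V} {T T' : SimpleGraph (Finset V)}
    (hu : ChordalOn G (closedNbhd G u)) (hv : ChordalOn G (closedNbhd G v))
    (hT : IsKruskalTree G u T) (hT' : IsKruskalTree G v T') {K L : Finset V}
    (h : T.Adj K L) (hvK : v ∈ K) (hvL : v ∈ L) : T'.Adj K L := by
  obtain ⟨hK, huK⟩ := hT.left_mem h
  obtain ⟨hL, huL⟩ := hT.left_mem h.symm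
  by_contra hn
  -- The path of `T'` between `K` and `L`: its edges precede `KL`, and its nodes include `K ∩ L`.
  have hreach : (edgesUpTo (nodesAbove T' (K ∩ L)) s(K, L)).Reachable K L := by
    obtain ⟨p, hp⟩ := (hT'.reachable h.ne hK hL hvK hvL).exists_isPath
    obtain ⟨q, hq⟩ := (hT'.reachable_nodesAbove hv (K ∩ L) (Finset.mem_inter.2 ⟨hvK, hvL⟩) hK hL
      Finset.inter_subset_left Finset.inter_subset_right).exists_isPath
    have heq := (hT'.isAcyclic.subsingleton_path K L).elim
      ⟨p.mapLe (edgesUpTo_le _ _), hp.mapLe _⟩ ⟨q.mapLe (nodesAbove_le _ _), hq.mapLe _⟩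
    have hedges : p.edges = q.edges := by
      have := congrArg (fun p => p.1.edges) heq
      simpa using this
    refine ⟨q.transfer _ fun e he => ?_⟩
    have h1 := q.edges_subset_edgeSet he
    have h2 := p.edges_subset_edgeSet (hedges ▸ he)
    induction e using Sym2.ind with
    | _ M N => exact ⟨h1, h2.2⟩
  -- Replacing each of its edges by a path of `T` yields a connection of `K` and `L` in `T - KL`.
  refine not_reachable_deleteEdges hT.isAcyclic h ?_
  by_contra hcon
  obtain ⟨M, N, ⟨⟨hMN, hM1, hN1⟩, hprec⟩, hKM, hKN⟩ := exists_adj_of_reachable hreach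
    (P := fun M => (T.deleteEdges {s(K, L)}).Reachable K M) .rfl hcon
  obtain ⟨hM, hvM⟩ := hT'.left_mem hMN
  obtain ⟨hN, hvN⟩ := hT'.left_mem hMN.symm
  have huKL : u ∈ K ∩ L := Finset.mem_inter.2 ⟨huK, huL⟩
  refine hKN (hKM.trans ((hT.reachable hMN.ne hM hN (hM1 huKL) (hN1 huKL)).mono ?_))
  intro A B hAB
  refine SimpleGraph.deleteEdges_adj.2 ⟨hAB.1, fun he => hn ?_⟩
  have he : s(A, B) = s(K, L) := he
  have hback : Precedes s(K, L) s(M, N) := he ▸ hAB.2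
  have := precedes_antisymm hu hK hL hM hN huK huL h.ne hback hprec
  rw [← SimpleGraph.mem_edgeSet, this]
  exact hMN

/-- The local clique trees at the vertices of a set `Y` that induces a chordal graph form a forest:
remove a simplicial vertex `x` of `G[Y]`; the tree at `x` meets each tree at a neighbour of `x` in
a subtree, and all of these subtrees share a node. -/
lemma isAcyclic_biSup [Fintype V] {T : V → SimpleGraph (Finset V)}
    (hch : ∀ v, ChordalOn G (closedNbhd G v)) (hT : ∀ v, IsKruskalTree G v (T v))
    {Y : Finset V} (hY : ChordalOn G (Y : Set V)) : (⨆ y ∈ Y, T y).IsAcyclic := by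
  classical
  induction hn : Y.card generalizing Y with
  | zero =>
    rw [Finset.card_eq_zero] at hn
    subst hn
    simp
  | succ n ih =>
    have hne : Y.Nonempty := by rw [← Finset.card_pos]; omega
    obtain ⟨x, hxY, hx⟩ := hY.exists_simplicial hne
    have hsup : (⨆ y ∈ Y, T y) = (⨆ y ∈ Y.erase x, T y) ⊔ T x := by
      conv_lhs => rw [← Finset.insert_erase hxY]
      rw [Finset.iSup_insert, sup_comm]
    have hYx : ChordalOn G (Y.erase x : Set V) := by
      intro f k z hk hf hfX hz
      exact hY f k z hk hf (fun i hi => Finset.mem_of_mem_erase (hfX i hi))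
        (Finset.mem_of_mem_erase hz)
    have hadj : ∀ K L, (⨆ y ∈ Y.erase x, T y).Adj K L ↔ ∃ y ∈ Y.erase x, (T y).Adj K L := by
      intro K L; simp only [SimpleGraph.iSup_adj, exists_prop]
    rw [hsup]
    refine isAcyclic_sup (NF := {K | IsMaxClique G K ∧ ∃ y ∈ Y.erase x, y ∈ K})
      (NT := {K | IsMaxClique G K ∧ x ∈ K}) (ih hYx (by rw [Finset.card_erase_of_mem hxY]; omega))
      (hT x).isAcyclic ?_ (fun K L h => (hT x).left_mem h) ?_
    · intro K L h
      obtain ⟨y, hy, h⟩ := (hadj K L).1 h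
      exact ⟨((hT y).left_mem h).1, y, hy, ((hT y).left_mem h).2⟩
    · rintro K ⟨⟨hK, y, hy, hyK⟩, -, hxK⟩ L ⟨⟨hL, z, hz, hzL⟩, -, hxL⟩
      rw [Finset.mem_erase] at hy hz
      have hcl : G.IsClique ((insert x {y, z} : Finset V) : Set V) := by
        have hxy : G.Adj x y := hK.1 hxK hyK hy.1.symm
        have hxz : G.Adj x z := hL.1 hxL hzL hz.1.symm
        rw [Finset.coe_insert, SimpleGraph.isClique_insert]
        constructor
        · refine hx.subset ?_
          intro w hw
          simp only [Finset.coe_insert, Finset.coe_singleton, Set.mem_insert_iff,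
            Set.mem_singleton_iff] at hw
          rcases hw with rfl | rfl
          · exact ⟨hy.2, hxy⟩
          · exact ⟨hz.2, hxz⟩
        · intro w hw _
          simp only [Finset.coe_insert, Finset.coe_singleton, Set.mem_insert_iff,
            Set.mem_singleton_iff] at hw
          rcases hw with rfl | rfl
          · exact hxy
          · exact hxz
      obtain ⟨M, hM, hMmax⟩ := exists_isMaxClique hcl
      have hxM : x ∈ M := hM (by simp)
      have key : ∀ {K : Finset V} {y : V}, IsMaxClique G K → x ∈ K → y ∈ Y.erase x → y ∈ K →
          y ∈ M → ((⨆ y ∈ Y.erase x, T y) ⊓ T x).Reachable K M := by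
        intro K y hK hxK hy hyK hyM
        have hsub : ∀ {Q : Finset V}, x ∈ Q → y ∈ Q → ({x, y} : Finset V) ⊆ Q := by
          intro Q h1 h2 w hw
          simp only [Finset.mem_insert, Finset.mem_singleton] at hw
          rcases hw with rfl | rfl <;> assumption
        refine ((hT x).reachable_nodesAbove (hch x) {x, y} (by simp) hK hMmax (hsub hxK hyK)
          (hsub hxM hyM)).mono ?_
        rintro A B ⟨hAB, hA, hB⟩
        exact ⟨(hadj A B).2 ⟨y, hy, (hT x).adj_of_adj (hch x) (hch y) (hT y) hAB
          (hA (by simp)) (hB (by simp))⟩, hAB⟩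
      exact (key hK hxK (Finset.mem_erase.2 hy) hyK (hM (by simp))).trans
        (key hL hxL (Finset.mem_erase.2 hz) hzL (hM (by simp))).symm

end CliqueTrees

/-! ### The union of the local clique trees is a clique graph -/

section Union

variable {V : Type*}

/-- Reachability by edges of a subgraph, starting from one of its vertices. -/
lemma coe_reachable_of_spanningCoe {W : Type*} {X : SimpleGraph W} {S : X.Subgraph} {a b : W}
    (ha : a ∈ S.verts) (hb : b ∈ S.verts) (h : S.spanningCoe.Reachable a b) :
    S.coe.Reachable ⟨a, ha⟩ ⟨b, hb⟩ := by
  by_contra hcon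
  obtain ⟨x, y, hxy, ⟨hx, h1⟩, h2⟩ := exists_adj_of_reachable h
    (P := fun z => ∃ hz : z ∈ S.verts, S.coe.Reachable ⟨a, ha⟩ ⟨z, hz⟩) ⟨ha, .rfl⟩
    fun h => hcon h.2
  have hxy : S.Adj x y := hxy
  have hadj : S.coe.Adj ⟨x, hx⟩ ⟨y, S.edge_vert hxy.symm⟩ := hxy
  exact h2 ⟨S.edge_vert hxy.symm, h1.trans hadj.reachable⟩

variable [LinearOrder V] [Fintype V] {G : SimpleGraph V} {H : V → NodeGraph V}

/-- The parts of the union `H` of the local clique trees are those trees. -/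
lemma coPart_iSup_adj (hch : ∀ v, ChordalOn G (closedNbhd G v))
    (hT : ∀ v, IsKruskalTree G v (H v).spanningCoe) {v : V} {K L : Finset V} :
    (coPart G (⨆ v, H v) v).Adj K L ↔ (H v).Adj K L := by
  simp only [coPart, SimpleGraph.Subgraph.induce_adj, SimpleGraph.Subgraph.iSup_adj,
    Set.mem_ofPred_eq, mem_maxCliques_top]
  constructor
  · rintro ⟨⟨-, hvK⟩, ⟨-, hvL⟩, u, h⟩
    exact (hT u).adj_of_adj (hch u) (hch v) (hT v) h hvK hvL
  · intro h
    exact ⟨(hT v).left_mem h, (hT v).left_mem h.symm, v, h⟩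

lemma isAcyclicCliqueGraph_iSup {r : ℕ} (hr : 3 ≤ r) (hG : IsLocallyChordal r G)
    (hverts : ∀ v, (H v).verts = {K | IsMaxClique G K ∧ v ∈ K})
    (hT : ∀ v, IsKruskalTree G v (H v).spanningCoe) [Nonempty V] :
    IsAcyclicCliqueGraph r G (⨆ v, H v) := by
  have hch : ∀ v, ChordalOn G (closedNbhd G v) := hG.chordalOn_closedNbhd hr
  have hne : ∀ {K : Finset V}, IsMaxClique G K → K.Nonempty := by
    intro K hK
    by_contra h
    rw [Finset.not_nonempty_iff_eq_empty] at h
    obtain ⟨v⟩ := ‹Nonempty V›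
    have := hK.2 (y := {v}) (by change G.IsClique _; simp) (by rw [h]; simp)
    simp [h] at this
  have hV : (⨆ v, H v).verts = maxCliques (⊤ : G.Subgraph) := by
    ext K
    rw [SimpleGraph.Subgraph.verts_iSup, Set.mem_iUnion, mem_maxCliques_top]
    simp only [hverts, Set.mem_ofPred_eq]
    exact ⟨fun ⟨v, h⟩ => h.1, fun h => (hne h).imp fun v hv => ⟨h, hv⟩⟩
  have hcv : ∀ v, (coPart G (⨆ v, H v) v).verts = {K | IsMaxClique G K ∧ v ∈ K} := by
    intro v
    ext K
    simp [coPart, mem_maxCliques_top]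
  refine ⟨⟨⟨hV.le, ?_⟩, hV, ?_, ?_, ?_⟩, ?_⟩
  · intro K L h
    rw [SimpleGraph.Subgraph.iSup_adj] at h
    obtain ⟨v, h⟩ := h
    obtain ⟨h1, h2⟩ := (hT v).left_mem h
    obtain ⟨h3, h4⟩ := (hT v).left_mem (SimpleGraph.Subgraph.Adj.symm h)
    exact ⟨mem_maxCliques_top.2 h1, mem_maxCliques_top.2 h3, h.ne, v, h2, h4⟩
  · intro v
    constructor
    · intro K hK
      rw [hcv] at hK
      rw [hV]
      exact mem_maxCliques_top.2 hK.1
    · intro K L h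
      exact h.2.2
  · intro v
    have hsp : (coPart G (⨆ v, H v) v).spanningCoe = (H v).spanningCoe := by
      ext K L
      exact coPart_iSup_adj hch hT
    have hex : ∃ K, IsMaxClique G K ∧ v ∈ K := by
      obtain ⟨K, hK, hKm⟩ := exists_isMaxClique (G := G) (Q := {v}) (by simp)
      exact ⟨K, hKm, hK (Finset.mem_singleton_self v)⟩
    rw [SimpleGraph.Subgraph.connected_iff]
    constructor
    · rw [SimpleGraph.Subgraph.preconnected_iff]
      rintro ⟨K, hK⟩ ⟨L, hL⟩
      refine coe_reachable_of_spanningCoe hK hL ?_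
      rw [hsp]
      rw [hcv] at hK hL
      by_cases hKL : K = L
      · rw [hKL]
      · exact ((hT v).reachable hKL hK.1 hL.1 hK.2 hL.2).mono (edgesUpTo_le _ _)
    · obtain ⟨K, hK⟩ := hex
      exact ⟨K, by rw [hcv]; exact hK⟩
  · intro u v huv
    rw [hcv, hcv]
    constructor
    · intro h
      obtain ⟨K, hK, hKm⟩ := exists_isMaxClique (G := G) (Q := {u, v}) (by
        rw [Finset.coe_insert, Finset.coe_singleton, SimpleGraph.isClique_pair]
        exact fun _ => h)
      exact ⟨K, ⟨hKm, hK (by simp)⟩, hKm, hK (by simp)⟩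
    · rintro ⟨K, ⟨hK, hu⟩, -, hv⟩
      exact hK.1 hu hv huv
  · intro Y hY
    rw [IsAcyclicSubgraph]
    refine (isAcyclic_biSup hch hT (hG.chordalOn_of_card_le hY)).anti ?_
    intro K L h
    simp only [SimpleGraph.Subgraph.spanningCoe_adj, SimpleGraph.Subgraph.iSup_adj] at h
    obtain ⟨y, hy, h⟩ := h
    simp only [SimpleGraph.iSup_adj]
    exact ⟨y, hy, (coPart_iSup_adj hch hT).1 h⟩

end Union

/-! ### Edges of least rank across a cut -/

section Prim

variable {V : Type*} [LinearOrder V] {G : SimpleGraph V}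

/-- An edge between `S` and its complement that may be listed before all other such edges is an
edge of the Kruskal tree. -/
lemma IsKruskalTree.adj_of_forall_precedes [Finite V] {u : V} {T : SimpleGraph (Finset V)}
    (hu : ChordalOn G (closedNbhd G u)) (hT : IsKruskalTree G u T) {S : Set (Finset V)}
    {K L : Finset V} (hK : IsMaxClique G K) (hL : IsMaxClique G L) (huK : u ∈ K) (huL : u ∈ L)
    (hKS : K ∉ S) (hLS : L ∈ S)
    (hmin : ∀ M N, IsMaxClique G M → IsMaxClique G N → u ∈ M → u ∈ N → M ∉ S → N ∈ S →
      Precedes s(K, L) s(M, N)) : T.Adj K L := by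
  have hKL : K ≠ L := fun h => hKS (h ▸ hLS)
  obtain ⟨M, N, ⟨hMN, hprec⟩, hMS, hNS⟩ := exists_adj_of_reachable
    (hT.reachable hKL hK hL huK huL) (P := fun M => M ∉ S) hKS (not_not.2 hLS)
  obtain ⟨hM, huM⟩ := hT.left_mem hMN
  obtain ⟨hN, huN⟩ := hT.left_mem hMN.symm
  have := precedes_antisymm hu hK hL hM hN huK huL hKL
    (hmin M N hM hN huM huN hMS (not_not.1 hNS)) hprec
  rw [← SimpleGraph.mem_edgeSet, this]
  exact hMN

end Prim

/-! ### Reasoning about runs -/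

section Runs

variable {n : ℕ} {A : Fin n → List (Fin n)}

/-- Started in state `s`, the program `p` halts within `B` steps in a state with property `Q`. -/
def HaltsWith (A : Fin n → List (Fin n)) (p : Prog) (s : State n) (B : ℕ)
    (Q : State n → Prop) : Prop :=
  ∃ t s', t ≤ B ∧ Runs A p s t s' ∧ Q s'

lemma HaltsWith.weaken {p : Prog} {s : State n} {B B' : ℕ} {Q Q' : State n → Prop}
    (h : HaltsWith A p s B Q) (hB : B ≤ B') (hQ : ∀ s, Q s → Q' s) : HaltsWith A p s B' Q' := by
  obtain ⟨t, s', ht, hr, hq⟩ := h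
  exact ⟨t, s', ht.trans hB, hr, hQ _ hq⟩

lemma HaltsWith.seq {p q : Prog} {s : State n} {B B' : ℕ} {Q Q' : State n → Prop}
    (h : HaltsWith A p s B Q) (h' : ∀ s', Q s' → HaltsWith A q s' B' Q') :
    HaltsWith A (.seq p q) s (B + B') Q' := by
  obtain ⟨t, s', ht, hr, hq⟩ := h
  obtain ⟨t', s'', ht', hr', hq'⟩ := h' s' hq
  exact ⟨t + t', s'', by omega, hr.seq hr', hq'⟩

/-- Programs without loops. -/
def Prog.LoopFree : Prog → Prop
  | .instr _ => True
  | .seq p q => p.LoopFree ∧ q.LoopFree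
  | .branch _ p q => p.LoopFree ∧ q.LoopFree
  | .loop _ _ => False

/-- A bound on the number of steps of a loop-free program. -/
def Prog.cost : Prog → ℕ
  | .instr _ => 1
  | .seq p q => p.cost + q.cost
  | .branch _ p q => p.cost + q.cost + 1
  | .loop _ _ => 0

/-- The effect of a loop-free program. -/
def Prog.effect (A : Fin n → List (Fin n)) : Prog → State n → State n
  | .instr i, s => i.exec A s
  | .seq p q, s => q.effect A (p.effect A s)
  | .branch x p q, s => if s.reg x = 0 then q.effect A s else p.effect A s
  | .loop _ _, s => s

lemma haltsWith_of_loopFree {p : Prog} (hp : p.LoopFree) {s : State n} {Q : State n → Prop}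
    (hQ : Q (p.effect A s)) : HaltsWith A p s p.cost Q := by
  suffices h : ∀ s, ∃ t, t ≤ p.cost ∧ Runs A p s t (p.effect A s) by
    obtain ⟨t, ht, hr⟩ := h s
    exact ⟨t, _, ht, hr, hQ⟩
  clear hQ s
  induction p with
  | instr i => exact fun s => ⟨1, le_rfl, .instr i s⟩
  | seq p q ihp ihq =>
    intro s
    obtain ⟨t, ht, hr⟩ := ihp hp.1 s
    obtain ⟨t', ht', hr'⟩ := ihq hp.2 (p.effect A s)
    exact ⟨t + t', by simp only [Prog.cost]; omega, hr.seq hr'⟩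
  | branch x p q ihp ihq =>
    intro s
    simp only [Prog.effect, Prog.cost]
    split_ifs with h
    · obtain ⟨t, ht, hr⟩ := ihq hp.2 s
      exact ⟨t + 1, by omega, .branch_false h hr⟩
    · obtain ⟨t, ht, hr⟩ := ihp hp.1 s
      exact ⟨t + 1, by omega, .branch_true h hr⟩
  | loop => exact hp.elim

/-- An instruction whose only effect is on the scratch register `20`. -/
def skip : Prog := .instr (.const 20 0)

/-- A sequence of instructions. -/
def block : List Instr → Prog
  | [] => skip
  | [i] => .instr i
  | i :: j :: l => .seq (.instr i) (block (j :: l))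

/-- `for i = 0, …, (register b) - 1 do p`, with `c` as a scratch register. It relies on register `1`
holding the number `1`. -/
def forLoop (i c b : ℕ) (p : Prog) : Prog :=
  .seq (.instr (.const i 0)) (.seq (.instr (.sub c b i))
    (.loop c (.seq p (.seq (.instr (.add i i 1)) (.instr (.sub c b i))))))

/-- The rule for `forLoop`: the invariant may not depend on the registers `i` and `c`. -/
lemma haltsWith_forLoop {i c b : ℕ} {p : Prog} {s : State n} {N B : ℕ}
    (Inv : ℕ → State n → Prop) (hic : i ≠ c) (hbi : b ≠ i)
    (h0 : Inv 0 s) (hreg : ∀ k s, Inv k s → s.reg 1 = 1 ∧ s.reg b = N)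
    (hframe : ∀ k s x y, Inv k s →
      Inv k { s with reg := Function.update (Function.update s.reg i x) c y })
    (hbody : ∀ k s, k < N → Inv k s → s.reg i = k →
      HaltsWith A p s B fun s' => s'.reg i = k ∧ Inv (k + 1) s') :
    HaltsWith A (forLoop i c b p) s (N * (B + 3) + 3) (Inv N) := by
  have hloop : ∀ j k s, k + j = N → Inv k s → s.reg i = k → s.reg c = j →
      HaltsWith A (.loop c (.seq p (.seq (.instr (.add i i 1)) (.instr (.sub c b i))))) s
        (j * (B + 3) + 1) (Inv N) := by
    intro j
    induction j with
    | zero =>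
      intro k s hk hinv hi hc
      obtain rfl : k = N := by omega
      exact ⟨1, s, by omega, .loop_false hc, hinv⟩
    | succ j ih =>
      intro k s hk hinv hi hc
      obtain ⟨t, s', ht, hr, hi', hinv'⟩ := hbody k s (by omega) hinv hi
      have hreg' := hreg _ _ hinv'
      set s₂ : State n := (Instr.sub c b i).exec A ((Instr.add i i 1).exec A s') with hs₂
      have hs₂' : s₂ = { s' with
          reg := Function.update (Function.update s'.reg i (k + 1)) c (N - (k + 1)) } := by
        simp [hs₂, Instr.exec, hreg'.1, hreg'.2, hi', hbi]
      have hrun : Runs A (.seq p (.seq (.instr (.add i i 1)) (.instr (.sub c b i)))) s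
          (t + (1 + 1)) s₂ := hr.seq ((Runs.instr _ _).seq (Runs.instr _ _))
      obtain ⟨t', s₃, ht', hr', hq⟩ := ih (k + 1) s₂ (by omega)
        (by rw [hs₂']; exact hframe _ _ _ _ hinv') (by simp [hs₂', hic])
        (by simp [hs₂']; omega)
      refine ⟨t + (1 + 1) + t' + 1, s₃, ?_, .loop_true (by omega) hrun hr', hq⟩
      have : (j + 1) * (B + 3) = j * (B + 3) + (B + 3) := by ring
      omega
  have hreg0 := hreg _ _ h0
  set s₂ : State n := (Instr.sub c b i).exec A ((Instr.const i 0).exec A s) with hs₂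
  have hs₂' : s₂ = { s with reg := Function.update (Function.update s.reg i 0) c N } := by
    simp [hs₂, Instr.exec, hreg0.2, hbi]
  obtain ⟨t', s₃, ht', hr', hq⟩ := hloop N 0 s₂ (by omega)
    (by rw [hs₂']; exact hframe _ _ _ _ h0) (by simp [hs₂', hic]) (by simp [hs₂'])
  exact ⟨1 + (1 + t'), s₃, by omega, (Runs.instr _ _).seq ((Runs.instr _ _).seq hr'), hq⟩

/-- The states `s₀` and `s` differ at most in the registers listed in `R` and the set registers
listed in `S`. -/
structure AgreeOff (R S : List ℕ) (s₀ s : State n) : Prop where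
  reg : ∀ r, r ∉ R → s.reg r = s₀.reg r
  sreg : ∀ a, a ∉ S → s.sreg a = s₀.sreg a
  arr : s.arr = s₀.arr
  sarr : s.sarr = s₀.sarr
  nodes : s.nodes = s₀.nodes
  edges : s.edges = s₀.edges

lemma AgreeOff.refl (R S : List ℕ) (s : State n) : AgreeOff R S s s :=
  ⟨fun _ _ => rfl, fun _ _ => rfl, rfl, rfl, rfl, rfl⟩

lemma AgreeOff.update {R S : List ℕ} {s₀ s : State n} (h : AgreeOff R S s₀ s) {i c : ℕ}
    (hi : i ∈ R) (hc : c ∈ R) (x y : ℕ) :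
    AgreeOff R S s₀ { s with reg := Function.update (Function.update s.reg i x) c y } := by
  refine ⟨fun r hr => ?_, h.sreg, h.arr, h.sarr, h.nodes, h.edges⟩
  have h1 : r ≠ i := fun h' => hr (h' ▸ hi)
  have h2 : r ≠ c := fun h' => hr (h' ▸ hc)
  simp [h1, h2, h.reg r hr]

/-- The number register that an instruction overwrites, if any. -/
def Instr.regs : Instr → List ℕ
  | .const x _ | .add x _ _ | .sub x _ _ | .load x _ _ | .deg x _ | .nbr x _ _ | .scard x _
  | .smem x _ _ | .slex x _ _ => [x]
  | _ => []

/-- The set register that an instruction overwrites, if any. -/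
def Instr.sregs : Instr → List ℕ
  | .sempty a | .sinsert a _ | .sunion a _ _ | .sinter a _ _ | .sdiff a _ _ | .sload a _ _ => [a]
  | _ => []

/-- The instruction neither writes to an array nor produces output. -/
def Instr.OnlyRegs : Instr → Prop
  | .store _ _ _ | .sstore _ _ _ | .emitNode _ | .emitEdge _ _ => False
  | _ => True

/-- The number registers that a program may overwrite. -/
def Prog.regs : Prog → List ℕ
  | .instr i => i.regs
  | .seq p q => p.regs ++ q.regs
  | .branch _ p q => p.regs ++ q.regs
  | .loop _ p => p.regs

/-- The set registers that a program may overwrite. -/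
def Prog.sregs : Prog → List ℕ
  | .instr i => i.sregs
  | .seq p q => p.sregs ++ q.sregs
  | .branch _ p q => p.sregs ++ q.sregs
  | .loop _ p => p.sregs

/-- The program neither writes to an array nor produces output. -/
def Prog.OnlyRegs : Prog → Prop
  | .instr i => i.OnlyRegs
  | .seq p q => p.OnlyRegs ∧ q.OnlyRegs
  | .branch _ p q => p.OnlyRegs ∧ q.OnlyRegs
  | .loop _ p => p.OnlyRegs

lemma AgreeOff.trans {R S : List ℕ} {s₀ s s' : State n} (h : AgreeOff R S s₀ s)
    (h' : AgreeOff R S s s') : AgreeOff R S s₀ s' :=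
  ⟨fun r hr => (h'.reg r hr).trans (h.reg r hr), fun r hr => (h'.sreg r hr).trans (h.sreg r hr),
    h'.arr.trans h.arr, h'.sarr.trans h.sarr, h'.nodes.trans h.nodes, h'.edges.trans h.edges⟩

lemma Instr.agreeOff_exec {i : Instr} (hi : i.OnlyRegs) {R S : List ℕ} (hR : i.regs ⊆ R)
    (hS : i.sregs ⊆ S) (s : State n) : AgreeOff R S s (i.exec A s) := by
  have hr : ∀ x ∈ R, ∀ r ∉ R, r ≠ x := fun x hx r hr h => hr (h ▸ hx)
  have hs : ∀ x ∈ S, ∀ r ∉ S, r ≠ x := fun x hx r hr h => hr (h ▸ hx)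
  cases i <;> simp only [Instr.OnlyRegs, Instr.regs, Instr.sregs, List.cons_subset] at hi hR hS <;>
    first
    | exact hi.elim
    | exact ⟨fun r h => Function.update_of_ne (hr _ hR.1 r h) _ _, fun _ _ => rfl, rfl, rfl, rfl,
        rfl⟩
    | exact ⟨fun _ _ => rfl, fun r h => Function.update_of_ne (hs _ hS.1 r h) _ _, rfl, rfl, rfl,
        rfl⟩

/-- A program changes only the registers that its text mentions as targets. -/
lemma Runs.agreeOff {R S : List ℕ} {p : Prog} {s s' : State n} {t : ℕ} (h : Runs A p s t s')
    (hp : p.OnlyRegs) (hR : p.regs ⊆ R) (hS : p.sregs ⊆ S) : AgreeOff R S s s' := by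
  induction h with
  | instr i s => exact Instr.agreeOff_exec hp hR hS s
  | seq _ _ ih ih' =>
    rw [Prog.regs, List.append_subset] at hR
    rw [Prog.sregs, List.append_subset] at hS
    exact (ih hp.1 hR.1 hS.1).trans (ih' hp.2 hR.2 hS.2)
  | branch_true _ _ ih =>
    rw [Prog.regs, List.append_subset] at hR
    rw [Prog.sregs, List.append_subset] at hS
    exact ih hp.1 hR.1 hS.1
  | branch_false _ _ ih =>
    rw [Prog.regs, List.append_subset] at hR
    rw [Prog.sregs, List.append_subset] at hS
    exact ih hp.2 hR.2 hS.2
  | loop_true _ _ _ ih ih' => exact (ih hp hR hS).trans (ih' hp hR hS)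
  | loop_false _ => exact .refl _ _ _

lemma HaltsWith.agreeOff {p : Prog} {s : State n} {B : ℕ} {Q : State n → Prop}
    (h : HaltsWith A p s B Q) (R S : List ℕ) (hp : p.OnlyRegs) (hR : p.regs ⊆ R)
    (hS : p.sregs ⊆ S) : HaltsWith A p s B fun s' => AgreeOff R S s s' ∧ Q s' := by
  obtain ⟨t, s', ht, hr, hq⟩ := h
  exact ⟨t, s', ht, hr, hr.agreeOff hp hR hS, hq⟩

/-- The rule for a `forLoop` whose body only changes registers: the invariant has to speak only
about registers that are overwritten. -/
lemma haltsWith_forLoop_onlyRegs {i c b : ℕ} {p : Prog} {s : State n} {N B : ℕ} (R S : List ℕ)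
    (Inv : ℕ → State n → Prop) (hp : p.OnlyRegs) (hR : p.regs ⊆ R) (hS : p.sregs ⊆ S) (hi : i ∈ R)
    (hip : i ∉ p.regs) (hc : c ∈ R) (hb : b ∉ R) (hone : 1 ∉ R) (hic : i ≠ c) (hreg1 : s.reg 1 = 1)
    (hregb : s.reg b = N) (h0 : Inv 0 s)
    (hframe : ∀ k s x y, Inv k s →
      Inv k { s with reg := Function.update (Function.update s.reg i x) c y })
    (hbody : ∀ k s', k < N → AgreeOff R S s s' → Inv k s' → s'.reg i = k →
      HaltsWith A p s' B (Inv (k + 1))) :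
    HaltsWith A (forLoop i c b p) s (N * (B + 3) + 3) fun s' => AgreeOff R S s s' ∧ Inv N s' := by
  refine haltsWith_forLoop (fun k s' => AgreeOff R S s s' ∧ Inv k s') hic
    (fun h => hb (h ▸ hi)) ⟨.refl _ _ _, h0⟩ ?_ ?_ ?_
  · rintro k s' ⟨h, -⟩
    exact ⟨(h.reg 1 hone).trans hreg1, (h.reg b hb).trans hregb⟩
  · rintro k s' x y ⟨h, h'⟩
    exact ⟨h.update hi hc x y, hframe k s' x y h'⟩
  · rintro k s' hk ⟨h, h'⟩ hik
    obtain ⟨t, s'', ht, hr, hq⟩ := hbody k s' hk h h' hik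
    exact ⟨t, s'', ht, hr, ((hr.agreeOff hp (List.Subset.refl _) (List.Subset.refl _)).reg i
      hip).trans hik, h.trans (hr.agreeOff hp hR hS), hq⟩

end Runs

/-! ### Reading the neighbourhoods -/

section ReadNbhds

/-- Read the neighbours of the vertex in register `8` into set register `0`. -/
def readNbrs : Prog :=
  .seq (block [.sempty 0, .deg 9 8]) (forLoop 10 11 9 (block [.nbr 7 8 10, .sinsert 0 7]))

/-- Store the vertices of `N[v]` in number array `0`, their neighbourhoods in set array `0`, and
their number in register `3`. -/
def readNbhds : Prog :=
  .seq (block [.const 1 1, .deg 2 0, .add 3 2 1])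
    (forLoop 5 6 3
      (.seq (.seq (.instr (.sub 7 2 5)) (.seq (.branch 7 (block [.nbr 8 0 5]) (block [.add 8 0 4]))
        (block [.store 0 5 8])))
      (.seq readNbrs (block [.sstore 0 5 0]))))

variable {n : ℕ} {A : Fin n → List (Fin n)}

/-- The vertices of `N[v]` in the order in which they are stored; the last one is `v`. -/
def nbhdVertex (A : Fin n → List (Fin n)) (v : Fin n) (i : ℕ) : Fin n :=
  if h : i < (A v).length then (A v)[i] else v

lemma adjAt_val (u : Fin n) : adjAt A u.val = A u := by simp [adjAt]

lemma haltsWith_readNbrs {s : State n} {u : Fin n} (h1 : s.reg 1 = 1) (h8 : s.reg 8 = u) :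
    HaltsWith A readNbrs s ((A u).length * 5 + 5) fun s' =>
      AgreeOff [7, 9, 10, 11] [0] s s' ∧ s'.sreg 0 = (A u).toFinset := by
  refine HaltsWith.agreeOff ?_ _ _ (by simp [readNbrs, forLoop, block, Prog.OnlyRegs,
    Instr.OnlyRegs]) (by decide) (by decide)
  have hstart : HaltsWith A (block [.sempty 0, .deg 9 8]) s 2 fun s' =>
      s'.sreg 0 = ∅ ∧ s'.reg 9 = (A u).length ∧ s'.reg 1 = 1 ∧ s'.reg 8 = u := by
    refine haltsWith_of_loopFree (by simp [block, Prog.LoopFree]) ?_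
    simp [block, Prog.effect, Instr.exec, h1, h8, adjAt_val]
  refine (hstart.seq (B' := (A u).length * (2 + 3) + 3) fun s₁ hs₁ =>
    (haltsWith_forLoop_onlyRegs (i := 10) (c := 11) (b := 9)
    (p := block [.nbr 7 8 10, .sinsert 0 7]) (N := (A u).length) (B := 2)
    [7, 10, 11] [0] (fun j s' => s'.sreg 0 = ((A u).take j).toFinset)
    (by simp [block, Prog.OnlyRegs, Instr.OnlyRegs]) (by decide) (by decide) (by decide)
    (by decide) (by decide) (by decide) (by decide) (by decide)
    hs₁.2.2.1 hs₁.2.1 (by simp [hs₁.1]) (fun _ _ _ _ h => h) ?_).weaken le_rfl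
      fun s' h => by simpa using h.2).weaken (by omega) fun _ h => h
  · intro k s' hk h h0 h10
    refine haltsWith_of_loopFree (by simp [block, Prog.LoopFree]) ?_
    have h8' : s'.reg 8 = u := by rw [h.reg 8 (by decide), hs₁.2.2.2]
    have htake : (A u).take (k + 1) = (A u).take k ++ [(A u)[k]] :=
      (List.take_concat_get' _ _ hk).symm
    rw [htake, List.toFinset_append, ← h0]
    simp [block, Prog.effect, Instr.exec, h8', h10, adjAt_val, hk]

/-- The contents of the memory while (`k ≤ deg v`) and after (`k = deg v + 1`) the neighbourhoods
are read. -/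
structure NbhdsRead (A : Fin n → List (Fin n)) (v : Fin n) (k : ℕ) (s : State n) : Prop where
  reg0 : s.reg 0 = v
  reg1 : s.reg 1 = 1
  reg2 : s.reg 2 = (A v).length
  reg3 : s.reg 3 = (A v).length + 1
  reg4 : s.reg 4 = 0
  reg15 : s.reg 15 = 0
  sreg1 : s.sreg 1 = ∅
  sreg5 : s.sreg 5 = ∅
  sarr2 : s.sarr 2 = fun _ => ∅
  nodes : s.nodes = []
  edges : s.edges = []
  arr0 : ∀ i < k, s.arr 0 i = nbhdVertex A v i
  sarr0 : ∀ i < k, s.sarr 0 i = (A (nbhdVertex A v i)).toFinset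

lemma haltsWith_readNbhds (v : Fin n) {D : ℕ} (hD : ∀ u, (A u).length ≤ D) :
    HaltsWith A readNbhds (initState v) ((D + 1) * (5 * D + 15) + 6)
      (NbhdsRead A v ((A v).length + 1)) := by
  have hstart : HaltsWith A (block [.const 1 1, .deg 2 0, .add 3 2 1]) (initState v) 3
      (NbhdsRead A v 0) := by
    refine haltsWith_of_loopFree (by simp [block, Prog.LoopFree]) ?_
    constructor <;> simp [block, Prog.effect, Instr.exec, initState, adjAt_val]
  have hmono : ((A v).length + 1) * (5 * D + 12 + 3) ≤ (D + 1) * (5 * D + 15) :=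
    Nat.mul_le_mul (by have := hD v; omega) (by omega)
  refine (hstart.seq fun s₁ hs₁ => haltsWith_forLoop (N := (A v).length + 1) (B := 5 * D + 12)
    (NbhdsRead A v) (by decide) (by decide) hs₁ (fun k s h => ⟨h.reg1, h.reg3⟩)
    ?_ ?_).weaken (by omega) fun s h => h
  · rintro k s x y h
    exact ⟨by simpa using h.reg0, by simpa using h.reg1, by simpa using h.reg2,
      by simpa using h.reg3, by simpa using h.reg4, by simpa using h.reg15, h.sreg1, h.sreg5,
      h.sarr2, h.nodes, h.edges, h.arr0, h.sarr0⟩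
  · intro k s hk h h5
    set u := nbhdVertex A v k with hu
    have hfirst : HaltsWith A (.seq (.instr (.sub 7 2 5)) (.seq
        (.branch 7 (block [.nbr 8 0 5]) (block [.add 8 0 4])) (block [.store 0 5 8]))) s 5
        fun s' => s' = { s with
          reg := Function.update (Function.update s.reg 7 ((A v).length - k)) 8 u
          arr := Function.update s.arr 0 (Function.update (s.arr 0) k u) } := by
      refine (haltsWith_of_loopFree (by simp [block, Prog.LoopFree]) (Q := fun s' => s' = { s with
          reg := Function.update (Function.update s.reg 7 ((A v).length - k)) 8 u
          arr := Function.update s.arr 0 (Function.update (s.arr 0) k u) }) ?_).weaken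
        (by simp [Prog.cost, block]) fun _ h => h
      rcases Nat.lt_or_ge k (A v).length with hlt | hge
      · have hne : (A v).length - k ≠ 0 := by omega
        have huv : u = (A v)[k] := by simp [hu, nbhdVertex, hlt]
        simp [block, Prog.effect, Instr.exec, h.reg2, h5, hne, h.reg0, adjAt_val, hlt, huv]
      · have hne : (A v).length - k = 0 := by omega
        have huv : u = v := by simp [hu, nbhdVertex, hge]
        simp [block, Prog.effect, Instr.exec, h.reg2, h5, hne, h.reg0, h.reg4, huv]
    have hDu := hD u
    refine (hfirst.seq fun s₂ hs₂ => (haltsWith_readNbrs (u := u) (by simp [hs₂, h.reg1])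
      (by simp [hs₂])).seq fun s₃ hs₃ => haltsWith_of_loopFree (by simp [block, Prog.LoopFree])
        (Q := fun s' => s'.reg 5 = k ∧ NbhdsRead A v (k + 1) s') ?_).weaken
      (by simp only [block, Prog.cost]; omega) fun _ h => h
    obtain ⟨hs₃, hs₃'⟩ := hs₃
    have h53 : s₃.reg 5 = k := by rw [hs₃.reg 5 (by decide)]; simp [hs₂, h5]
    have harr : s₃.arr = Function.update s.arr 0 (Function.update (s.arr 0) k u) := by
      rw [hs₃.arr, hs₂]
    have hsarr : s₃.sarr = s.sarr := by rw [hs₃.sarr, hs₂]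
    have hr : ∀ r, r ∉ [7, 9, 10, 11] → r ≠ 8 → s₃.reg r = s.reg r := by
      intro r hr h8
      rw [hs₃.reg r hr]
      simp only [List.mem_cons, not_or] at hr
      simp [hs₂, h8, hr]
    have hsr : ∀ a, a ∉ [0] → s₃.sreg a = s.sreg a := by
      intro r hr
      rw [hs₃.sreg r hr, hs₂]
    simp only [block, Prog.effect, Instr.exec]
    refine ⟨h53, ?_⟩
    constructor
    · simpa using (hr 0 (by decide) (by decide)).trans h.reg0
    · simpa using (hr 1 (by decide) (by decide)).trans h.reg1
    · simpa using (hr 2 (by decide) (by decide)).trans h.reg2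
    · simpa using (hr 3 (by decide) (by decide)).trans h.reg3
    · simpa using (hr 4 (by decide) (by decide)).trans h.reg4
    · simpa using (hr 15 (by decide) (by decide)).trans h.reg15
    · simpa using (hsr 1 (by decide)).trans h.sreg1
    · simpa using (hsr 5 (by decide)).trans h.sreg5
    · simpa [hsarr] using h.sarr2
    · simpa [hs₂, h.nodes] using hs₃.nodes
    · simpa [hs₂, h.edges] using hs₃.edges
    · intro i hi
      by_cases hik : i = k
      · subst hik; simp [harr, hu]
      · simpa [harr, hik] using h.arr0 i (by omega)
    · intro i hi
      by_cases hik : i = k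
      · subst hik; simp [h53, hs₃', hu]
      · simpa [h53, hik, hsarr] using h.sarr0 i (by omega)

end ReadNbhds

/-! ### Finding the maximal cliques -/

section FindCliques

/-- One step of the search for an unvisited vertex with the most visited neighbours: the vertex
number `j` (register `10`) is compared with the best vertex so far (register `13`). The visited set
is set register `1`, register `12` holds one more than the number of visited neighbours of the best
vertex (or `0`), and set register `3` the set of these. -/
def compareVertex : Prog :=
  .seq (block [.load 7 0 10, .smem 8 7 1]) (.branch 8 skip
    (.seq (block [.sload 2 0 10, .sinter 2 2 1, .scard 9 2, .add 9 9 1, .sub 8 9 12])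
      (.branch 8 (block [.add 12 9 4, .add 13 7 4, .sunion 3 2 2]) skip)))

/-- Set register `14` to zero if the clique in set register `3` lies in the neighbourhood of vertex
number `j` (register `10`). -/
def testMaximal : Prog :=
  .seq (block [.sload 2 0 10, .sdiff 2 3 2, .scard 9 2]) (.branch 9 skip (block [.const 14 0]))

/-- Visit the next vertex of a maximum cardinality search. If it forms a maximal clique together
with its visited neighbours, output this clique and append it to set array `1`, whose length is
kept in register `15`. -/
def visitVertex : Prog :=
  .seq (block [.const 12 0]) (.seq (forLoop 10 11 3 compareVertex)
    (.seq (block [.sinsert 3 13, .sinsert 1 13, .const 14 1])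
      (.seq (forLoop 10 11 3 testMaximal)
        (.branch 14 (block [.emitNode 3, .sstore 1 15 3, .add 15 15 1]) skip))))

/-- Output the maximal cliques that contain `v` and store them in set array `1`. -/
def findCliques : Prog := forLoop 5 6 3 visitVertex

variable {n : ℕ} {G : SimpleGraph (Fin n)} [DecidableRel G.Adj] {A : Fin n → List (Fin n)}
  {v : Fin n}

/-- The closed neighbourhood of `v`, as a finite set. -/
def nbhdFinset (G : SimpleGraph (Fin n)) [DecidableRel G.Adj] (v : Fin n) : Finset (Fin n) :=
  insert v (G.neighborFinset v)

lemma coe_nbhdFinset : (nbhdFinset G v : Set (Fin n)) = closedNbhd G v := by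
  ext w
  simp [nbhdFinset, closedNbhd]

lemma IsAdjList.toFinset_eq (hA : IsAdjList G A) (u : Fin n) :
    (A u).toFinset = G.neighborFinset u := by
  ext w
  simp [(hA u).2 w]

lemma IsAdjList.length_eq (hA : IsAdjList G A) (u : Fin n) : (A u).length = G.degree u := by
  rw [← List.toFinset_card_of_nodup (hA u).1, hA.toFinset_eq, SimpleGraph.card_neighborFinset_eq_degree]

lemma IsAdjList.card_nbhdFinset (hA : IsAdjList G A) :
    (nbhdFinset G v).card = (A v).length + 1 := by
  rw [nbhdFinset, Finset.card_insert_of_notMem (by simp),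
    SimpleGraph.card_neighborFinset_eq_degree, hA.length_eq]

lemma IsAdjList.mem_nbhdFinset_iff (hA : IsAdjList G A) {w : Fin n} :
    w ∈ nbhdFinset G v ↔ ∃ i < (A v).length + 1, nbhdVertex A v i = w := by
  simp only [nbhdFinset, Finset.mem_insert, SimpleGraph.mem_neighborFinset, ← (hA v).2]
  constructor
  · rintro (rfl | h)
    · exact ⟨(A w).length, by omega, by simp [nbhdVertex]⟩
    · obtain ⟨i, hi, rfl⟩ := List.getElem_of_mem h
      exact ⟨i, by omega, by simp [nbhdVertex, hi]⟩
  · rintro ⟨i, hi, rfl⟩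
    unfold nbhdVertex
    split_ifs with h
    · exact Or.inr (List.getElem_mem h)
    · exact Or.inl rfl

/-- The clique that the vertex `u` forms with its neighbours among the vertices in `t`. -/
def cliqueAt (G : SimpleGraph (Fin n)) [DecidableRel G.Adj] (u : Fin n) (t : Finset (Fin n)) :
    Finset (Fin n) :=
  insert u (G.neighborFinset u ∩ t)

/-- The cliques found by a complete maximum cardinality search of `G[N[v]]` that lie in no
neighbourhood of a vertex of `N[v]` are the maximal cliques that contain `v`. -/
lemma mem_found_iff (hch : ChordalOn G (closedNbhd G v)) {l : List (Fin n)}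
    (hl : IsMCS G (nbhdFinset G v) l) (hall : l.toFinset = nbhdFinset G v) {Q : Finset (Fin n)} :
    ((∃ u t, (u :: t) <:+ l ∧ Q = cliqueAt G u t.toFinset) ∧
      ∀ w ∈ nbhdFinset G v, ¬ Q ⊆ G.neighborFinset w) ↔ IsMaxClique G Q ∧ v ∈ Q := by
  have hX : ∀ {w}, w ∈ nbhdFinset G v ↔ w ∈ closedNbhd G v := by
    intro w; rw [← coe_nbhdFinset]; simp
  have hclique : ∀ u t, (u :: t) <:+ l → G.IsClique (cliqueAt G u t.toFinset : Set (Fin n)) := by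
    intro u t h
    rw [cliqueAt, Finset.coe_insert, SimpleGraph.isClique_insert]
    refine ⟨(hl.suffix h).isClique_inter (by rwa [coe_nbhdFinset]), fun b hb _ => ?_⟩
    simp only [Finset.coe_inter, Set.mem_inter_iff, Finset.mem_coe,
      SimpleGraph.mem_neighborFinset] at hb
    exact hb.1
  constructor
  · rintro ⟨⟨u, t, hut, rfl⟩, hmax⟩
    have hcl := hclique u t hut
    have hsub : cliqueAt G u t.toFinset ⊆ nbhdFinset G v := by
      refine subset_trans ?_ (hl.suffix hut).subset
      rw [List.toFinset_cons]
      exact Finset.insert_subset_insert _ Finset.inter_subset_right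
    have hv : v ∈ cliqueAt G u t.toFinset := by
      by_contra hv
      refine hmax v (hX.2 (Or.inl rfl)) fun w hw => ?_
      rw [SimpleGraph.mem_neighborFinset]
      exact (hX.1 (hsub hw)).resolve_left fun h => hv (h ▸ hw)
    refine ⟨⟨hcl, fun L hL hQL w hw => ?_⟩, hv⟩
    by_contra hwQ
    have hL : G.IsClique (L : Set (Fin n)) := hL
    refine hmax w (hX.2 (subset_closedNbhd hL (hQL hv) hw)) fun z hz => ?_
    rw [SimpleGraph.mem_neighborFinset]
    exact hL hw (hQL hz) fun h => hwQ (h ▸ hz)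
  · rintro ⟨hQ, hv⟩
    constructor
    · obtain ⟨u, t, hut, hQs⟩ := exists_suffix_of_isClique hQ.1 ⟨v, hv⟩ (l := l) (by
        intro w hw
        rw [hall, hX]
        exact subset_closedNbhd hQ.1 hv hw)
      exact ⟨u, t, hut, le_antisymm hQs (hQ.2 (hclique u t hut) hQs)⟩
    · intro w _ hsub
      have hw : w ∈ Q := by
        refine hQ.2 (y := insert w Q) ?_ (Finset.subset_insert _ _) (Finset.mem_insert_self _ _)
        change G.IsClique ((insert w Q : Finset (Fin n)) : Set (Fin n))
        rw [Finset.coe_insert, SimpleGraph.isClique_insert]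
        exact ⟨hQ.1, fun b hb _ => by simpa using hsub hb⟩
      simpa using hsub hw

/-- The part of the memory that does not change any more while the cliques are determined. -/
structure NbhdsStored (G : SimpleGraph (Fin n)) [DecidableRel G.Adj] (A : Fin n → List (Fin n))
    (v : Fin n) (s : State n) : Prop where
  reg1 : s.reg 1 = 1
  reg3 : s.reg 3 = (A v).length + 1
  reg4 : s.reg 4 = 0
  sreg5 : s.sreg 5 = ∅
  sarr2 : s.sarr 2 = fun _ => ∅
  edges : s.edges = []
  arr0 : ∀ i < (A v).length + 1, s.arr 0 i = nbhdVertex A v i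
  sarr0 : ∀ i < (A v).length + 1, s.sarr 0 i = G.neighborFinset (nbhdVertex A v i)

lemma NbhdsStored.of_agreeOff {R S : List ℕ} {s s' : State n} (h : NbhdsStored G A v s)
    (hs : AgreeOff R S s s') (h1 : 1 ∉ R) (h3 : 3 ∉ R) (h4 : 4 ∉ R) (h5 : 5 ∉ S) :
    NbhdsStored G A v s' :=
  ⟨by rw [hs.reg 1 h1, h.reg1], by rw [hs.reg 3 h3, h.reg3], by rw [hs.reg 4 h4, h.reg4],
    by rw [hs.sreg 5 h5, h.sreg5], by rw [hs.sarr, h.sarr2], by rw [hs.edges, h.edges],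
    by rw [hs.arr]; exact h.arr0, by rw [hs.sarr]; exact h.sarr0⟩

/-- The search for the next vertex finds an unvisited vertex with the most visited neighbours. -/
lemma haltsWith_compareVertex_loop (hA : IsAdjList G A) {s : State n} (hs : NbhdsStored G A v s)
    (h12 : s.reg 12 = 0) (hex : ∃ w ∈ nbhdFinset G v, w ∉ s.sreg 1) :
    HaltsWith A (forLoop 10 11 3 compareVertex) s (((A v).length + 1) * 18 + 3) fun s' =>
      AgreeOff [7, 8, 9, 10, 11, 12, 13, 20] [2, 3] s s' ∧ ∃ u ∈ nbhdFinset G v, u ∉ s.sreg 1 ∧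
        s'.reg 13 = u ∧ s'.sreg 3 = G.neighborFinset u ∩ s.sreg 1 ∧
        ∀ w ∈ nbhdFinset G v, w ∉ s.sreg 1 →
          (G.neighborFinset w ∩ s.sreg 1).card ≤ (G.neighborFinset u ∩ s.sreg 1).card := by
  refine (haltsWith_forLoop_onlyRegs (i := 10) (c := 11) (b := 3) (p := compareVertex)
    (N := (A v).length + 1) (B := 15) [7, 8, 9, 10, 11, 12, 13, 20] [2, 3]
    (fun j s' => (∀ i < j, nbhdVertex A v i ∉ s.sreg 1 →
        (G.neighborFinset (nbhdVertex A v i) ∩ s.sreg 1).card + 1 ≤ s'.reg 12) ∧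
      (s'.reg 12 = 0 ∨ ∃ u ∈ nbhdFinset G v, u ∉ s.sreg 1 ∧ s'.reg 13 = u ∧
        s'.sreg 3 = G.neighborFinset u ∩ s.sreg 1 ∧
        s'.reg 12 = (G.neighborFinset u ∩ s.sreg 1).card + 1))
    (by simp [compareVertex, skip, block, Prog.OnlyRegs, Instr.OnlyRegs]) (by decide) (by decide)
    (by decide) (by decide) (by decide) (by decide) (by decide) (by decide) hs.reg1 hs.reg3
    ⟨by simp, Or.inl h12⟩ ?_ ?_).weaken le_rfl ?_
  · rintro k s' x y ⟨h', h''⟩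
    exact ⟨by simpa using h', by simpa using h''⟩
  · rintro k s' hk h ⟨hmax, hcur⟩ h10
    have hst := hs.of_agreeOff h (by decide) (by decide) (by decide) (by decide)
    set u := nbhdVertex A v k with hu
    have hl : s'.arr 0 k = u := hst.arr0 k hk
    have hsl : s'.sarr 0 k = G.neighborFinset u := hst.sarr0 k hk
    have hS : s'.sreg 1 = s.sreg 1 := h.sreg 1 (by decide)
    have hmem : (∃ w ∈ s.sreg 1, w.val = u.val) ↔ u ∈ s.sreg 1 :=
      ⟨fun ⟨w, hw, h⟩ => Fin.ext h ▸ hw, fun h => ⟨u, h, rfl⟩⟩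
    refine (haltsWith_of_loopFree (by simp [compareVertex, skip, block, Prog.LoopFree]) ?_).weaken
      (B := compareVertex.cost) (by simp [compareVertex, skip, block, Prog.cost]) fun _ h => h
    have hstep : ∀ i < k + 1, i = k ∨ i < k := fun i hi => by omega
    simp only [compareVertex, skip, block, Prog.effect, Instr.exec]
    by_cases huS : u ∈ s.sreg 1
    · have hmem' := hmem.2 huS
      simp only [Function.update_self, ne_eq, Nat.reduceEqDiff, not_false_eq_true,
        Function.update_of_ne, h10, hl, hS, hmem', if_true, one_ne_zero, if_false]
      refine ⟨fun i hi hi' => hmax i ((hstep i hi).resolve_left ?_) hi', hcur⟩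
      rintro rfl
      exact hi' huS
    · have hmem' : ¬ ∃ w ∈ s.sreg 1, w.val = u.val := fun h => huS (hmem.1 h)
      rcases Nat.lt_or_ge (s'.reg 12) ((G.neighborFinset u ∩ s.sreg 1).card + 1) with hlt | hge
      · have hne : (G.neighborFinset u ∩ s.sreg 1).card + 1 - s'.reg 12 ≠ 0 := by omega
        simp only [Function.update_self, ne_eq, Nat.reduceEqDiff, not_false_eq_true,
          Function.update_of_ne, h10, hl, hsl, hS, hmem', if_false, if_true, hst.reg1, hne, hst.reg4,
          add_zero, Finset.union_self]
        refine ⟨fun i hi hi' => ?_, Or.inr ⟨u, hA.mem_nbhdFinset_iff.2 ⟨k, hk, rfl⟩, huS, rfl, rfl,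
          rfl⟩⟩
        rcases hstep i hi with rfl | hi
        · exact le_rfl
        · exact (hmax i hi hi').trans hlt.le
      · have hne : (G.neighborFinset u ∩ s.sreg 1).card + 1 - s'.reg 12 = 0 := by omega
        simp only [Function.update_self, ne_eq, Nat.reduceEqDiff, not_false_eq_true,
          Function.update_of_ne, h10, hl, hsl, hS, hmem', if_false, if_true, hst.reg1, hne]
        refine ⟨fun i hi hi' => ?_, hcur⟩
        rcases hstep i hi with rfl | hi
        · exact hge
        · exact hmax i hi hi'
  · rintro s' ⟨h, hmax, hcur⟩
    refine ⟨h, ?_⟩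
    have hmax' : ∀ w ∈ nbhdFinset G v, w ∉ s.sreg 1 →
        (G.neighborFinset w ∩ s.sreg 1).card + 1 ≤ s'.reg 12 := by
      intro w hw hwS
      obtain ⟨i, hi, rfl⟩ := hA.mem_nbhdFinset_iff.1 hw
      exact hmax i hi hwS
    rcases hcur with h0 | ⟨u, hu, huS, h13, h3, h12'⟩
    · obtain ⟨w, hw, hwS⟩ := hex
      have := hmax' w hw hwS
      omega
    · refine ⟨u, hu, huS, h13, h3, fun w hw hwS => ?_⟩
      have := hmax' w hw hwS
      rw [h12'] at this
      omega

lemma haltsWith_testMaximal_loop (hA : IsAdjList G A) {s : State n} (hs : NbhdsStored G A v s)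
    (h14 : s.reg 14 = 1) :
    HaltsWith A (forLoop 10 11 3 testMaximal) s (((A v).length + 1) * 9 + 3) fun s' =>
      AgreeOff [9, 10, 11, 14, 20] [2] s s' ∧
        (s'.reg 14 ≠ 0 ↔ ∀ w ∈ nbhdFinset G v, ¬ s.sreg 3 ⊆ G.neighborFinset w) := by
  refine (haltsWith_forLoop_onlyRegs (i := 10) (c := 11) (b := 3) (p := testMaximal)
    (N := (A v).length + 1) (B := 6) [9, 10, 11, 14, 20] [2]
    (fun j s' => s'.reg 14 ≠ 0 ↔ ∀ i < j, ¬ s.sreg 3 ⊆ G.neighborFinset (nbhdVertex A v i))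
    (by simp [testMaximal, skip, block, Prog.OnlyRegs, Instr.OnlyRegs]) (by decide) (by decide)
    (by decide) (by decide) (by decide) (by decide) (by decide) (by decide) hs.reg1 hs.reg3
    (by simp [h14]) ?_ ?_).weaken le_rfl ?_
  · intro k s' x y h'
    simpa using h'
  · intro k s' hk h hflag h10
    have hst := hs.of_agreeOff h (by decide) (by decide) (by decide) (by decide)
    set u := nbhdVertex A v k with hu
    have hsl : s'.sarr 0 k = G.neighborFinset u := hst.sarr0 k hk
    have hS : s'.sreg 3 = s.sreg 3 := h.sreg 3 (by decide)
    have hstep : (∀ i < k + 1, ¬ s.sreg 3 ⊆ G.neighborFinset (nbhdVertex A v i)) ↔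
        (∀ i < k, ¬ s.sreg 3 ⊆ G.neighborFinset (nbhdVertex A v i)) ∧
          ¬ s.sreg 3 ⊆ G.neighborFinset u := by
      constructor
      · exact fun h => ⟨fun i hi => h i (by omega), h k (by omega)⟩
      · rintro ⟨h1, h2⟩ i hi
        rcases Nat.lt_succ_iff_lt_or_eq.1 hi with h | rfl
        · exact h1 i h
        · exact h2
    refine (haltsWith_of_loopFree (by simp [testMaximal, skip, block, Prog.LoopFree]) ?_).weaken
      (B := testMaximal.cost) (by simp [testMaximal, skip, block, Prog.cost]) fun _ h => h
    rw [hstep, ← hflag]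
    simp only [testMaximal, skip, block, Prog.effect, Instr.exec]
    by_cases hsub : s.sreg 3 ⊆ G.neighborFinset u
    · simp [h10, hsl, hS, hsub]
    · simp [h10, hsl, hS, hsub]
  · rintro s' ⟨h, hflag⟩
    refine ⟨h, hflag.trans ⟨fun h w hw => ?_, fun h i hi =>
      h _ (hA.mem_nbhdFinset_iff.2 ⟨i, hi, rfl⟩)⟩⟩
    obtain ⟨i, hi, rfl⟩ := hA.mem_nbhdFinset_iff.1 hw
    exact h i hi

/-- The state after the vertices in `l` have been visited (latest first), where `D` lists the
maximal cliques found so far. -/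
structure CliquesFound (G : SimpleGraph (Fin n)) [DecidableRel G.Adj] (A : Fin n → List (Fin n))
    (v : Fin n) (l : List (Fin n)) (D : List (Finset (Fin n))) (s : State n) : Prop
    extends NbhdsStored G A v s where
  isMCS : IsMCS G (nbhdFinset G v) l
  sreg1 : s.sreg 1 = l.toFinset
  reg15 : s.reg 15 = D.length
  sarr1 : ∀ j (h : j < D.length), s.sarr 1 j = D[j]
  nodes : ∀ Q, Q ∈ s.nodes ↔ Q ∈ D
  nodup : D.Nodup
  length_le : D.length ≤ l.length
  mem_iff : ∀ Q, Q ∈ D ↔ (∃ u t, (u :: t) <:+ l ∧ Q = cliqueAt G u t.toFinset) ∧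
    ∀ w ∈ nbhdFinset G v, ¬ Q ⊆ G.neighborFinset w

lemma CliquesFound.update {l : List (Fin n)} {D : List (Finset (Fin n))} {s : State n}
    (h : CliquesFound G A v l D s) (x y : ℕ) :
    CliquesFound G A v l D
      { s with reg := Function.update (Function.update s.reg 5 x) 6 y } where
  reg1 := by simpa using h.reg1
  reg3 := by simpa using h.reg3
  reg4 := by simpa using h.reg4
  sreg5 := h.sreg5
  sarr2 := h.sarr2
  edges := h.edges
  arr0 := h.arr0
  sarr0 := h.sarr0
  isMCS := h.isMCS
  sreg1 := h.sreg1
  reg15 := by simpa using h.reg15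
  sarr1 := h.sarr1
  nodes := h.nodes
  nodup := h.nodup
  length_le := h.length_le
  mem_iff := h.mem_iff

lemma haltsWith_visitVertex (hA : IsAdjList G A) {l : List (Fin n)} {D : List (Finset (Fin n))}
    {s : State n} (h : CliquesFound G A v l D s) (hl : l.length < (A v).length + 1) :
    HaltsWith A visitVertex s (((A v).length + 1) * 27 + 15) fun s' =>
      s'.reg 5 = s.reg 5 ∧ ∃ u D', CliquesFound G A v (u :: l) D' s' := by
  have hex : ∃ w ∈ nbhdFinset G v, w ∉ l.toFinset := by
    by_contra! hcon
    have h1 := Finset.card_le_card (show nbhdFinset G v ⊆ l.toFinset from hcon)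
    have h2 := l.toFinset_card_le
    rw [hA.card_nbhdFinset] at h1
    omega
  have hstart : HaltsWith A (block [.const 12 0]) s 1 fun s' =>
      AgreeOff [12] [] s s' ∧ s'.reg 12 = 0 :=
    (haltsWith_of_loopFree (by simp [block, Prog.LoopFree])
      (by simp [block, Prog.effect, Instr.exec])).agreeOff _ _
      (by simp [block, Prog.OnlyRegs, Instr.OnlyRegs]) (by decide) (by decide)
  refine (hstart.seq (B' := (((A v).length + 1) * 18 + 3) + (3 + ((((A v).length + 1) * 9 + 3) + 5)))
    fun s₁ ⟨h1, h12⟩ => ?_).weaken (by omega) fun _ h => h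
  have hst1 : NbhdsStored G A v s₁ :=
    h.toNbhdsStored.of_agreeOff h1 (by decide) (by decide) (by decide) (by decide)
  have hS1 : s₁.sreg 1 = l.toFinset := (h1.sreg 1 (by decide)).trans h.sreg1
  refine (haltsWith_compareVertex_loop hA hst1 h12 (by rwa [hS1])).seq fun s₂ ⟨h2, u, hu, hul, h13,
    h3, hmax⟩ => ?_
  rw [hS1] at hul h3 hmax
  have hS2 : s₂.sreg 1 = l.toFinset := (h2.sreg 1 (by decide)).trans hS1
  have hst2 : NbhdsStored G A v s₂ :=
    hst1.of_agreeOff h2 (by decide) (by decide) (by decide) (by decide)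
  set Q := cliqueAt G u l.toFinset with hQ
  have hmid : HaltsWith A (block [.sinsert 3 13, .sinsert 1 13, .const 14 1]) s₂ 3 fun s' =>
      AgreeOff [14] [1, 3] s₂ s' ∧ s'.reg 14 = 1 ∧ s'.sreg 3 = Q ∧
        s'.sreg 1 = (u :: l).toFinset := by
    refine (haltsWith_of_loopFree (by simp [block, Prog.LoopFree]) ?_).agreeOff _ _
      (by simp [block, Prog.OnlyRegs, Instr.OnlyRegs]) (by decide) (by decide)
    simp [block, Prog.effect, Instr.exec, h13, h3, hS2, hQ, cliqueAt]
  refine hmid.seq fun s₃ ⟨h3', h14, hQ3, hS3⟩ => ?_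
  have hst3 : NbhdsStored G A v s₃ :=
    hst2.of_agreeOff h3' (by decide) (by decide) (by decide) (by decide)
  refine (haltsWith_testMaximal_loop hA hst3 h14).seq fun s₄ ⟨h4, hflag⟩ => ?_
  have hst4 : NbhdsStored G A v s₄ :=
    hst3.of_agreeOff h4 (by decide) (by decide) (by decide) (by decide)
  rw [hQ3] at hflag
  have hreg : ∀ r, r ∉ [7, 8, 9, 10, 11, 12, 13, 14, 20] → s₄.reg r = s.reg r := by
    intro r hr
    simp only [List.mem_cons, not_or, List.not_mem_nil, not_false_eq_true, and_true] at hr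
    rw [h4.reg r (by simp [hr]), h3'.reg r (by simp [hr]), h2.reg r (by simp [hr]),
      h1.reg r (by simp [hr])]
  have h4Q : s₄.sreg 3 = Q := (h4.sreg 3 (by decide)).trans hQ3
  have h4S : s₄.sreg 1 = (u :: l).toFinset := (h4.sreg 1 (by decide)).trans hS3
  have h415 : s₄.reg 15 = D.length := (hreg 15 (by decide)).trans h.reg15
  have h4sarr : s₄.sarr = s.sarr := by rw [h4.sarr, h3'.sarr, h2.sarr, h1.sarr]
  have h4nodes : s₄.nodes = s.nodes := by rw [h4.nodes, h3'.nodes, h2.nodes, h1.nodes]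
  have hmcs : IsMCS G (nbhdFinset G v) (u :: l) :=
    .cons h.isMCS hu (by simpa using hul) fun w hw hwl => hmax w hw (by simpa using hwl)
  have hsuff : ∀ Q', (∃ u' t, (u' :: t) <:+ (u :: l) ∧ Q' = cliqueAt G u' t.toFinset) ↔
      Q' = Q ∨ ∃ u' t, (u' :: t) <:+ l ∧ Q' = cliqueAt G u' t.toFinset := by
    intro Q'
    constructor
    · rintro ⟨u', t, hs, rfl⟩
      rcases List.suffix_cons_iff.1 hs with hs | hs
      · simp only [List.cons.injEq] at hs
        exact Or.inl (by rw [hs.1, hs.2])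
      · exact Or.inr ⟨u', t, hs, rfl⟩
    · rintro (rfl | ⟨u', t, hs, rfl⟩)
      · exact ⟨u, l, List.suffix_rfl, rfl⟩
      · exact ⟨u', t, hs.trans (List.suffix_cons _ _), rfl⟩
  refine (haltsWith_of_loopFree (by simp [skip, block, Prog.LoopFree]) ?_).weaken (B' := 5)
    (by simp [skip, block, Prog.cost]) fun _ h => h
  by_cases h0 : s₄.reg 14 = 0
  · have hnot : ¬ ∀ w ∈ nbhdFinset G v, ¬ Q ⊆ G.neighborFinset w := fun h' => hflag.2 h' h0
    simp only [Prog.effect, h0, if_true, skip, Instr.exec]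
    refine ⟨by simpa using hreg 5 (by decide), u, D, ⟨?_, hmcs, h4S, by simpa using h415,
      by rw [h4sarr]; exact h.sarr1, by rw [h4nodes]; exact h.nodes, h.nodup,
      h.length_le.trans (by simp), ?_⟩⟩
    · exact hst4.of_agreeOff (Instr.agreeOff_exec (A := A) (i := .const 20 0) trivial
        (R := [20]) (S := []) (by simp [Instr.regs]) (by simp [Instr.sregs]) s₄)
        (by decide) (by decide) (by decide) (by decide)
    · intro Q'
      rw [h.mem_iff, hsuff]
      constructor
      · exact fun ⟨h1, h2⟩ => ⟨Or.inr h1, h2⟩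
      · rintro ⟨rfl | h1, h2⟩
        · exact absurd h2 hnot
        · exact ⟨h1, h2⟩
  · have hyes := hflag.1 h0
    have hQD : Q ∉ D := by
      intro hQD
      obtain ⟨⟨u', t, hs, hQ'⟩, -⟩ := (h.mem_iff Q).1 hQD
      have huQ : u ∈ cliqueAt G u' t.toFinset := hQ' ▸ Finset.mem_insert_self _ _
      have hsub : cliqueAt G u' t.toFinset ⊆ l.toFinset := by
        intro w hw
        simp only [cliqueAt, Finset.mem_insert, Finset.mem_inter, List.mem_toFinset] at hw ⊢
        exact hs.subset (by simp; tauto)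
      exact hul (hsub huQ)
    simp only [Prog.effect, h0, if_false, block, Instr.exec, h4Q, h415]
    refine ⟨by simpa using hreg 5 (by decide), u, D ++ [Q], ?_⟩
    constructor
    · constructor
      · simpa using hst4.reg1
      · simpa using hst4.reg3
      · simpa using hst4.reg4
      · exact hst4.sreg5
      · simpa using hst4.sarr2
      · exact hst4.edges
      · exact hst4.arr0
      · simpa using hst4.sarr0
    · exact hmcs
    · exact h4S
    · simp [hst4.reg1]
    · intro j hj
      rw [List.length_append, List.length_singleton] at hj
      by_cases hjD : j = D.length
      · subst hjD; simp
      · have hj' : j < D.length := by omega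
        simp only [Function.update_self, ne_eq, hjD, not_false_eq_true, Function.update_of_ne]
        rw [h4sarr, h.sarr1 j hj', List.getElem_append_left hj']
    · intro Q'
      simp [h4nodes, h.nodes, or_comm]
    · simpa [List.nodup_append] using ⟨h.nodup, fun a ha h => hQD (h ▸ ha)⟩
    · simpa using h.length_le
    · intro Q'
      rw [List.mem_append, List.mem_singleton, h.mem_iff, hsuff]
      constructor
      · rintro (⟨h1, h2⟩ | rfl)
        · exact ⟨Or.inr h1, h2⟩
        · exact ⟨Or.inl rfl, hyes⟩
      · rintro ⟨rfl | h1, h2⟩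
        · exact Or.inr rfl
        · exact Or.inl ⟨h1, h2⟩

lemma haltsWith_findCliques (hA : IsAdjList G A) {s : State n}
    (hs : NbhdsRead A v ((A v).length + 1) s) :
    HaltsWith A findCliques s
      (((A v).length + 1) * ((((A v).length + 1) * 27 + 15) + 3) + 3) fun s' =>
      ∃ l D, CliquesFound G A v l D s' ∧ l.toFinset = nbhdFinset G v := by
  refine (haltsWith_forLoop (i := 5) (c := 6) (b := 3) (p := visitVertex)
    (N := (A v).length + 1) (B := ((A v).length + 1) * 27 + 15)
    (fun k s' => ∃ l D, CliquesFound G A v l D s' ∧ l.length = k) (by decide) (by decide)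
    ⟨[], [], ?_, rfl⟩ ?_ ?_ ?_).weaken le_rfl ?_
  · refine ⟨⟨hs.reg1, hs.reg3, hs.reg4, hs.sreg5, hs.sarr2, hs.edges, hs.arr0, ?_⟩, .nil,
      by simp [hs.sreg1], by simp [hs.reg15], by simp, by simp [hs.nodes], by simp, le_rfl, by simp⟩
    intro i hi
    rw [hs.sarr0 i hi, hA.toFinset_eq]
  · rintro k s' ⟨l, D, h, -⟩
    exact ⟨h.reg1, h.reg3⟩
  · rintro k s' x y ⟨l, D, h, hk⟩
    exact ⟨l, D, h.update x y, hk⟩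
  · rintro k s' hk ⟨l, D, h, rfl⟩ h5
    refine (haltsWith_visitVertex hA h hk).weaken le_rfl ?_
    rintro s'' ⟨h5', u, D', h'⟩
    exact ⟨h5'.trans h5, u :: l, D', h', by simp⟩
  · rintro s' ⟨l, D, h, hl⟩
    refine ⟨l, D, h, Finset.eq_of_subset_of_card_le h.isMCS.subset ?_⟩
    rw [List.toFinset_card_of_nodup h.isMCS.nodup, hA.card_nbhdFinset, hl]

end FindCliques

/-! ### Growing the tree -/

section GrowTree

/-- Set register `18` to a nonzero number if the edge between the set registers `a` and `b` precedes
strictly the one between `c` and `d`, and to zero otherwise. -/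
def compareEdges (a b c d : ℕ) : Prog :=
  .seq (block [.sinter 10 a b, .scard 19 10, .sinter 10 c d, .scard 20 10, .sub 18 19 20])
    (.branch 18 skip (.seq (block [.sub 18 20 19])
      (.branch 18 (block [.const 18 0]) (block [.sunion 10 a b, .sunion 11 c d, .slex 18 10 11]))))

/-- One step of the search for the best edge that leaves the tree: for the clique number `j`
(register `10`), replace its best neighbour in the tree (set array `2`) by the newest node of the
tree (set register `4`) if that one is better, and compare the resulting edge with the best edge
so far (set registers `6` and `7`; register `17` holds the number of its first end). -/
def scanClique : Prog :=
  .seq (block [.sload 8 1 10, .sload 9 2 10])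
    (.seq (compareEdges 8 4 8 9)
      (.seq (.branch 18 (block [.sunion 9 4 4, .sstore 2 10 4]) skip)
        (.seq (compareEdges 8 9 6 7)
          (.branch 18 (block [.sunion 6 8 8, .sunion 7 9 9, .add 17 10 4]) skip))))

/-- Add the best edge that leaves the tree. The clique that is added to the tree is overwritten by
`∅` in set array `1`: edges at `∅` have weight `0`, so they are never chosen. -/
def addBestEdge : Prog :=
  .seq (block [.sempty 6, .sempty 7]) (.seq (forLoop 10 11 15 scanClique)
    (block [.emitEdge 6 7, .sunion 4 6 6, .sstore 1 17 5]))

/-- Grow a spanning tree of the cliques in set array `1`, starting from the first one. -/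
def growTree : Prog :=
  .seq (block [.sload 4 1 4, .sstore 1 4 5, .sub 16 15 1]) (forLoop 5 6 16 addBestEdge)

variable {n : ℕ} {A : Fin n → List (Fin n)} {G : SimpleGraph (Fin n)} {v : Fin n}

lemma not_precedes_iff {V : Type*} [LinearOrder V] {e f : Sym2 (Finset V)} :
    ¬ Precedes f e ↔ weight f < weight e ∨ (weight e = weight f ∧ endsList e < endsList f) := by
  unfold Precedes
  rw [not_or, not_and, not_lt, not_le]
  constructor
  · rintro ⟨h1, h2⟩
    rcases h1.lt_or_eq with h | h
    · exact Or.inl h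
    · exact Or.inr ⟨h.symm, h2 h⟩
  · rintro (h | ⟨h1, h2⟩)
    · exact ⟨h.le, fun h' => absurd h' h.ne⟩
    · exact ⟨h1.ge, fun _ => h2⟩

lemma haltsWith_compareEdges {a b c d : ℕ} (ha : a < 10) (hb : b < 10) (hc : c < 10) (hd : d < 10)
    (s : State n) : HaltsWith A (compareEdges a b c d) s 13 fun s' =>
      AgreeOff [18, 19, 20] [10, 11] s s' ∧
        (s'.reg 18 ≠ 0 ↔ ¬ Precedes s(s.sreg c, s.sreg d) s(s.sreg a, s.sreg b)) := by
  refine ((haltsWith_of_loopFree (by simp [compareEdges, skip, block, Prog.LoopFree])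
    ?_).weaken (B := (compareEdges a b c d).cost) (by simp [compareEdges, skip, block, Prog.cost])
    fun _ h => h).agreeOff _ _ (by simp [compareEdges, skip, block, Prog.OnlyRegs, Instr.OnlyRegs])
    (by simp [compareEdges, skip, block, Prog.regs, Instr.regs])
    (by simp [compareEdges, skip, block, Prog.sregs, Instr.sregs])
  rw [not_precedes_iff, weight_mk, weight_mk, endsList_mk, endsList_mk]
  have h10 : ∀ x < 10, x ≠ 10 := fun x hx => by omega
  simp only [compareEdges, skip, block, Prog.effect, Instr.exec, Function.update_self, ne_eq,
    Nat.reduceEqDiff, not_false_eq_true, Function.update_of_ne, h10 a ha, h10 b hb, h10 c hc,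
    h10 d hd]
  rcases lt_trichotomy (s.sreg a ∩ s.sreg b).card (s.sreg c ∩ s.sreg d).card with h | h | h
  · have h1 : (s.sreg a ∩ s.sreg b).card - (s.sreg c ∩ s.sreg d).card = 0 := by omega
    have h2 : (s.sreg c ∩ s.sreg d).card - (s.sreg a ∩ s.sreg b).card ≠ 0 := by omega
    simp only [h1, h2, if_true, if_false, Function.update_self]
    simp [h.not_gt, h.ne]
  · simp [h]
  · have h1 : (s.sreg a ∩ s.sreg b).card - (s.sreg c ∩ s.sreg d).card ≠ 0 := by omega
    simp only [h1, if_false]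
    simp [h, h1]

/-- The state `s` with the contents that set array `2` has in `s₀`. -/
def State.withParentsOf (s₀ s : State n) : State n :=
  { s with sarr := Function.update s.sarr 2 (s₀.sarr 2) }

lemma haltsWith_scanClique {s : State n} (h4 : s.reg 4 = 0) {j : ℕ} (h10 : s.reg 10 = j) :
    HaltsWith A scanClique s 39 fun s' =>
      AgreeOff [17, 18, 19, 20] [6, 7, 8, 9, 10, 11] s (s.withParentsOf s') ∧
      ∃ p, s'.sarr 2 = Function.update (s.sarr 2) j p ∧ (p = s.sreg 4 ∨ p = s.sarr 2 j) ∧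
        Precedes s(s.sarr 1 j, p) s(s.sarr 1 j, s.sreg 4) ∧
        Precedes s(s.sarr 1 j, p) s(s.sarr 1 j, s.sarr 2 j) ∧
        ((s'.sreg 6 = s.sarr 1 j ∧ s'.sreg 7 = p ∧ s'.reg 17 = j ∧
            ¬ Precedes s(s.sreg 6, s.sreg 7) s(s.sarr 1 j, p)) ∨
          (s'.sreg 6 = s.sreg 6 ∧ s'.sreg 7 = s.sreg 7 ∧ s'.reg 17 = s.reg 17 ∧
            Precedes s(s.sreg 6, s.sreg 7) s(s.sarr 1 j, p))) := by
  have hload : HaltsWith A (block [.sload 8 1 10, .sload 9 2 10]) s 2 fun s' =>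
      AgreeOff [] [8, 9] s s' ∧ s'.sreg 8 = s.sarr 1 j ∧ s'.sreg 9 = s.sarr 2 j := by
    refine (haltsWith_of_loopFree (by simp [block, Prog.LoopFree]) ?_).agreeOff _ _
      (by simp [block, Prog.OnlyRegs, Instr.OnlyRegs]) (by decide) (by decide)
    simp [block, Prog.effect, Instr.exec, h10]
  refine (hload.seq (B' := 13 + (4 + (13 + 5))) fun s₁ ⟨h1, h18, h19⟩ => ?_).weaken (by omega)
    fun _ h => h
  refine (haltsWith_compareEdges (by decide) (by decide) (by decide) (by decide) s₁).seq
    fun s₂ ⟨h2, hcmp⟩ => ?_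
  have h14 : s₁.sreg 4 = s.sreg 4 := h1.sreg 4 (by decide)
  rw [h18, h19, h14] at hcmp
  have h2j : s₂.reg 10 = j := by rw [h2.reg 10 (by decide), h1.reg 10 (by decide), h10]
  have h24 : s₂.sreg 4 = s.sreg 4 := (h2.sreg 4 (by decide)).trans h14
  have h29 : s₂.sreg 9 = s.sarr 2 j := (h2.sreg 9 (by decide)).trans h19
  have h2s : s₂.sarr = s.sarr := by rw [h2.sarr, h1.sarr]
  have hupd : HaltsWith A (.branch 18 (block [.sunion 9 4 4, .sstore 2 10 4]) skip) s₂ 4 fun s' =>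
      ∃ p, (p = s.sreg 4 ∨ p = s.sarr 2 j) ∧
        Precedes s(s.sarr 1 j, p) s(s.sarr 1 j, s.sreg 4) ∧
        Precedes s(s.sarr 1 j, p) s(s.sarr 1 j, s.sarr 2 j) ∧
        (∀ r, r ≠ 20 → s'.reg r = s₂.reg r) ∧ s'.sreg = Function.update s₂.sreg 9 p ∧
        s'.arr = s₂.arr ∧
        s'.sarr = Function.update s.sarr 2 (Function.update (s.sarr 2) j p) ∧
        s'.nodes = s₂.nodes ∧ s'.edges = s₂.edges := by
    refine (haltsWith_of_loopFree (by simp [skip, block, Prog.LoopFree]) ?_).weaken (B' := 4)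
      (by simp [skip, block, Prog.cost]) fun _ h => h
    by_cases h0 : s₂.reg 18 = 0
    · simp only [Prog.effect, h0, if_true, skip, Instr.exec]
      have hp : Precedes s(s.sarr 1 j, s.sarr 2 j) s(s.sarr 1 j, s.sreg 4) := by
        by_contra hn
        exact hcmp.2 hn h0
      refine ⟨s.sarr 2 j, Or.inr rfl, hp, precedes_refl _, fun r hr => Function.update_of_ne hr _ _,
        ?_, trivial, ?_, trivial, trivial⟩
      · rw [← h29, Function.update_eq_self]
      · rw [Function.update_eq_self, Function.update_eq_self, h2s]
    · simp only [Prog.effect, h0, if_false, block, Instr.exec]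
      have hp : Precedes s(s.sarr 1 j, s.sreg 4) s(s.sarr 1 j, s.sarr 2 j) :=
        (precedes_total _ _).resolve_right (hcmp.1 h0)
      refine ⟨s.sreg 4, Or.inl rfl, precedes_refl _, hp, fun _ _ => trivial, ?_, trivial, ?_, trivial,
        trivial⟩
      · rw [h24, Finset.union_self]
      · simp [h2s, h24, h2j]
  refine hupd.seq fun s₃ ⟨p, hp, hp1, hp2, h3r, h3s, h3a, h3sa, h3n, h3e⟩ => ?_
  refine (haltsWith_compareEdges (by decide) (by decide) (by decide) (by decide) s₃).seq
    fun s₄ ⟨h4', hcmp'⟩ => ?_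
  have h38 : s₃.sreg 8 = s.sarr 1 j := by
    rw [h3s, Function.update_of_ne (by decide), h2.sreg 8 (by decide), h18]
  have h39 : s₃.sreg 9 = p := by rw [h3s, Function.update_self]
  have hsreg : ∀ a, a ∉ [8, 9, 10, 11] → s₄.sreg a = s.sreg a := by
    intro a ha
    simp only [List.mem_cons, not_or, List.not_mem_nil, not_false_eq_true, and_true] at ha
    rw [h4'.sreg a (by simp [ha]), h3s, Function.update_of_ne ha.2.1, h2.sreg a (by simp [ha]),
      h1.sreg a (by simp [ha])]
  have hs3 : ∀ a, a ∉ [8, 9, 10, 11] → s₃.sreg a = s.sreg a := by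
    intro a ha
    rw [← hsreg a ha, h4'.sreg a]
    simp only [List.mem_cons, not_or, List.not_mem_nil, not_false_eq_true, and_true] at ha ⊢
    simp [ha]
  have hreg : ∀ r, r ∉ [18, 19, 20] → s₄.reg r = s.reg r := by
    intro r hr
    rw [h4'.reg r hr]
    have hr' := hr
    simp only [List.mem_cons, not_or] at hr
    rw [h3r r hr.2.2.1, h2.reg r hr', h1.reg r (by simp)]
  rw [h38, h39, hs3 6 (by decide), hs3 7 (by decide)] at hcmp'
  have h4sa : s₄.sarr = Function.update s.sarr 2 (Function.update (s.sarr 2) j p) := by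
    rw [h4'.sarr, h3sa]
  have h48 : s₄.sreg 8 = s.sarr 1 j := by rw [h4'.sreg 8 (by decide), h38]
  have h49 : s₄.sreg 9 = p := by rw [h4'.sreg 9 (by decide), h39]
  refine (haltsWith_of_loopFree (by simp [skip, block, Prog.LoopFree]) ?_).weaken (B' := 5)
    (by simp [skip, block, Prog.cost]) fun _ h => h
  by_cases h0 : s₄.reg 18 = 0
  · simp only [Prog.effect, h0, if_true, skip, Instr.exec]
    refine ⟨⟨fun r hr => ?_, fun a ha => ?_, ?_, ?_, ?_, ?_⟩, p, by simp [h4sa], hp, hp1, hp2,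
      Or.inr ⟨hsreg 6 (by decide), hsreg 7 (by decide), ?_, ?_⟩⟩
    · simp only [List.mem_cons, not_or, List.not_mem_nil, not_false_eq_true, and_true] at hr
      simp [State.withParentsOf, hr, hreg]
    · simp only [List.mem_cons, not_or, List.not_mem_nil, not_false_eq_true, and_true] at ha
      simp [State.withParentsOf, ha, hsreg]
    · simp [State.withParentsOf, h4'.arr, h3a, h2.arr, h1.arr]
    · simp [State.withParentsOf, h4sa]
    · simp [State.withParentsOf, h4'.nodes, h3n, h2.nodes, h1.nodes]
    · simp [State.withParentsOf, h4'.edges, h3e, h2.edges, h1.edges]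
    · simp [hreg]
    · by_contra hn
      exact hcmp'.2 hn h0
  · simp only [Prog.effect, h0, if_false, block, Instr.exec]
    refine ⟨⟨fun r hr => ?_, fun a ha => ?_, ?_, ?_, ?_, ?_⟩, p, by simp [h4sa], hp, hp1, hp2,
      Or.inl ⟨?_, ?_, ?_, hcmp'.1 h0⟩⟩
    · simp only [List.mem_cons, not_or, List.not_mem_nil, not_false_eq_true, and_true] at hr
      simp [State.withParentsOf, hr, hreg]
    · simp only [List.mem_cons, not_or, List.not_mem_nil, not_false_eq_true, and_true] at ha
      simp [State.withParentsOf, ha, hsreg]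
    · simp [State.withParentsOf, h4'.arr, h3a, h2.arr, h1.arr]
    · simp [State.withParentsOf, h4sa]
    · simp [State.withParentsOf, h4'.nodes, h3n, h2.nodes, h1.nodes]
    · simp [State.withParentsOf, h4'.edges, h3e, h2.edges, h1.edges]
    · simp [h48]
    · simp [h49]
    · simp [hreg, h10, h4]

/-- The graph on the cliques that is described by a list of pairs. -/
def pairGraph (l : List (Finset (Fin n) × Finset (Fin n))) : SimpleGraph (Finset (Fin n)) where
  Adj K L := K ≠ L ∧ ((K, L) ∈ l ∨ (L, K) ∈ l)
  symm := ⟨fun _ _ h => ⟨h.1.symm, h.2.symm⟩⟩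
  loopless := ⟨fun _ h => h.1 rfl⟩

/-- The state when the tree has the node set `N`. The newest node of the tree is in set register
`4`, and set array `2` holds the best neighbour of each outside clique among the other nodes of the
tree, or `∅` if there are none. -/
structure TreeGrown (D : List (Finset (Fin n))) (T : SimpleGraph (Finset (Fin n)))
    (N : Finset (Finset (Fin n))) (s : State n) : Prop where
  reg1 : s.reg 1 = 1
  reg4 : s.reg 4 = 0
  reg15 : s.reg 15 = D.length
  reg16 : s.reg 16 = D.length - 1
  sreg5 : s.sreg 5 = ∅
  nodes : ∀ Q, Q ∈ s.nodes ↔ Q ∈ D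
  newest_mem : s.sreg 4 ∈ N
  subset : ∀ M ∈ N, M ∈ D
  outside : ∀ j (h : j < D.length), s.sarr 1 j = if D[j] ∈ N then ∅ else D[j]
  parent_mem : ∀ j (h : j < D.length), D[j] ∉ N → s.sarr 2 j = ∅ ∨ s.sarr 2 j ∈ N.erase (s.sreg 4)
  parent_min : ∀ j (h : j < D.length), D[j] ∉ N → ∀ M ∈ N.erase (s.sreg 4),
    Precedes s(D[j], s.sarr 2 j) s(D[j], M)
  edges_adj : ∀ e ∈ s.edges, T.Adj e.1 e.2
  reachable : ∀ M ∈ N, ∀ M' ∈ N, (pairGraph s.edges).Reachable M M'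

/-- Scanning all cliques finds the best neighbour in the tree for each clique outside, and an edge
that leaves the tree and precedes all others. -/
lemma haltsWith_scanClique_loop {D : List (Finset (Fin n))} {T : SimpleGraph (Finset (Fin n))}
    {N : Finset (Finset (Fin n))} (hv : ∀ Q ∈ D, v ∈ Q) {s : State n} (hs : TreeGrown D T N s)
    (h6 : s.sreg 6 = ∅) (h7 : s.sreg 7 = ∅) (hex : ∃ Q ∈ D, Q ∉ N) :
    HaltsWith A (forLoop 10 11 15 scanClique) s (D.length * 42 + 3) fun s' =>
      AgreeOff [10, 11, 17, 18, 19, 20] [6, 7, 8, 9, 10, 11] s (s.withParentsOf s') ∧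
      (∀ j (h : j < D.length), D[j] ∉ N → s'.sarr 2 j ∈ N ∧
        ∀ M ∈ N, Precedes s(D[j], s'.sarr 2 j) s(D[j], M)) ∧
      ∃ j, ∃ h : j < D.length, D[j] ∉ N ∧ s'.reg 17 = j ∧ s'.sreg 6 = D[j] ∧ s'.sreg 7 ∈ N ∧
        ∀ Q ∈ D, Q ∉ N → ∀ M ∈ N, Precedes s(D[j], s'.sreg 7) s(Q, M) := by
  have hpos : ∀ Q ∈ D, ∀ M ∈ N, 0 < weight s(Q, M) := by
    intro Q hQ M hM
    rw [weight_mk, Finset.card_pos]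
    exact ⟨v, Finset.mem_inter.2 ⟨hv Q hQ, hv M (hs.subset M hM)⟩⟩
  have hempty : ∀ M : Finset (Fin n), weight s(∅, M) = 0 := by intro M; simp
  have hempty' : ∀ M : Finset (Fin n), weight s(M, ∅) = 0 := by intro M; simp
  refine (haltsWith_forLoop (i := 10) (c := 11) (b := 15) (p := scanClique) (N := D.length)
    (B := 39) (fun k s' =>
      AgreeOff [10, 11, 17, 18, 19, 20] [6, 7, 8, 9, 10, 11] s (s.withParentsOf s') ∧
      (∀ j, k ≤ j → s'.sarr 2 j = s.sarr 2 j) ∧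
      (∀ j (h : j < D.length), j < k → D[j] ∉ N → s'.sarr 2 j ∈ N ∧
        (∀ M ∈ N, Precedes s(D[j], s'.sarr 2 j) s(D[j], M)) ∧
        Precedes s(s'.sreg 6, s'.sreg 7) s(D[j], s'.sarr 2 j)) ∧
      ((s'.sreg 6 = ∅ ∧ s'.sreg 7 = ∅) ∨ ∃ j, ∃ h : j < D.length, D[j] ∉ N ∧ s'.reg 17 = j ∧
        s'.sreg 6 = D[j] ∧ s'.sreg 7 ∈ N)) (by decide) (by decide)
    ⟨⟨fun _ _ => rfl, fun _ _ => rfl, rfl, by simp [State.withParentsOf], rfl, rfl⟩, by simp,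
      by simp, Or.inl ⟨h6, h7⟩⟩ ?_ ?_ ?_).weaken le_rfl ?_
  · rintro k s' ⟨h, -⟩
    exact ⟨(h.reg 1 (by decide)).trans hs.reg1, (h.reg 15 (by decide)).trans hs.reg15⟩
  · rintro k s' x y ⟨h, h1, h2, h3⟩
    exact ⟨h.update (by decide) (by decide) x y, h1, h2, by simpa using h3⟩
  · rintro k s' hk ⟨h, hold, hdone, hbest⟩ h10
    refine (haltsWith_scanClique (s := s') ((h.reg 4 (by decide)).trans hs.reg4) h10).weaken le_rfl ?_
    rintro s'' ⟨h', p, hsarr, hp, hp1, hp2, hnew⟩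
    have h4 : s'.sreg 4 = s.sreg 4 := h.sreg 4 (by decide)
    have harr1 : s'.sarr 1 = s.sarr 1 := by
      have := congrFun h.sarr 1
      simpa [State.withParentsOf] using this
    have harr1k : s'.sarr 1 k = if D[k] ∈ N then ∅ else D[k] := by rw [harr1, hs.outside k hk]
    have harr2k : s'.sarr 2 k = s.sarr 2 k := hold k le_rfl
    have hkeep : ∀ j, j ≠ k → s''.sarr 2 j = s'.sarr 2 j := by
      intro j hj
      rw [hsarr, Function.update_of_ne hj]
    have hk2 : s''.sarr 2 k = p := by rw [hsarr, Function.update_self]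
    have hagree : AgreeOff [10, 11, 17, 18, 19, 20] [6, 7, 8, 9, 10, 11] s (s.withParentsOf s'') := by
      refine ⟨fun r hr => ?_, fun a ha => ?_, h'.arr.trans h.arr, ?_, h'.nodes.trans h.nodes,
        h'.edges.trans h.edges⟩
      · rw [← h.reg r hr]
        refine h'.reg r ?_
        simp only [List.mem_cons, not_or] at hr ⊢
        simp [hr]
      · rw [← h.sreg a ha]
        exact h'.sreg a ha
      · have e1 := h.sarr
        have e2 := h'.sarr
        simp only [State.withParentsOf] at e1 e2 ⊢
        rw [← e1]
        funext i
        by_cases hi : i = 2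
        · subst hi; simp
        · have := congrFun e2 i
          simpa [hi] using this
    refine ⟨by rw [← h10]; exact h'.reg 10 (by decide), hagree, ?_, ?_⟩
    · intro j hj
      rw [hkeep j (by omega), hold j (by omega)]
    by_cases hkN : D[k] ∈ N
    · -- The clique number `k` has already been overwritten by `∅`, which changes nothing.
      rw [harr1k, if_pos hkN] at hnew
      have hlt : ∀ j (h : j < D.length), j < k + 1 → D[j] ∉ N → j < k := by
        intro j hj hjk hjN
        have : j ≠ k := fun h => hjN (by subst h; exact hkN)
        omega
      have hnot : Precedes s(s'.sreg 6, s'.sreg 7) s(∅, p) := by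
        rcases hbest with ⟨h1, h2⟩ | ⟨j, hj, hjN, -, h1, h2⟩
        · rw [h1, h2]
          exact Or.inr ⟨by simp, by
            rw [show endsList s((∅ : Finset (Fin n)), ∅) = [] by simp]
            exact not_lt.1 (List.not_lt_nil _)⟩
        · rw [h1]
          exact Or.inl (by rw [hempty]; exact hpos _ (List.getElem_mem hj) _ h2)
      rcases hnew with ⟨-, -, -, hn⟩ | ⟨e6, e7, e17, -⟩
      · exact absurd hnot hn
      · rw [e6, e7, e17]
        refine ⟨fun j hj hjk hjN => ?_, hbest⟩
        have hjk' := hlt j hj hjk hjN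
        rw [hkeep j hjk'.ne]
        exact hdone j hj hjk' hjN
    · rw [harr1k, if_neg hkN] at hp1 hp2 hnew
      rw [h4] at hp hp1
      rw [harr2k] at hp hp2
      have hkD : D[k] ∈ D := List.getElem_mem hk
      have hpN : p ∈ N := by
        rcases hp with rfl | rfl
        · exact hs.newest_mem
        · rcases hs.parent_mem k hk hkN with h0 | h0
          · exfalso
            have h1 := hp1.weight_le
            rw [h0, hempty'] at h1
            have h2 := hpos _ hkD _ hs.newest_mem
            omega
          · exact Finset.mem_of_mem_erase h0
      have hpmin : ∀ M ∈ N, Precedes s(D[k], p) s(D[k], M) := by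
        intro M hM
        by_cases hMnew : M = s.sreg 4
        · rw [hMnew]; exact hp1
        · exact hp2.trans (hs.parent_min k hk hkN M (Finset.mem_erase.2 ⟨hMnew, hM⟩))
      have hbetter : Precedes s(s''.sreg 6, s''.sreg 7) s(s'.sreg 6, s'.sreg 7) ∧
          Precedes s(s''.sreg 6, s''.sreg 7) s(D[k], p) := by
        rcases hnew with ⟨e6, e7, e17, hn⟩ | ⟨e6, e7, e17, hn⟩
        · rw [e6, e7]
          exact ⟨(precedes_total _ _).resolve_right hn, precedes_refl _⟩
        · rw [e6, e7]
          exact ⟨precedes_refl _, hn⟩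
      constructor
      · intro j hj hjk hjN
        by_cases hjk' : j = k
        · subst hjk'
          rw [hk2]
          exact ⟨hpN, hpmin, hbetter.2⟩
        · rw [hkeep j hjk']
          obtain ⟨a1, a2, a3⟩ := hdone j hj (by omega) hjN
          exact ⟨a1, a2, hbetter.1.trans a3⟩
      · rcases hnew with ⟨e6, e7, e17, hn⟩ | ⟨e6, e7, e17, hn⟩
        · exact Or.inr ⟨k, hk, hkN, e17, e6, by rw [e7]; exact hpN⟩
        · rw [e6, e7, e17]
          exact hbest
  · rintro s' ⟨h, -, hdone, hbest⟩
    refine ⟨h, fun j hj hjN => ⟨(hdone j hj hj hjN).1, (hdone j hj hj hjN).2.1⟩, ?_⟩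
    rcases hbest with ⟨h1, h2⟩ | ⟨j, hj, hjN, h17, h1, h2⟩
    · exfalso
      obtain ⟨Q, hQ, hQN⟩ := hex
      obtain ⟨i, hi, rfl⟩ := List.getElem_of_mem hQ
      obtain ⟨a1, -, a3⟩ := hdone i hi hi hQN
      have h3 := a3.weight_le
      rw [h1, hempty] at h3
      have h4 := hpos _ hQ _ a1
      omega
    · refine ⟨j, hj, hjN, h17, h1, h2, ?_⟩
      intro Q hQ hQN M hM
      obtain ⟨i, hi, rfl⟩ := List.getElem_of_mem hQ
      obtain ⟨a1, a2, a3⟩ := hdone i hi hi hQN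
      rw [← h1]
      exact a3.trans (a2 M hM)

lemma haltsWith_addBestEdge (hch : ChordalOn G (closedNbhd G v)) {D : List (Finset (Fin n))}
    (hD : ∀ Q, Q ∈ D ↔ IsMaxClique G Q ∧ v ∈ Q) (hnd : D.Nodup)
    {T : SimpleGraph (Finset (Fin n))} (hT : IsKruskalTree G v T) {N : Finset (Finset (Fin n))}
    {s : State n} (hs : TreeGrown D T N s) (hex : ∃ Q ∈ D, Q ∉ N) :
    HaltsWith A addBestEdge s (D.length * 42 + 8) fun s' =>
      s'.reg 5 = s.reg 5 ∧ ∃ Q, Q ∉ N ∧ TreeGrown D T (insert Q N) s' := by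
  have hstart : HaltsWith A (block [.sempty 6, .sempty 7]) s 2 fun s' =>
      AgreeOff [] [6, 7] s s' ∧ s'.sreg 6 = ∅ ∧ s'.sreg 7 = ∅ :=
    (haltsWith_of_loopFree (by simp [block, Prog.LoopFree])
      (by simp [block, Prog.effect, Instr.exec])).agreeOff _ _
      (by simp [block, Prog.OnlyRegs, Instr.OnlyRegs]) (by decide) (by decide)
  refine (hstart.seq (B' := (D.length * 42 + 3) + 3) fun s₁ ⟨h1, h16, h17⟩ => ?_).weaken (by omega)
    fun _ h => h
  have hs1 : TreeGrown D T N s₁ := by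
    have e4 : s₁.sreg 4 = s.sreg 4 := h1.sreg 4 (by decide)
    constructor
    · rw [h1.reg 1 (by decide), hs.reg1]
    · rw [h1.reg 4 (by decide), hs.reg4]
    · rw [h1.reg 15 (by decide), hs.reg15]
    · rw [h1.reg 16 (by decide), hs.reg16]
    · rw [h1.sreg 5 (by decide), hs.sreg5]
    · rw [h1.nodes]; exact hs.nodes
    · rw [e4]; exact hs.newest_mem
    · exact hs.subset
    · rw [h1.sarr]; exact hs.outside
    · rw [h1.sarr, e4]; exact hs.parent_mem
    · rw [h1.sarr, e4]; exact hs.parent_min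
    · rw [h1.edges]; exact hs.edges_adj
    · rw [h1.edges]; exact hs.reachable
  refine (haltsWith_scanClique_loop (fun Q hQ => ((hD Q).1 hQ).2) hs1 h16 h17 hex).seq
    fun s₂ ⟨h2, hpar, j, hj, hjN, h217, h26, h27, hmin⟩ => ?_
  refine haltsWith_of_loopFree (p := block [.emitEdge 6 7, .sunion 4 6 6, .sstore 1 17 5])
    (by simp [block, Prog.LoopFree]) ?_
  set Q := D[j] with hQ
  set P := s₂.sreg 7 with hP
  have hQD : Q ∈ D := List.getElem_mem hj
  obtain ⟨hQm, hvQ⟩ := (hD Q).1 hQD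
  obtain ⟨hPm, hvP⟩ := (hD P).1 (hs.subset P h27)
  have hTQP : T.Adj Q P := by
    refine hT.adj_of_forall_precedes hch (S := (N : Set _)) hQm hPm hvQ hvP hjN h27 ?_
    intro M M' hM hM' hvM hvM' hMN hM'N
    exact hmin M ((hD M).2 ⟨hM, hvM⟩) hMN M' hM'N
  have hreg : ∀ r, r ∉ [10, 11, 17, 18, 19, 20] → s₂.reg r = s.reg r := by
    intro r hr
    exact (h2.reg r hr).trans (h1.reg r (by simp))
  have hsreg5 : s₂.sreg 5 = ∅ := (h2.sreg 5 (by decide)).trans hs1.sreg5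
  have hsarr1 : s₂.sarr 1 = s₁.sarr 1 := by
    simpa [State.withParentsOf] using congrFun h2.sarr 1
  have hnodes : s₂.nodes = s₁.nodes := h2.nodes
  have hedges : s₂.edges = s₁.edges := h2.edges
  simp only [block, Prog.effect, Instr.exec]
  refine ⟨hreg 5 (by decide), Q, hjN, ?_⟩
  have hne : ∀ {M}, M ∈ N → M ≠ Q := fun hM h => hjN (h ▸ hM)
  have herase : (insert Q N).erase Q = N := Finset.erase_insert hjN
  constructor
  · exact (hreg 1 (by decide)).trans hs.reg1
  · exact (hreg 4 (by decide)).trans hs.reg4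
  · exact (hreg 15 (by decide)).trans hs.reg15
  · exact (hreg 16 (by decide)).trans hs.reg16
  · simpa using hsreg5
  · rw [hnodes]; exact hs1.nodes
  · simp [h26]
  · intro M hM
    rcases Finset.mem_insert.1 hM with rfl | hM
    · exact hQD
    · exact hs.subset M hM
  · intro i hi
    by_cases hij : i = j
    · subst hij
      simp [h217, hsreg5, hQ]
    · have hiQ : D[i] ≠ Q := fun h => hij ((hnd.getElem_inj_iff).1 h)
      simp only [Function.update_self, h217, Function.update_of_ne hij, hsarr1,
        Finset.mem_insert, hiQ, false_or]
      exact hs1.outside i hi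
  · intro i hi hiN
    rw [Finset.mem_insert, not_or] at hiN
    right
    simp only [Function.update_self, h26, Finset.union_self, herase, ne_eq, Nat.reduceEqDiff,
      not_false_eq_true, Function.update_of_ne]
    exact (hpar i hi hiN.2).1
  · intro i hi hiN
    rw [Finset.mem_insert, not_or] at hiN
    simp only [Function.update_self, h26, Finset.union_self, herase, ne_eq, Nat.reduceEqDiff,
      not_false_eq_true, Function.update_of_ne]
    exact (hpar i hi hiN.2).2
  · intro e he
    rcases List.mem_cons.1 he with rfl | he
    · simpa [h26] using hTQP
    · exact hs1.edges_adj e (hedges ▸ he)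
  · simp only [h26, hedges]
    have hle : pairGraph s₁.edges ≤ pairGraph ((Q, P) :: s₁.edges) := by
      rintro M M' ⟨h, h'⟩
      exact ⟨h, h'.imp (List.mem_cons_of_mem _) (List.mem_cons_of_mem _)⟩
    have hQP : (pairGraph ((Q, P) :: s₁.edges)).Reachable Q P :=
      SimpleGraph.Adj.reachable ⟨hTQP.ne, Or.inl List.mem_cons_self⟩
    have hall : ∀ M ∈ insert Q N, (pairGraph ((Q, P) :: s₁.edges)).Reachable M P := by
      intro M hM
      rcases Finset.mem_insert.1 hM with rfl | hM
      · exact hQP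
      · exact (hs1.reachable M hM P h27).mono hle
    exact fun M hM M' hM' => (hall M hM).trans (hall M' hM').symm

/-- The program `growTree` outputs the Kruskal tree. -/
lemma haltsWith_growTree (hch : ChordalOn G (closedNbhd G v)) {D : List (Finset (Fin n))}
    (hD : ∀ Q, Q ∈ D ↔ IsMaxClique G Q ∧ v ∈ Q) (hnd : D.Nodup)
    {T : SimpleGraph (Finset (Fin n))} (hT : IsKruskalTree G v T) {s : State n}
    (h1 : s.reg 1 = 1) (h4 : s.reg 4 = 0) (h15 : s.reg 15 = D.length) (h5 : s.sreg 5 = ∅)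
    (hsarr1 : ∀ j (h : j < D.length), s.sarr 1 j = D[j]) (hsarr2 : s.sarr 2 = fun _ => ∅)
    (hnodes : ∀ Q, Q ∈ s.nodes ↔ Q ∈ D) (hedges : s.edges = []) :
    HaltsWith A growTree s (D.length * (D.length * 42 + 11) + 6) fun s' =>
      s'.outputGraph.verts = {K | IsMaxClique G K ∧ v ∈ K} ∧ s'.outputGraph.spanningCoe = T := by
  have hlen : 0 < D.length := by
    obtain ⟨K, hK, hKm⟩ := exists_isMaxClique (G := G) (Q := {v}) (by simp)
    exact List.length_pos_of_mem ((hD K).2 ⟨hKm, hK (Finset.mem_singleton_self v)⟩)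
  have hcard : D.toFinset.card = D.length := List.toFinset_card_of_nodup hnd
  have hstart : HaltsWith A (block [.sload 4 1 4, .sstore 1 4 5, .sub 16 15 1]) s 3
      fun s' => ∃ N, N.card = 0 + 1 ∧ TreeGrown D T N s' := by
    refine haltsWith_of_loopFree (by simp [block, Prog.LoopFree]) ?_
    have h0 : s.sarr 1 0 = D[0] := hsarr1 0 hlen
    simp only [block, Prog.effect, Instr.exec, h4, h0]
    refine ⟨{D[0]}, by simp, ?_⟩
    constructor
    · simpa using h1
    · simpa using h4
    · simpa using h15
    · simp [h15, h1]
    · simpa using h5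
    · exact hnodes
    · simp
    · simp
    · intro j hj
      by_cases hj0 : j = 0
      · subst hj0
        simp [h5]
      · have : D[j] ≠ D[0] := fun h => hj0 ((hnd.getElem_inj_iff).1 h)
        simp [hj0, this, hsarr1 j hj]
    · intro j hj _
      left
      simp [hsarr2]
    · simp
    · simp [hedges]
    · intro M hM M' hM'
      rw [Finset.mem_singleton.1 hM, Finset.mem_singleton.1 hM']
  have hmono : (D.length - 1) * ((D.length * 42 + 8) + 3) + 3 ≤ D.length * (D.length * 42 + 11) + 3 :=
    Nat.add_le_add_right (Nat.mul_le_mul (by omega) (by omega)) 3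
  refine (hstart.seq (B' := (D.length - 1) * ((D.length * 42 + 8) + 3) + 3) fun s₁ hs₁ =>
    haltsWith_forLoop (i := 5) (c := 6) (b := 16) (p := addBestEdge) (N := D.length - 1)
    (B := D.length * 42 + 8) (fun k s' => ∃ N, N.card = k + 1 ∧ TreeGrown D T N s') (by decide)
    (by decide) hs₁ ?_ ?_ ?_).weaken (by omega) ?_
  · rintro k s' ⟨N, -, h⟩
    exact ⟨h.reg1, h.reg16⟩
  · rintro k s' x y ⟨N, hN, h⟩
    exact ⟨N, hN, ⟨by simpa using h.reg1, by simpa using h.reg4, by simpa using h.reg15,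
      by simpa using h.reg16, h.sreg5, h.nodes, h.newest_mem, h.subset, h.outside, h.parent_mem,
      h.parent_min, h.edges_adj, h.reachable⟩⟩
  · rintro k s' hk ⟨N, hN, h⟩ hreg5
    have hex : ∃ Q ∈ D, Q ∉ N := by
      by_contra! hcon
      have : D.toFinset.card ≤ N.card :=
        Finset.card_le_card fun Q hQ => hcon Q (List.mem_toFinset.1 hQ)
      omega
    refine (haltsWith_addBestEdge hch hD hnd hT h hex).weaken le_rfl ?_
    rintro s'' ⟨h5'', Q, hQN, h''⟩
    exact ⟨h5''.trans hreg5, insert Q N, by rw [Finset.card_insert_of_notMem hQN, hN], h''⟩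
  · rintro s' ⟨N, hN, h⟩
    have hND : N = D.toFinset := by
      refine Finset.eq_of_subset_of_card_le (fun M hM => List.mem_toFinset.2 (h.subset M hM)) ?_
      omega
    have hmem : ∀ {M}, IsMaxClique G M ∧ v ∈ M → M ∈ N := by
      intro M hM
      rw [hND, List.mem_toFinset, hD]
      exact hM
    constructor
    · ext K
      change (K ∈ s'.nodes ∨ ∃ L, (K, L) ∈ s'.edges ∨ (L, K) ∈ s'.edges) ↔ _
      rw [h.nodes, hD, Set.mem_ofPred_eq]
      constructor
      · rintro (hK | ⟨L, hL | hL⟩)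
        · exact hK
        · exact hT.left_mem (h.edges_adj _ hL)
        · exact hT.left_mem (h.edges_adj _ hL).symm
      · exact Or.inl
    · change pairGraph s'.edges = T
      refine eq_of_le_of_reachable hT.isAcyclic ?_ fun K L hKL =>
        h.reachable K (hmem (hT.left_mem hKL)) L (hmem (hT.left_mem hKL.symm))
      rintro K L ⟨-, hKL | hKL⟩
      · exact h.edges_adj _ hKL
      · exact (h.edges_adj _ hKL).symm

end GrowTree

/-! ### The parallel run -/

section Run

/-- The program of every processor `v`: read `N[v]` and the neighbourhoods of its vertices, find
the maximal cliques that contain `v`, and grow the Kruskal tree on them. -/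
def cliqueTreeProg : Prog :=
  .seq readNbhds (.seq findCliques growTree)

variable {n : ℕ} {G : SimpleGraph (Fin n)} [DecidableRel G.Adj] {A : Fin n → List (Fin n)}

lemma haltsWith_cliqueTreeProg (hA : IsAdjList G A) (v : Fin n)
    (hch : ChordalOn G (closedNbhd G v)) {T : SimpleGraph (Finset (Fin n))}
    (hT : IsKruskalTree G v T) :
    HaltsWith A cliqueTreeProg (initState v) (150 * (G.maxDegree + 1) ^ 2) fun s =>
      s.outputGraph.verts = {K | IsMaxClique G K ∧ v ∈ K} ∧ s.outputGraph.spanningCoe = T := by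
  have hdeg : ∀ u, (A u).length ≤ G.maxDegree := fun u =>
    (hA.length_eq u).trans_le (G.degree_le_maxDegree u)
  refine ((haltsWith_readNbhds v hdeg).seq (B' := (G.maxDegree + 1) *
    ((G.maxDegree + 1) * 27 + 18) + 3 + ((G.maxDegree + 1) * ((G.maxDegree + 1) * 42 + 11) + 6))
    fun s hs => ?_).weaken ?_ fun _ h => h
  · refine ((haltsWith_findCliques hA hs).seq (B' := (G.maxDegree + 1) *
      ((G.maxDegree + 1) * 42 + 11) + 6) ?_).weaken ?_ fun _ h => h
    · rintro s' ⟨l, D, h, hall⟩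
      have hD : ∀ Q, Q ∈ D ↔ IsMaxClique G Q ∧ v ∈ Q := fun Q =>
        (h.mem_iff Q).trans (mem_found_iff hch h.isMCS hall)
      have hlen : D.length ≤ G.maxDegree + 1 := by
        calc D.length ≤ l.length := h.length_le
          _ ≤ (nbhdFinset G v).card := h.isMCS.length_le
          _ = (A v).length + 1 := hA.card_nbhdFinset
          _ ≤ G.maxDegree + 1 := by simpa using hdeg v
      refine (haltsWith_growTree hch hD h.nodup hT h.reg1 h.reg4 h.reg15 h.sreg5 h.sarr1 h.sarr2
        h.nodes h.edges).weaken ?_ fun _ h => h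
      gcongr
    · have := hdeg v
      calc _ = ((A v).length + 1) * (((A v).length + 1) * 27 + 18) + 3 +
            ((G.maxDegree + 1) * ((G.maxDegree + 1) * 42 + 11) + 6) := by ring
        _ ≤ _ := by gcongr
  -- The number of steps is a polynomial of degree two in `Δ + 1` with coefficients that sum to less
  -- than `150`.
  · nlinarith [Nat.zero_le G.maxDegree]

end Run

/-- The bound `(d + 1) ^ 2` is of the order of `d ^ 2 * log d + 1`; for `d ≤ 1` the logarithm
vanishes and only the constant term counts. -/
lemma succ_sq_le (d : ℕ) : ((d : ℝ) + 1) ^ 2 ≤ 4 * ((d : ℝ) ^ 2 * Real.log d + 1) := by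
  rcases Nat.lt_or_ge d 2 with h | h
  · interval_cases d <;> norm_num
  · have h2 : (2 : ℝ) ≤ d := by exact_mod_cast h
    have hlog : (0.69 : ℝ) ≤ Real.log d :=
      (by linarith [Real.log_two_gt_d9] : (0.69 : ℝ) ≤ Real.log 2).trans
        (Real.log_le_log (by norm_num) h2)
    nlinarith [mul_le_mul_of_nonneg_left hlog (sq_nonneg (d : ℝ)), sq_nonneg ((d : ℝ) - 2)]

/-- The edges of `K(B_{3/2}(v))` have only one admissible listing,
since no two of them tie. -/
lemma IsKruskalOrder.unique_ball {n : ℕ} {G : SimpleGraph (Fin n)} {v : Fin n}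
    (hch : ChordalOn G (closedNbhd G v)) {l l' : List (Sym2 (Finset (Fin n)))}
    (h : IsKruskalOrder (cliqueIntersectionGraph (ball G v 3)) l)
    (h' : IsKruskalOrder (cliqueIntersectionGraph (ball G v 3)) l') : l = l' := by
  refine IsKruskalOrder.unique ?_ h h'
  intro e he f hf h1 h2
  induction e using Sym2.ind with | _ K L => ?_
  induction f using Sym2.ind with | _ M N => ?_
  rw [SimpleGraph.Subgraph.mem_edgeSet, cliqueIntersectionGraph_ball_adj] at he hf
  obtain ⟨hKL, hK, hL, hvK, hvL⟩ := he
  exact precedes_antisymm hch hK hL hf.2.1 hf.2.2.1 hvK hvL hKL h1 h2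

end LocChordal

theorem mainTheorem7 :
    ∃ (P : LocChordal.Prog) (C : ℝ),
      ∀ (n : ℕ), 0 < n → ∀ (G : SimpleGraph (Fin n)) [DecidableRel G.Adj]
        (A : Fin n → List (Fin n)), LocChordal.IsAdjList G A →
        ∀ r : ℕ, 3 ≤ r → LocChordal.IsLocallyChordal r G →
          ∃ (T : ℕ) (H : Fin n → LocChordal.NodeGraph (Fin n)),
            LocChordal.ParallelRun P A T H ∧
            (T : ℝ) ≤ C * ((G.maxDegree : ℝ) ^ 2 * Real.log (G.maxDegree : ℝ) + 1) ∧
            (∀ v, ∃ l, LocChordal.IsKruskalOrder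
              (LocChordal.cliqueIntersectionGraph (LocChordal.ball G v 3)) l) ∧
            (∀ v l, LocChordal.IsKruskalOrder
              (LocChordal.cliqueIntersectionGraph (LocChordal.ball G v 3)) l →
                H v = LocChordal.kruskal
                  (LocChordal.cliqueIntersectionGraph (LocChordal.ball G v 3)) l) ∧
            LocChordal.IsAcyclicCliqueGraph r G (⨆ v, H v) := by
  refine ⟨LocChordal.cliqueTreeProg, 600, fun n hn G _ A hA r hr hG => ?_⟩
  have : Nonempty (Fin n) := ⟨⟨0, hn⟩⟩
  have hch := hG.chordalOn_closedNbhd hr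
  have hex : ∀ v, ∃ l, LocChordal.IsKruskalOrder
      (LocChordal.cliqueIntersectionGraph (LocChordal.ball G v 3)) l :=
    fun v => LocChordal.exists_isKruskalOrder _
  choose l hl using hex
  have hT := fun v => LocChordal.isKruskalTree_kruskal (hl v)
  have hverts : ∀ v, (LocChordal.kruskal (LocChordal.cliqueIntersectionGraph
      (LocChordal.ball G v 3)) (l v)).verts = {K | LocChordal.IsMaxClique G K ∧ v ∈ K} := by
    intro v
    rw [(LocChordal.kruskal_spec _ (fun e he => ((hl v).2.1 e).1 he) (hl v).2.2).1]
    exact Set.ext fun K => LocChordal.mem_maxCliques_ball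
  refine ⟨150 * (G.maxDegree + 1) ^ 2, fun v => LocChordal.kruskal
    (LocChordal.cliqueIntersectionGraph (LocChordal.ball G v 3)) (l v), fun v => ?_, ?_,
    fun v => ⟨l v, hl v⟩, fun v l' hl' => ?_,
    LocChordal.isAcyclicCliqueGraph_iSup hr hG hverts hT⟩
  · obtain ⟨t, s, ht, hrun, hV, hE⟩ := LocChordal.haltsWith_cliqueTreeProg hA v (hch v) (hT v)
    exact ⟨t, s, ht, hrun, SimpleGraph.Subgraph.ext (hV.trans (hverts v).symm)
      (congrArg SimpleGraph.Adj hE)⟩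
  · push_cast
    linarith [LocChordal.succ_sq_le G.maxDegree]
  · rw [LocChordal.IsKruskalOrder.unique_ball (hch v) hl' (hl v)]
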